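/- **Setting.** Let $\Omega\subset\mathbb R^2$ be a bounded convex polygonal domain, $\|\cdot\|$ and $(\cdot,\cdot)$ the norm and inner product of $L^2(\Omega)$. Let $\mathcal T_h$ be a conforming triangulation of $\overline\Omega$ with maximal triangle diameter $h$, and let $V_h$ be the space of continuous, piecewise linear (complex-valued) functions on $\mathcal T_h$ vanishing on $\partial\Omega$. For an interior node $P$ let $K_P^*$ be its control volume, i.e. the union over the triangles $K\ni P$ of the quadrilaterals with corners $P$, the midpoints of the two edges of $K$ at $P$, and the barycenter of $K$; put $\Pi_h^*\chi=\sum_P\chi(P)\mathbf 1_{K_P^*}$ (sum over interior nodes) and $(\psi,\chi)_h=(\psi,\Pi_h^*\chi)$. The operators $A_h,\bar A_h,Q_h:V_h\to V_h$ are defined, for all $\psi,\chi\in V_h$, by $$(A_h\psi,\chi)=(\nabla\psi,\nabla\chi),\qquad(\bar A_h\psi,\chi)_h=(\nabla\psi,\nabla\chi),\qquad(\nabla Q_h\psi,\nabla\chi)=(\psi,\chi)_h-(\psi,\chi).$$ For $0<\theta<\pi$ let $\Sigma_\theta=\{z\neq0:|\arg z|<\theta\}$, and let $\Gamma_{\varphi,\delta}=\{\rho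 e^{\pm i\varphi}:\rho\ge\delta\}\cup\{\delta e^{i\psi}:|\psi|\le\varphi\}$, oriented with increasing imaginary part. Let $\theta,\theta'\in(\pi/2,\pi)$, let $\beta$ be holomorphic on $\Sigma_\theta$ with $z\beta(z)\in\Sigma_{\theta'}$ for all $z\in\Sigma_\theta$, and fix $\varphi\in(\pi/2,\theta)$. Put $$\hat E_h(z)=\beta(z)(z\beta(z)I+\bar A_h)^{-1},\qquad \hat F_h(z)=\beta(z)(z\beta(z)I+A_h)^{-1},$$ and for $v_h\in V_h$, $t>0$, $$\xi(t)=-\frac1{2\pi i}\int_{\Gamma_{\varphi,1/t}}e^{zt}\,\hat E_h(z)\bar A_hQ_h\bigl(z\hat F_h(z)v_h-v_h\bigr)\,dz .$$ **Theorem.** The operators $A_h,\bar A_h,Q_h$ are well defined, and the following hold. (0) *($\xi$ is the FVE–FE difference.)* Let $\mathcal J\varphi(t)=\frac{d}{dt}\int_0^t\kappa(t-s)\varphi(s)\,ds$, where $\kappa$ has, on some right half plane, the absolutely convergent Laplace transform $1/(z\beta(z))$ (so that $\mathcal J$ has the symbol $1/\beta(z)$). If $\bar u_h,u_h:[0,\infty)\to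 V_h$ are continuous with $\bar u_h(0)=u_h(0)=v_h$ and, for $t>0$, $\bar u_h'+\mathcal J\bar A_h\bar u_h=0$ and $u_h'+\mathcal JA_hu_h=0$, then $\bar u_h(t)-u_h(t)=\xi(t)$ for all $t>0$. Moreover, for every $\sigma>0$ there are constants $C>0$ such that the following estimates hold for all triangulations $\mathcal T_h$ of $\overline\Omega$ in which every triangle $K$ contains a disc of radius $\operatorname{diam}(K)/\sigma$, all $v_h\in V_h$ and all $t>0$ (in particular, $C$ does not depend on $h$): (1) $\|\xi(t)\|+h\|\nabla\xi(t)\|\le Ch^2\|\bar A_hv_h\|$. (2) If $|\beta(z)|\le c|z|^\mu$ for all $z\in\Sigma_\theta$, with some real $\mu<1$, then $\|\xi(t)\|+h\|\nabla\xi(t)\|\le Ct^{-(\mu+1)/2}h^2\|\nabla v_h\|$, with $C$ depending also on $c,\mu$. (3) If $|\beta(z)|\le c|z|^\mu$ for all $z\in\Sigma_\theta$, with some real $\mu$, and if the triangulation satisfies $\|Q_h\chi\|\le q\,h^2\|\chi\|$ for all $\chi\in V_h$ (as holds on symmetric meshes), then $\|\xi(t)\|+h\|\nabla\xi(t)\|\le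 Ct^{-(\mu+1)}h^2\|v_h\|$, with $C$ depending also on $c,\mu,q$. **Examples.** Let $0<\alpha<1$, $\gamma>0$ and $\omega_a(t)=t^{a-1}/\Gamma(a)$. The following pairs $(\kappa,\beta)$ are related as in (0), and for each of them there are $\theta,\theta'\in(\pi/2,\pi)$ and $c$ such that $\beta$ is holomorphic on $\Sigma_\theta$, $z\beta(z)\in\Sigma_{\theta'}$ and $|\beta(z)|\le c|z|^\mu$ for $z\in\Sigma_\theta$: the fractional diffusion-wave equation $\mathcal J=\mathcal I^\alpha$, with $\kappa=\omega_{1+\alpha}$, $\beta(z)=z^\alpha$, $\mu=\alpha$; the integro-differential equation with singular kernel $\mathcal J=I+\mathcal I^\alpha$, with $\kappa=1+\omega_{1+\alpha}$, $\beta(z)=z^\alpha/(1+z^\alpha)$, $\mu=\alpha$; and the Rayleigh–Stokes problem $\mathcal J=I+\gamma\partial_t^\alpha$, with $\kappa=1+\gamma\omega_{1-\alpha}$, $\beta(z)=1/(1+\gamma z^\alpha)$, $\mu=-\alpha$. -/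

import Mathlib

open MeasureTheory

namespace FVE

/-- The Euclidean plane. -/
abbrev Plane : Type := EuclideanSpace ℝ (Fin 2)

/-- Bounded convex polygonal domains: nonempty interiors of convex hulls of finitely many points. -/
def IsConvexPolygonalDomain (Ω : Set Plane) : Prop :=
  Ω.Nonempty ∧ ∃ S : Finset Plane, Ω = interior (convexHull ℝ (S : Set Plane))

/-! ### Triangulations and finite element spaces -/

/-- A conforming triangulation of `closure Ω`. A triangle is recorded by its set of vertices; two
triangles meet exactly in the convex hull of their common vertices (nothing, a common vertex,
or a common edge, if they are different). -/
structure Triangulation (Ω : Set Plane) where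
  cells : Finset (Finset Plane)
  card_eq : ∀ K ∈ cells, K.card = 3
  indep : ∀ K ∈ cells, AffineIndependent ℝ (fun P : K => (P : Plane))
  conforming : ∀ K ∈ cells, ∀ L ∈ cells,
    convexHull ℝ (K : Set Plane) ∩ convexHull ℝ (L : Set Plane)
      = convexHull ℝ ((K : Set Plane) ∩ (L : Set Plane))
  cover : ⋃ K ∈ cells, convexHull ℝ (K : Set Plane) = closure Ω

/-- The `L²(Ω)` inner product (linear in the first argument). -/
noncomputable def l2Inner (Ω : Set Plane) (f g : Plane → ℂ) : ℂ :=
  ∫ x in Ω, f x * star (g x)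

/-- The `L²(Ω)` norm. -/
noncomputable def l2Norm (Ω : Set Plane) (f : Plane → ℂ) : ℝ :=
  Real.sqrt (∫ x in Ω, ‖f x‖ ^ 2)

/-- The partial derivative in the `i`-th coordinate direction. On piecewise linear functions it is
meaningful off the edges of the triangles, which form a null set. -/
noncomputable def partialDeriv (f : Plane → ℂ) (i : Fin 2) (x : Plane) : ℂ :=
  fderiv ℝ f x (EuclideanSpace.single i (1 : ℝ))

/-- `(∇ f, ∇ g)` in `L²(Ω)`. -/
noncomputable def gradInner (Ω : Set Plane) (f g : Plane → ℂ) : ℂ :=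
  ∫ x in Ω, ∑ i : Fin 2, partialDeriv f i x * star (partialDeriv g i x)

/-- `‖∇ f‖` in `L²(Ω)`. -/
noncomputable def gradNorm (Ω : Set Plane) (f : Plane → ℂ) : ℝ :=
  Real.sqrt (∫ x in Ω, ∑ i : Fin 2, ‖partialDeriv f i x‖ ^ 2)

namespace Triangulation

variable {Ω : Set Plane} (T : Triangulation Ω)

/-- The mesh size `h`: the maximal diameter of the triangles. -/
noncomputable def meshSize : ℝ :=
  ⨆ K : T.cells, Metric.diam (convexHull ℝ ((K : Finset Plane) : Set Plane))

/-- Shape regularity with constant `σ`: every triangle `K` contains a disc of radius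
`diam K / σ`. -/
def IsShapeRegular (σ : ℝ) : Prop :=
  ∀ K ∈ T.cells, ∃ c : Plane,
    Metric.closedBall c (Metric.diam (convexHull ℝ (K : Set Plane)) / σ)
      ⊆ convexHull ℝ (K : Set Plane)

open Classical in
/-- The interior nodes: the vertices of the triangles that lie in the open set `Ω`. -/
noncomputable def interiorNodes : Finset Plane :=
  (T.cells.biUnion id).filter (fun P => P ∈ Ω)

/-- The part in the triangle `K` of the control volume of the vertex `P`: the quadrilateral
whose corners are `P` (`= midpoint P P`), the midpoints of the two edges of `K` at `P`, and the
barycenter of `K`. -/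
noncomputable def controlPiece (K : Finset Plane) (P : Plane) : Set Plane :=
  convexHull ℝ (insert ((3 : ℝ)⁻¹ • ∑ R ∈ K, R) ((fun R => midpoint ℝ P R) '' (K : Set Plane)))

/-- The control volume of the node `P`. -/
noncomputable def controlVolume (P : Plane) : Set Plane :=
  ⋃ K ∈ T.cells, ⋃ _ : P ∈ K, controlPiece K P

/-- The interpolation `Π_h^* χ = ∑ χ(P) η_P` over the interior nodes `P`, where `η_P` is
the characteristic function of the control volume of `P`. -/
noncomputable def dualInterp (χ : Plane → ℂ) (x : Plane) : ℂ :=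
  ∑ P ∈ T.interiorNodes, χ P * (T.controlVolume P).indicator (fun _ => (1 : ℂ)) x

/-- The space `V_h` of continuous piecewise linear functions vanishing on `∂Ω`, with complex
values, since resolvents at complex numbers act on it; the real functions of the method are
among its members. For definiteness its members are extended by zero outside `Ω`. -/
def femSpace : Submodule ℂ (Plane → ℂ) where
  carrier := {χ | ContinuousOn χ (closure Ω) ∧
    (∀ K ∈ T.cells, ∃ g : Plane →ᵃ[ℝ] ℂ, Set.EqOn χ g (convexHull ℝ (K : Set Plane))) ∧
    ∀ x ∉ Ω, χ x = 0}
  zero_mem' := ⟨continuousOn_const, fun _ _ => ⟨0, fun _ _ => rfl⟩, fun _ _ => rfl⟩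
  add_mem' := by
    rintro χ ψ ⟨h1, h2, h3⟩ ⟨k1, k2, k3⟩
    refine ⟨h1.add k1, fun K hK => ?_, fun x hx => ?_⟩
    · obtain ⟨g, hg⟩ := h2 K hK
      obtain ⟨k, hk⟩ := k2 K hK
      exact ⟨g + k, fun x hx => by simp [hg hx, hk hx]⟩
    · simp [h3 x hx, k3 x hx]
  smul_mem' := by
    rintro c χ ⟨h1, h2, h3⟩
    refine ⟨h1.const_smul c, fun K hK => ?_, fun x hx => ?_⟩
    · obtain ⟨g, hg⟩ := h2 K hK
      exact ⟨c • g, fun x hx => by simp [hg hx]⟩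
    · simp [h3 x hx]

/-- `(ψ, χ)` on `V_h`. -/
noncomputable def massForm (ψ χ : T.femSpace) : ℂ := l2Inner Ω ψ χ

/-- The discrete inner product `(ψ, χ)_h = (ψ, Π_h^* χ)` on `V_h`. -/
noncomputable def dualMassForm (ψ χ : T.femSpace) : ℂ := l2Inner Ω ψ (T.dualInterp χ)

/-- `(∇ ψ, ∇ χ)` on `V_h`. -/
noncomputable def stiffForm (ψ χ : T.femSpace) : ℂ := gradInner Ω ψ χ

/-- The quadrature error `ε_h(χ, ψ) = (χ, ψ)_h - (χ, ψ)`. -/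
noncomputable def quadForm (χ ψ : T.femSpace) : ℂ := T.dualMassForm χ ψ - T.massForm χ ψ

open Classical in
/-- The linear operator `B` on `V_h` with `m (B ψ) χ = a ψ χ` for all `ψ`, `χ`. It exists and is
unique if `m` is positive definite and `a` is sesquilinear, as in all uses below. -/
noncomputable def formOperator (m a : T.femSpace → T.femSpace → ℂ) : Module.End ℂ T.femSpace :=
  if h : ∃ B : Module.End ℂ T.femSpace, ∀ ψ χ, m (B ψ) χ = a ψ χ then h.choose else 0

/-- The finite element operator `A_h`: `(A_h ψ, χ) = (∇ ψ, ∇ χ)`. -/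
noncomputable def feLaplacian : Module.End ℂ T.femSpace :=
  T.formOperator T.massForm T.stiffForm

/-- The finite volume element operator `Ā_h`: `(Ā_h ψ, χ)_h = (∇ ψ, ∇ χ)`. -/
noncomputable def fveLaplacian : Module.End ℂ T.femSpace :=
  T.formOperator T.dualMassForm T.stiffForm

/-- The quadrature error operator `Q_h`: `(∇ Q_h χ, ∇ ψ) = ε_h(χ, ψ)`. -/
noncomputable def quadError : Module.End ℂ T.femSpace :=
  T.formOperator T.stiffForm T.quadForm

end Triangulation

/-! ### Sectors, contours, kernels -/

/-- The sector `Σ_θ`. -/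
def sector (θ : ℝ) : Set ℂ := {z | z ≠ 0 ∧ |z.arg| < θ}

/-- The integral of `f` along `Γ_{φ,δ}`, which comes in along the ray `arg z = -φ`, `|z| ≥ δ`,
follows the arc `|z| = δ`, `|arg z| ≤ φ`, and leaves along the ray `arg z = φ`. -/
noncomputable def contourIntegral (φ δ : ℝ) (f : ℂ → ℂ) : ℂ :=
  -(∫ ρ in Set.Ioi δ, f (ρ * Complex.exp (-(φ * Complex.I))) * Complex.exp (-(φ * Complex.I)))
  + (∫ ψ in (-φ)..φ, f (δ * Complex.exp (ψ * Complex.I)) *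
      (Complex.I * (δ * Complex.exp (ψ * Complex.I))))
  + ∫ ρ in Set.Ioi δ, f (ρ * Complex.exp (φ * Complex.I)) * Complex.exp (φ * Complex.I)

/-- `β` is holomorphic on `Σ_θ` and `z β(z) ∈ Σ_{θ'}` for all `z ∈ Σ_θ`, with both angles in
`(π/2, π)`. -/
structure IsSectorialKernel (θ θ' : ℝ) (β : ℂ → ℂ) : Prop where
  angle : θ ∈ Set.Ioo (Real.pi / 2) Real.pi
  angle' : θ' ∈ Set.Ioo (Real.pi / 2) Real.pi
  holo : DifferentiableOn ℂ β (sector θ)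
  mapsTo : ∀ z ∈ sector θ, z * β z ∈ sector θ'

/-- `|β(z)| ≤ c |z|^μ` on `Σ_θ`. -/
def HasPowerBound (θ : ℝ) (β : ℂ → ℂ) (c μ : ℝ) : Prop :=
  ∀ z ∈ sector θ, ‖β z‖ ≤ c * ‖z‖ ^ μ

/-- The time operator `𝒥 φ (t) = d/dt ∫₀ᵗ κ(t-s) φ(s) ds` has the symbol `h(z) = 1 / β(z)`,
that is, `κ` has the Laplace transform `h(z) / z` on some right half plane. -/
def HasSymbol (κ : ℝ → ℝ) (β : ℂ → ℂ) : Prop :=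
  ∃ a : ℝ, 0 < a ∧ ∀ z : ℂ, a < z.re →
    IntegrableOn (fun t : ℝ => Complex.exp (-(z * t)) * (κ t : ℂ)) (Set.Ioi 0) ∧
    ∫ t in Set.Ioi (0 : ℝ), Complex.exp (-(z * t)) * (κ t : ℂ) = (z * β z)⁻¹

/-- `ω_a(t) = t^(a-1) / Γ(a)`. With `κ = 1`, `κ = ω_{1+α}` and `κ = ω_{1-α}` the operator
`φ ↦ d/dt ∫₀ᵗ κ(t-s) φ(s) ds` is the identity, the fractional integral `ℐ^α` and the
Riemann-Liouville derivative `∂_t^α`. -/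
noncomputable def omega (a t : ℝ) : ℝ := t ^ (a - 1) / Real.Gamma a

/-! ### The semidiscrete problems and the error -/

namespace Triangulation

variable {Ω : Set Plane} (T : Triangulation Ω)

/-- `u` solves `u' + 𝒥 B u = 0` for `t > 0`, `u(0) = v`, in `V_h`, where
`𝒥 φ (t) = d/dt ∫₀ᵗ κ(t-s) φ(s) ds`. -/
structure IsSolution (κ : ℝ → ℝ) (B : Module.End ℂ T.femSpace) (v : T.femSpace)
    (u : ℝ → T.femSpace) : Prop where
  init : u 0 = v
  cont : ∀ x : Plane, ContinuousOn (fun t => (u t : Plane → ℂ) x) (Set.Ici 0)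
  eqn : ∀ t : ℝ, 0 < t → ∀ x : Plane, ∃ d : ℂ,
    HasDerivAt (fun τ => (u τ : Plane → ℂ) x) d t ∧
    HasDerivAt (fun τ : ℝ => ∫ s in (0 : ℝ)..τ, (κ (τ - s) : ℂ) * (B (u s) : Plane → ℂ) x) (-d) t

/-- `β(z) (z β(z) I + B)⁻¹`: this is `Ê_h(z)` if `B = Ā_h` and `F̂_h(z)` if `B = A_h`. -/
noncomputable def solOp (β : ℂ → ℂ) (B : Module.End ℂ T.femSpace) (z : ℂ) :
    Module.End ℂ T.femSpace :=
  β z • Ring.inverse ((z * β z) • (1 : Module.End ℂ T.femSpace) + B)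

/-- The Laplace transform `z F̂_h(z) v - v` of the time derivative of the finite element
solution. -/
noncomputable def feDerivTransform (β : ℂ → ℂ) (v : T.femSpace) (z : ℂ) : T.femSpace :=
  z • T.solOp β T.feLaplacian z v - v

/-- `ξ(t) = -(2πi)⁻¹ ∫_Γ e^{zt} Ê_h(z) Ā_h Q_h (z F̂_h(z) v - v) dz` with `Γ = Γ_{φ,1/t}`,
evaluated pointwise in space. -/
noncomputable def xi (β : ℂ → ℂ) (φ : ℝ) (v : T.femSpace) (t : ℝ) (x : Plane) : ℂ :=
  -(2 * Real.pi * Complex.I)⁻¹ * contourIntegral φ (1 / t) (fun z =>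
    Complex.exp (z * t) *
      (T.solOp β T.fveLaplacian z (T.fveLaplacian (T.quadError (T.feDerivTransform β v z))) :
        Plane → ℂ) x)

/-- `‖ξ(t)‖ + h ‖∇ ξ(t)‖`. -/
noncomputable def errorNorm (β : ℂ → ℂ) (φ : ℝ) (v : T.femSpace) (t : ℝ) : ℝ :=
  l2Norm Ω (T.xi β φ v t) + T.meshSize * gradNorm Ω (T.xi β φ v t)

end Triangulation

end FVE

/-! Write `ζ = z β(z)`, which stays in a sector of half-angle below `π`. The vector `w = z F̂_h(z) v
- v` equals `-A_h (ζ + A_h)⁻¹ v`, and the definitions of the three operators give `Ā_h Q_h A_h = A_h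
- Ā_h` (`Ab_Q_A`). Together these show that the integrand of `ξ`, without the exponential, is
`F̂_h(z) v - Ê_h(z) v` (`errorTransform_eq`). Hence `ξ` is the FVE-FE difference as soon as each
semidiscrete solution is the contour integral of its Laplace transform.

That representation is scalar: `A_h` and `Ā_h` are self-adjoint for `(·,·)` and `(·,·)_h`, so an
orthonormal eigenbasis splits each problem into equations with a number `l ≥ 0` in place of the
operator. Integrating in time gives a Volterra equation, whose solutions grow at most exponentially.
Their Laplace transform is `y(0) β / (z β + l)`, and uniqueness of Laplace transforms identifies the
solution with the contour integral (`scalar_solution_eq`). Cauchy's formula on the contour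
(`contourIntegral_cauchy`) shows that this integral has the right transform.

The estimates combine three ingredients. First, consistency: on each triangle both mass matrices
have equal diagonal entries, equal off-diagonal entries and the same row sums, so their difference
is a multiple of the form `∑ (uᵢ - uⱼ)(w̄ᵢ - w̄ⱼ)` (`nodalForm_sub_nodalForm`). This bounds the
quadrature error by `h² ‖∇ψ‖ ‖∇χ‖` and by `h ‖ψ‖ ‖∇χ‖`, with universal constants
(`exists_quadratureSetting`). Second, stability: testing a resolvent equation with its solution and
using `|ζ| + s ≤ C |ζ + s|` on a sector gives all resolvent bounds (`resolvent_energy`). Applied to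
`w` and to `u = (ζ + Ā_h)⁻¹ Ā_h Q_h w`, they bound the integrand by `h²` times `|z|^s`, with `s =
-1`, `(μ-1)/2` or `μ` according to how many factors `|ζ|^(1/2)` the data can supply. Third, scaling:
on `Γ_{φ,1/t}` a function of size `|z|^s` integrates to `O(t^(-s-1))` (`norm_contourIntegral_le`),
which produces the stated powers of `t`. -/

namespace FVE

/-! ### Cauchy's theorem in polar coordinates -/

open Complex Filter Topology Set in
-- The substitution `ρ = e^x` turns a piece of a ray into a horizontal segment in the logarithmic
-- coordinate, where Cauchy's theorem for rectangles applies.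
theorem integral_ray_eq_integral_exp {g : ℂ → ℂ} {r R a : ℝ} (hr : 0 < r) (hrR : r ≤ R)
    (hg : ∀ ρ ∈ Icc r R, ContinuousAt g (ρ * exp (a * I))) :
    ∫ x in Real.log r..Real.log R, g (exp (x + a * I)) * exp (x + a * I)
      = ∫ ρ in r..R, g (ρ * exp (a * I)) * exp (a * I) := by
  have hR : 0 < R := hr.trans_le hrR
  have h := intervalIntegral.integral_deriv_smul_comp' (a := Real.log r) (b := Real.log R)
    (f := Real.exp) (f' := Real.exp) (g := fun ρ : ℝ => g (ρ * exp (a * I)) * exp (a * I))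
    (fun x _ => Real.hasDerivAt_exp x) Real.continuous_exp.continuousOn ?_
  · rw [Real.exp_log hr, Real.exp_log hR] at h
    rw [← h]
    refine intervalIntegral.integral_congr fun x _ => ?_
    simp only [Function.comp, Complex.exp_add, Complex.ofReal_exp, Complex.real_smul]
    ring
  · rintro _ ⟨x, hx, rfl⟩
    rw [uIcc_of_le (Real.log_le_log hr hrR)] at hx
    have hx' : Real.exp x ∈ Icc r R :=
      ⟨(Real.log_le_iff_le_exp hr).1 hx.1, (Real.le_log_iff_exp_le hR).1 hx.2⟩
    refine ContinuousAt.continuousWithinAt ?_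
    refine ContinuousAt.mul ?_ continuousAt_const
    exact ContinuousAt.comp (f := fun ρ : ℝ => (ρ : ℂ) * exp (a * I)) (hg _ hx') (by fun_prop)

open Complex Filter Topology Set in
/-- Cauchy's theorem for a truncated circular sector. -/
theorem integral_boundary_polarRect_eq_zero {g : ℂ → ℂ} {r R a b : ℝ} (hr : 0 < r) (hrR : r ≤ R)
    (hab : a ≤ b)
    (hg : ∀ ρ ∈ Icc r R, ∀ ψ ∈ Icc a b, DifferentiableAt ℂ g ((ρ : ℝ) * exp ((ψ : ℝ) * I))) :
    (∫ ρ in r..R, g (ρ * exp (a * I)) * exp (a * I))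
      - (∫ ρ in r..R, g (ρ * exp (b * I)) * exp (b * I))
      + (∫ ψ in a..b, g (R * exp (ψ * I)) * (I * (R * exp (ψ * I))))
      - (∫ ψ in a..b, g (r * exp (ψ * I)) * (I * (r * exp (ψ * I)))) = 0 := by
  have hR : 0 < R := hr.trans_le hrR
  have hlog := Real.log_le_log hr hrR
  -- The sector is the image under `exp` of the rectangle `[log r, log R] × [a, b]`; the factor `exp
  -- s` is the Jacobian.
  have h := integral_boundary_rect_eq_zero_of_differentiableOn (fun s => g (exp s) * exp s)
    (⟨Real.log r, a⟩ : ℂ) ⟨Real.log R, b⟩ ?_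
  · have e1 : ∀ y : ℝ, exp ((Real.log R : ℝ) + y * I) = R * exp (y * I) := fun y => by
      rw [Complex.exp_add, ← Complex.ofReal_exp, Real.exp_log hR]
    have e2 : ∀ y : ℝ, exp ((Real.log r : ℝ) + y * I) = r * exp (y * I) := fun y => by
      rw [Complex.exp_add, ← Complex.ofReal_exp, Real.exp_log hr]
    simp only [e1, e2] at h
    rw [integral_ray_eq_integral_exp hr hrR
        (fun ρ hρ => (hg ρ hρ a (left_mem_Icc.2 hab)).continuousAt),
      integral_ray_eq_integral_exp hr hrR
        (fun ρ hρ => (hg ρ hρ b (right_mem_Icc.2 hab)).continuousAt),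
      smul_eq_mul, smul_eq_mul, ← intervalIntegral.integral_const_mul,
      ← intervalIntegral.integral_const_mul] at h
    rw [← h]
    have e3 : ∀ (ρ ψ : ℝ), g (ρ * exp (ψ * I)) * (I * (ρ * exp (ψ * I)))
        = I * (g (ρ * exp (ψ * I)) * (ρ * exp (ψ * I))) := fun ρ ψ => by ring
    simp only [e3]
  · intro s hs
    rw [mem_reProdIm] at hs
    simp only [uIcc_of_le hlog, uIcc_of_le hab] at hs
    have hx' : Real.exp s.re ∈ Icc r R :=
      ⟨(Real.log_le_iff_le_exp hr).1 hs.1.1, (Real.le_log_iff_exp_le hR).1 hs.1.2⟩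
    have hs' : exp s = (Real.exp s.re : ℝ) * exp ((s.im : ℝ) * I) := by
      rw [Complex.ofReal_exp, ← Complex.exp_add, re_add_im]
    have := hg _ hx' _ hs.2
    rw [← hs'] at this
    exact ((this.comp s Complex.differentiableAt_exp).mul
      Complex.differentiableAt_exp).differentiableWithinAt

open Complex Filter Topology Set in
/-- Cauchy's theorem for the part of a circular sector outside a disc, with integrands that decay
quadratically. -/
theorem integral_boundary_infinitePolarRect_eq_zero {g : ℂ → ℂ} {r a b M : ℝ} (hr : 0 < r)
    (hab : a ≤ b)
    (hg : ∀ ρ, r ≤ ρ → ∀ ψ ∈ Icc a b, DifferentiableAt ℂ g ((ρ : ℝ) * exp ((ψ : ℝ) * I)))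
    (hM : ∀ ρ, r ≤ ρ → ∀ ψ ∈ Icc a b, ‖g ((ρ : ℝ) * exp ((ψ : ℝ) * I))‖ ≤ M / ρ ^ 2) :
    (∫ ρ in Ioi r, g (ρ * exp (a * I)) * exp (a * I))
      - (∫ ρ in Ioi r, g (ρ * exp (b * I)) * exp (b * I))
      - (∫ ψ in a..b, g (r * exp (ψ * I)) * (I * (r * exp (ψ * I)))) = 0 := by
  have hint : ∀ c ∈ Icc a b,
      IntegrableOn (fun ρ : ℝ => g (ρ * exp (c * I)) * exp (c * I)) (Ioi r) := by
    intro c hc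
    have h2 : IntegrableOn (fun ρ : ℝ => M * ρ ^ (-2 : ℝ)) (Ioi r) :=
      (integrableOn_Ioi_rpow_of_lt (by norm_num) hr).const_mul M
    refine Integrable.mono' h2 ?_ ?_
    · refine ContinuousOn.aestronglyMeasurable (fun ρ hρ => ?_) measurableSet_Ioi
      refine ContinuousAt.continuousWithinAt (ContinuousAt.mul ?_ continuousAt_const)
      exact ContinuousAt.comp (f := fun ρ : ℝ => (ρ : ℂ) * exp (c * I))
        (hg ρ (le_of_lt hρ) c hc).continuousAt (by fun_prop)
    · refine (ae_restrict_iff' measurableSet_Ioi).2 (Eventually.of_forall fun ρ hρ => ?_)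
      have hρ0 : 0 < ρ := hr.trans hρ
      rw [norm_mul, norm_exp_ofReal_mul_I, mul_one, Real.rpow_neg hρ0.le, ← div_eq_mul_inv]
      exact_mod_cast hM ρ (le_of_lt hρ) c hc
  have t1 := intervalIntegral_tendsto_integral_Ioi r (hint a (left_mem_Icc.2 hab)) tendsto_id
  have t2 := intervalIntegral_tendsto_integral_Ioi r (hint b (right_mem_Icc.2 hab)) tendsto_id
  -- The outer arc has length proportional to `R` and the integrand is at most `M / R²`, so its
  -- contribution is `O(1/R)`.
  have t3 : Tendsto (fun R : ℝ => ∫ ψ in a..b, g (R * exp (ψ * I)) * (I * (R * exp (ψ * I))))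
      atTop (𝓝 0) := by
    have t4 : Tendsto (fun R : ℝ => M / R * |b - a|) atTop (𝓝 0) := by
      simpa using (tendsto_const_nhds.div_atTop tendsto_id).mul_const |b - a|
    refine squeeze_zero_norm' ?_ t4
    filter_upwards [eventually_ge_atTop r] with R hR
    have hR0 : 0 < R := hr.trans_le hR
    refine intervalIntegral.norm_integral_le_of_norm_le_const fun ψ hψ => ?_
    rw [uIoc_of_le hab] at hψ
    have h5 := hM R hR ψ ⟨hψ.1.le, hψ.2⟩
    rw [norm_mul, norm_mul, norm_mul, norm_exp_ofReal_mul_I, norm_I, norm_real,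
      Real.norm_of_nonneg hR0.le]
    calc _ ≤ M / R ^ 2 * (1 * (R * 1)) := by gcongr
      _ = M / R := by field_simp
  have t5 := ((t1.sub t2).add t3).sub_const
    (∫ ψ in a..b, g (r * exp (ψ * I)) * (I * (r * exp (ψ * I))))
  rw [add_zero] at t5
  refine tendsto_nhds_unique t5 (tendsto_const_nhds.congr' ?_)
  filter_upwards [eventually_ge_atTop r] with R hR
  exact (integral_boundary_polarRect_eq_zero hr hR hab
    fun ρ hρ ψ hψ => hg ρ hρ.1 ψ hψ).symm

/-! ### Contour integrals: convergence, linearity and decay in time -/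

/-- The three pieces of the contour integral converge absolutely. -/
structure ContourIntegrable (φ δ : ℝ) (f : ℂ → ℂ) : Prop where
  lower : IntegrableOn (fun ρ : ℝ => f (ρ * Complex.exp (-(φ * Complex.I))) *
    Complex.exp (-(φ * Complex.I))) (Set.Ioi δ)
  arc : IntervalIntegrable (fun ψ : ℝ => f (δ * Complex.exp (ψ * Complex.I)) *
      (Complex.I * (δ * Complex.exp (ψ * Complex.I)))) volume (-φ) φ
  upper : IntegrableOn (fun ρ : ℝ => f (ρ * Complex.exp (φ * Complex.I)) *
    Complex.exp (φ * Complex.I)) (Set.Ioi δ)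

theorem ContourIntegrable.add {φ δ : ℝ} {f g : ℂ → ℂ} (hf : ContourIntegrable φ δ f)
    (hg : ContourIntegrable φ δ g) : ContourIntegrable φ δ (fun z => f z + g z) := by
  refine ⟨?_, ?_, ?_⟩
  · simp only [add_mul]
    exact hf.lower.add hg.lower
  · simpa only [add_mul] using hf.arc.add hg.arc
  · simp only [add_mul]
    exact hf.upper.add hg.upper

theorem ContourIntegrable.const_mul {φ δ : ℝ} {f : ℂ → ℂ} (hf : ContourIntegrable φ δ f) (c : ℂ) :
    ContourIntegrable φ δ (fun z => c * f z) := by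
  refine ⟨?_, ?_, ?_⟩
  · simp only [mul_assoc]
    exact hf.lower.const_mul c
  · simpa only [mul_assoc] using hf.arc.const_mul c
  · simp only [mul_assoc]
    exact hf.upper.const_mul c

theorem contourIntegral_add {φ δ : ℝ} {f g : ℂ → ℂ} (hf : ContourIntegrable φ δ f)
    (hg : ContourIntegrable φ δ g) :
    contourIntegral φ δ (fun z => f z + g z) = contourIntegral φ δ f + contourIntegral φ δ g := by
  simp only [contourIntegral, add_mul]
  rw [integral_add hf.lower hg.lower, integral_add hf.upper hg.upper,
    intervalIntegral.integral_add hf.arc hg.arc]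
  ring

theorem contourIntegral_const_mul (φ δ : ℝ) (f : ℂ → ℂ) (c : ℂ) :
    contourIntegral φ δ (fun z => c * f z) = c * contourIntegral φ δ f := by
  simp only [contourIntegral, mul_assoc, integral_const_mul, intervalIntegral.integral_const_mul]
  ring

theorem ContourIntegrable.sum {φ δ : ℝ} {ι : Type*} (s : Finset ι) {f : ι → ℂ → ℂ} (c : ι → ℂ)
    (hf : ∀ i, ContourIntegrable φ δ (f i)) :
    ContourIntegrable φ δ (fun z => ∑ i ∈ s, c i * f i z) := by
  classical
  induction s using Finset.induction_on with
  | empty => exact ⟨by simp, by simp, by simp⟩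
  | insert a s ha ih =>
    simpa only [Finset.sum_insert ha] using ((hf a).const_mul (c a)).add ih

theorem contourIntegral_sum {φ δ : ℝ} {ι : Type*} (s : Finset ι) {f : ι → ℂ → ℂ} (c : ι → ℂ)
    (hf : ∀ i, ContourIntegrable φ δ (f i)) :
    contourIntegral φ δ (fun z => ∑ i ∈ s, c i * f i z)
      = ∑ i ∈ s, c i * contourIntegral φ δ (f i) := by
  classical
  induction s using Finset.induction_on with
  | empty => simp [contourIntegral]
  | insert a s ha ih =>
    simp only [Finset.sum_insert ha]
    rw [contourIntegral_add ((hf a).const_mul (c a)) (ContourIntegrable.sum s c hf), ih,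
      contourIntegral_const_mul]

theorem mul_exp_mem_sector {θ ψ ρ : ℝ} (hρ : 0 < ρ) (hψ : |ψ| < θ) (hθ : θ ≤ Real.pi) :
    (ρ : ℂ) * Complex.exp (ψ * Complex.I) ∈ sector θ := by
  have h := abs_lt.1 (hψ.trans_le hθ)
  refine ⟨mul_ne_zero (by exact_mod_cast hρ.ne') (Complex.exp_ne_zero _), ?_⟩
  rwa [Complex.exp_mul_I, Complex.arg_mul_cos_add_sin_mul_I hρ ⟨h.1, h.2.le⟩]

theorem exp_neg_mul_I (φ : ℝ) :
    Complex.exp (-(φ * Complex.I)) = Complex.exp (((-φ : ℝ) : ℂ) * Complex.I) := by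
  rw [Complex.ofReal_neg, neg_mul]

theorem norm_mul_exp {ρ : ℝ} (hρ : 0 < ρ) (ψ : ℝ) :
    ‖(ρ : ℂ) * Complex.exp (ψ * Complex.I)‖ = ρ := by
  rw [norm_mul, Complex.norm_exp_ofReal_mul_I, mul_one, Complex.norm_real,
    Real.norm_of_nonneg hρ.le]

theorem re_mul_exp (ρ ψ : ℝ) :
    ((ρ : ℂ) * Complex.exp (ψ * Complex.I)).re = ρ * Real.cos ψ := by
  rw [Complex.re_ofReal_mul, Complex.exp_ofReal_mul_I_re]

theorem norm_exp_mul_real (z : ℂ) (t : ℝ) : ‖Complex.exp (z * t)‖ = Real.exp (z.re * t) := by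
  rw [Complex.norm_exp]
  simp

theorem continuous_mul_exp (ψ : ℝ) :
    Continuous fun ρ : ℝ => (ρ : ℂ) * Complex.exp (ψ * Complex.I) := by fun_prop

theorem continuous_mul_exp' (ρ : ℝ) :
    Continuous fun ψ : ℝ => (ρ : ℂ) * Complex.exp (ψ * Complex.I) := by fun_prop

open Filter Asymptotics Set in
theorem integrableOn_exp_mul_rpow_Ioi {c δ : ℝ} (hc : c < 0) (hδ : 0 < δ) (s : ℝ) :
    IntegrableOn (fun r : ℝ => Real.exp (r * c) * r ^ s) (Ioi δ) := by
  -- Half of the exponential decay absorbs the power `r ^ s`; the other half remains integrable.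
  have h := isLittleO_rpow_exp_pos_mul_atTop s (b := -c / 2) (by linarith)
  refine integrable_of_isBigO_exp_neg (b := -c / 2) (by linarith) ?_ ?_
  · intro r hr
    have : r ≠ 0 := (hδ.trans_le hr).ne'
    exact ((by fun_prop : Continuous fun r : ℝ => Real.exp (r * c)).continuousAt.mul
      (Real.continuousAt_rpow_const r s (Or.inl this))).continuousWithinAt
  · refine ((isBigO_refl (fun r : ℝ => Real.exp (r * c)) atTop).mul h.isBigO).congr_right ?_
    intro r
    rw [← Real.exp_add]
    congr 1
    ring

/-- The constant in the bound of contour integrals of functions of size `|z| ^ s`. -/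
noncomputable def contourConst (φ s : ℝ) : ℝ :=
  2 * (∫ r in Set.Ioi (1 : ℝ), Real.exp (r * Real.cos φ) * r ^ s) + 2 * φ * Real.exp 1

theorem contourConst_pos {φ : ℝ} (hφ : 0 < φ) (s : ℝ) : 0 < contourConst φ s := by
  have : 0 ≤ ∫ r in Set.Ioi (1 : ℝ), Real.exp (r * Real.cos φ) * r ^ s :=
    setIntegral_nonneg measurableSet_Ioi fun r hr => by
      have : (0 : ℝ) < r := zero_lt_one.trans hr
      positivity
  unfold contourConst
  positivity

/-- The data on the angles of sectors and contours. -/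
structure ContourAngles (φ θ : ℝ) : Prop where
  lower : Real.pi / 2 < φ
  lt : φ < θ
  upper : θ ≤ Real.pi

namespace ContourAngles

variable {φ θ : ℝ} (h : ContourAngles φ θ)
include h

theorem pos : 0 < φ := lt_trans (by positivity) h.lower

theorem cos_neg : Real.cos φ < 0 :=
  Real.cos_neg_of_pi_div_two_lt_of_lt h.lower (by linarith [h.lt, h.upper, Real.pi_pos])

theorem abs_lt_of_mem {ψ : ℝ} (hψ : ψ ∈ Set.Icc (-φ) φ) : |ψ| < θ :=
  (abs_le.2 hψ).trans_lt h.lt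

theorem ray_mem {ρ : ℝ} (hρ : 0 < ρ) {ψ : ℝ} (hψ : ψ ∈ Set.Icc (-φ) φ) :
    (ρ : ℂ) * Complex.exp (ψ * Complex.I) ∈ sector θ :=
  mul_exp_mem_sector hρ (h.abs_lt_of_mem hψ) h.upper

theorem mem : φ ∈ Set.Icc (-φ) φ := ⟨by linarith [h.pos], le_rfl⟩

theorem neg_mem : -φ ∈ Set.Icc (-φ) φ := ⟨le_rfl, by linarith [h.pos]⟩

end ContourAngles

theorem isOpen_sector {θ : ℝ} (hθ : θ ≤ Real.pi) : IsOpen (sector θ) := by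
  have : sector θ = Complex.slitPlane ∩ {z | |z.arg| < θ} := by
    ext z
    simp only [sector, Set.mem_ofPred_eq, Set.mem_inter_iff, Complex.mem_slitPlane_iff_arg]
    constructor
    · rintro ⟨h1, h2⟩
      exact ⟨⟨fun h3 => by rw [h3, abs_of_pos Real.pi_pos] at h2; linarith, h1⟩, h2⟩
    · rintro ⟨⟨_, h1⟩, h2⟩
      exact ⟨h1, h2⟩
  rw [this]
  refine ContinuousOn.isOpen_inter_preimage (t := {x : ℝ | |x| < θ}) ?_ Complex.isOpen_slitPlane
    (isOpen_lt continuous_abs continuous_const)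
  exact fun z hz => (Complex.continuousAt_arg hz).continuousWithinAt

open Set in
-- The substitution `r = tρ` moves the starting point `1/t` to `1` and pulls out exactly `t ^ (-s -
-- 1)`. This scaling is the reason for tying the radius of the contour to `t`.
theorem integral_ray_le {φ t M s : ℝ} {f : ℝ → ℂ} (hφ : Real.cos φ < 0) (ht : 0 < t)
    (hf : ∀ ρ, 1 / t < ρ → ‖f ρ‖ ≤ Real.exp (ρ * Real.cos φ * t) * (M * ρ ^ s)) :
    ‖∫ ρ in Ioi (1 / t), f ρ‖
      ≤ M * t ^ (-s - 1) * ∫ r in Ioi (1 : ℝ), Real.exp (r * Real.cos φ) * r ^ s := by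
  have h1 : ∀ ρ ∈ Ioi (1 / t), Real.exp (ρ * Real.cos φ * t) * (M * ρ ^ s)
      = M * t ^ (-s) * (Real.exp (t * ρ * Real.cos φ) * (t * ρ) ^ s) := by
    intro ρ hρ
    have hρ0 : 0 < ρ := lt_trans (by positivity) hρ
    rw [Real.mul_rpow ht.le hρ0.le, Real.rpow_neg ht.le]
    have : t ^ s ≠ 0 := (Real.rpow_pos_of_pos ht s).ne'
    field_simp
  have h2 := integral_comp_mul_left_Ioi
    (fun r : ℝ => Real.exp (r * Real.cos φ) * r ^ s) (1 / t) ht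
  have h3 : t * (1 / t) = 1 := by field_simp
  have h4 : IntegrableOn (fun ρ => M * t ^ (-s) *
      (Real.exp (t * ρ * Real.cos φ) * (t * ρ) ^ s)) (Ioi (1 / t)) := by
    refine Integrable.const_mul ?_ _
    refine (integrableOn_Ioi_comp_mul_left_iff
      (fun r : ℝ => Real.exp (r * Real.cos φ) * r ^ s) (1 / t) ht).2 ?_
    rw [h3]
    exact integrableOn_exp_mul_rpow_Ioi hφ one_pos s
  refine (norm_integral_le_of_norm_le h4 ?_).trans ?_
  · refine (ae_restrict_iff' measurableSet_Ioi).2 (Filter.Eventually.of_forall fun ρ hρ => ?_)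
    rw [← h1 ρ hρ]
    exact hf ρ hρ
  · rw [integral_const_mul, h2, h3, smul_eq_mul, Real.rpow_sub ht, Real.rpow_one]
    exact le_of_eq (by ring)

open Set in
/-- Contour integrals of functions of size `|z| ^ s` decay like `t ^ (-s - 1)`. -/
theorem norm_contourIntegral_le {φ θ : ℝ} (h : ContourAngles φ θ) {t M s : ℝ} (ht : 0 < t)
    {f : ℂ → ℂ} (hM : ∀ z ∈ sector θ, ‖f z‖ ≤ M * ‖z‖ ^ s) :
    ‖contourIntegral φ (1 / t) (fun z => Complex.exp (z * t) * f z)‖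
      ≤ M * t ^ (-s - 1) * contourConst φ s := by
  have ht' : 0 < 1 / t := by positivity
  have key : ∀ ρ : ℝ, 0 < ρ → ∀ ψ ∈ Icc (-φ) φ,
      ‖Complex.exp ((ρ * Complex.exp (ψ * Complex.I)) * t) * f (ρ * Complex.exp (ψ * Complex.I))‖
        ≤ Real.exp (ρ * Real.cos ψ * t) * (M * ρ ^ s) := by
    intro ρ hρ ψ hψ
    have := hM _ (h.ray_mem hρ hψ)
    rw [norm_mul_exp hρ] at this
    rw [norm_mul, norm_exp_mul_real, re_mul_exp]
    gcongr
  have b1 := integral_ray_le (f := fun ρ => Complex.exp ((ρ * Complex.exp (-(φ * Complex.I))) * t) *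
    f (ρ * Complex.exp (-(φ * Complex.I))) * Complex.exp (-(φ * Complex.I))) h.cos_neg ht
    (M := M) (s := s) (fun ρ hρ => by
      rw [norm_mul, exp_neg_mul_I, Complex.norm_exp_ofReal_mul_I, mul_one]
      simpa only [Real.cos_neg] using key ρ (ht'.trans hρ) (-φ) h.neg_mem)
  have b2 := integral_ray_le (f := fun ρ => Complex.exp ((ρ * Complex.exp (φ * Complex.I)) * t) *
    f (ρ * Complex.exp (φ * Complex.I)) * Complex.exp (φ * Complex.I)) h.cos_neg ht
    (M := M) (s := s) (fun ρ hρ => by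
      rw [norm_mul, Complex.norm_exp_ofReal_mul_I, mul_one]
      exact key ρ (ht'.trans hρ) φ h.mem)
  -- The bound at a point of modulus one, where the power of `‖z‖` is `1`, forces `M` to be
  -- nonnegative.
  have hM0 : 0 ≤ M := by
    have := (norm_nonneg _).trans (hM _ (h.ray_mem one_pos h.mem))
    rw [norm_mul_exp one_pos, Real.one_rpow, mul_one] at this
    exact this
  have b3 : ‖∫ ψ in (-φ)..φ,
      Complex.exp ((((1 / t : ℝ) : ℂ) * Complex.exp (ψ * Complex.I)) * t) *
        f (((1 / t : ℝ) : ℂ) * Complex.exp (ψ * Complex.I)) *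
        (Complex.I * (((1 / t : ℝ) : ℂ) * Complex.exp (ψ * Complex.I)))‖
      ≤ M * t ^ (-s - 1) * Real.exp 1 * |φ - -φ| := by
    refine intervalIntegral.norm_integral_le_of_norm_le_const fun ψ hψ => ?_
    rw [uIoc_of_le (by linarith [h.pos])] at hψ
    rw [norm_mul, norm_mul Complex.I, Complex.norm_I, one_mul, norm_mul_exp ht']
    refine (mul_le_mul_of_nonneg_right (key (1 / t) ht' ψ ⟨hψ.1.le, hψ.2⟩) ht'.le).trans ?_
    -- On the arc `|z| = 1/t` the exponential is at most `e`, whatever `t` is.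
    have e1 : 1 / t * Real.cos ψ * t = Real.cos ψ := by field_simp
    have e2 : (1 / t) ^ s * (1 / t) = t ^ (-s - 1) := by
      rw [one_div, Real.inv_rpow ht.le, Real.rpow_sub ht, Real.rpow_one, Real.rpow_neg ht.le]
      rfl
    rw [e1]
    calc _ = M * ((1 / t) ^ s * (1 / t)) * Real.exp (Real.cos ψ) := by ring
      _ ≤ M * t ^ (-s - 1) * Real.exp 1 := by
        rw [e2]
        gcongr
        exact Real.cos_le_one ψ
  have e3 : |φ - -φ| = 2 * φ := by rw [sub_neg_eq_add, ← two_mul, abs_of_pos (by linarith [h.pos])]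
  rw [e3] at b3
  unfold contourIntegral contourConst
  refine (norm_add_le _ _).trans ((add_le_add (norm_add_le _ _) le_rfl).trans ?_)
  rw [norm_neg]
  refine (add_le_add (add_le_add b1 b3) b2).trans (le_of_eq ?_)
  ring

open Set Filter in
theorem integrableOn_ray {θ ψ t M s δ : ℝ} (hψ : |ψ| < θ) (hθ : θ ≤ Real.pi)
    (hcos : Real.cos ψ < 0) (ht : 0 < t) (hδ : 0 < δ) {f : ℂ → ℂ} (hf : ContinuousOn f (sector θ))
    (hM : ∀ z ∈ sector θ, ‖f z‖ ≤ M * ‖z‖ ^ s) :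
    IntegrableOn (fun ρ : ℝ => Complex.exp ((ρ * Complex.exp (ψ * Complex.I)) * t) *
      f (ρ * Complex.exp (ψ * Complex.I)) * Complex.exp (ψ * Complex.I)) (Ioi δ) := by
  have h1 := (integrableOn_exp_mul_rpow_Ioi (c := Real.cos ψ * t)
    (mul_neg_of_neg_of_pos hcos ht) hδ s).const_mul M
  refine Integrable.mono' h1 ?_ ?_
  · refine ContinuousOn.aestronglyMeasurable ?_ measurableSet_Ioi
    refine ContinuousOn.mul (ContinuousOn.mul (by fun_prop) ?_) continuousOn_const
    exact hf.comp (continuous_mul_exp ψ).continuousOn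
      fun ρ hρ => mul_exp_mem_sector (hδ.trans hρ) hψ hθ
  · refine (ae_restrict_iff' measurableSet_Ioi).2 (Eventually.of_forall fun ρ hρ => ?_)
    have hρ0 : 0 < ρ := hδ.trans hρ
    have h2 := hM _ (mul_exp_mem_sector hρ0 hψ hθ)
    rw [norm_mul_exp hρ0] at h2
    rw [norm_mul, Complex.norm_exp_ofReal_mul_I, mul_one, norm_mul, norm_exp_mul_real, re_mul_exp,
      ← mul_assoc, mul_comm M, mul_assoc]
    refine (mul_le_mul_of_nonneg_left h2 (Real.exp_pos _).le).trans (le_of_eq ?_)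
    ring_nf

open Set Filter in
theorem continuous_arc {φ θ δ : ℝ} (h : ContourAngles φ θ) (hδ : 0 < δ) {f : ℂ → ℂ}
    (hf : ContinuousOn f (sector θ)) :
    ContinuousOn (fun ψ : ℝ => f (δ * Complex.exp (ψ * Complex.I)) *
      (Complex.I * (δ * Complex.exp (ψ * Complex.I)))) (Icc (-φ) φ) := by
  refine ContinuousOn.mul ?_ (by fun_prop)
  exact hf.comp (continuous_mul_exp' δ).continuousOn fun ψ hψ => h.ray_mem hδ hψ

open Set Filter in
theorem contourIntegrable_exp_mul {φ θ t M s δ : ℝ} (h : ContourAngles φ θ) (ht : 0 < t)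
    (hδ : 0 < δ) {f : ℂ → ℂ} (hf : ContinuousOn f (sector θ))
    (hM : ∀ z ∈ sector θ, ‖f z‖ ≤ M * ‖z‖ ^ s) :
    ContourIntegrable φ δ (fun z => Complex.exp (z * t) * f z) := by
  refine ⟨?_, ?_, ?_⟩
  · simp only [exp_neg_mul_I]
    refine integrableOn_ray (h.abs_lt_of_mem h.neg_mem) h.upper ?_ ht hδ hf hM
    rw [Real.cos_neg]
    exact h.cos_neg
  · refine ContinuousOn.intervalIntegrable ?_
    rw [uIcc_of_le (by linarith [h.pos])]
    exact continuous_arc h hδ (f := fun z => Complex.exp (z * t) * f z)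
      (ContinuousOn.mul (by fun_prop) hf)
  · exact integrableOn_ray (h.abs_lt_of_mem h.mem) h.upper h.cos_neg ht hδ hf hM

/-! ### Deformation of the contour and Cauchy's integral formula -/

/-- A set that contains the contour `Γ_{φ,δ}`, if `φ ∈ (π/2, θ)`. -/
def contourSupport (θ δ : ℝ) : Set ℂ := {w ∈ sector θ | ‖w‖ = δ ∨ δ < ‖w‖ ∧ w.re < 0}

namespace ContourAngles

variable {φ θ δ : ℝ} (h : ContourAngles φ θ) (hδ : 0 < δ)
include h hδ

theorem arc_mem_support {ψ : ℝ} (hψ : ψ ∈ Set.Icc (-φ) φ) :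
    (δ : ℂ) * Complex.exp (ψ * Complex.I) ∈ contourSupport θ δ :=
  ⟨h.ray_mem hδ hψ, Or.inl (norm_mul_exp hδ ψ)⟩

theorem upper_mem_support {ρ : ℝ} (hρ : δ < ρ) :
    (ρ : ℂ) * Complex.exp (φ * Complex.I) ∈ contourSupport θ δ := by
  refine ⟨h.ray_mem (hδ.trans hρ) h.mem, Or.inr ?_⟩
  rw [norm_mul_exp (hδ.trans hρ), re_mul_exp]
  exact ⟨hρ, mul_neg_of_pos_of_neg (hδ.trans hρ) h.cos_neg⟩

theorem lower_mem_support {ρ : ℝ} (hρ : δ < ρ) :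
    (ρ : ℂ) * Complex.exp ((-φ : ℝ) * Complex.I) ∈ contourSupport θ δ := by
  refine ⟨h.ray_mem (hδ.trans hρ) h.neg_mem, Or.inr ?_⟩
  rw [norm_mul_exp (hδ.trans hρ), re_mul_exp, Real.cos_neg]
  exact ⟨hρ, mul_neg_of_pos_of_neg (hδ.trans hρ) h.cos_neg⟩

end ContourAngles

open Set Filter in
theorem contourIntegral_congr {φ θ δ : ℝ} (h : ContourAngles φ θ) (hδ : 0 < δ) {f g : ℂ → ℂ}
    (hfg : ∀ z ∈ contourSupport θ δ, f z = g z) :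
    contourIntegral φ δ f = contourIntegral φ δ g := by
  unfold contourIntegral
  simp only [exp_neg_mul_I]
  congr 1
  · congr 1
    · congr 1
      refine setIntegral_congr_fun measurableSet_Ioi fun ρ hρ => ?_
      simp only [hfg _ (h.lower_mem_support hδ hρ)]
    · refine intervalIntegral.integral_congr fun ψ hψ => ?_
      rw [uIcc_of_le (by linarith [h.pos])] at hψ
      simp only [hfg _ (h.arc_mem_support hδ hψ)]
  · refine setIntegral_congr_fun measurableSet_Ioi fun ρ hρ => ?_
    simp only [hfg _ (h.upper_mem_support hδ hρ)]

open Set Filter in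
-- The hypotheses concern `contourSupport` only. That set misses every `z` with `0 < Re z` and `δ <
-- |z|`, so integrands with a pole at such a point are admitted.
theorem contourIntegrable_of_quadratic_decay {φ θ M δ : ℝ} (h : ContourAngles φ θ) (hδ : 0 < δ)
    {f : ℂ → ℂ} (hf : ContinuousOn f (contourSupport θ δ))
    (hM : ∀ z ∈ contourSupport θ δ, ‖f z‖ ≤ M / ‖z‖ ^ 2) : ContourIntegrable φ δ f := by
  have ray : ∀ ψ : ℝ, (∀ ρ : ℝ, δ < ρ → (ρ : ℂ) * Complex.exp (ψ * Complex.I) ∈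
      contourSupport θ δ) → IntegrableOn (fun ρ : ℝ => f (ρ * Complex.exp (ψ * Complex.I)) *
        Complex.exp (ψ * Complex.I)) (Ioi δ) := by
    intro ψ hψ
    have h2 : IntegrableOn (fun ρ : ℝ => M * ρ ^ (-2 : ℝ)) (Ioi δ) :=
      (integrableOn_Ioi_rpow_of_lt (by norm_num) hδ).const_mul M
    refine Integrable.mono' h2 ?_ ?_
    · refine ContinuousOn.aestronglyMeasurable ?_ measurableSet_Ioi
      exact (hf.comp (continuous_mul_exp ψ).continuousOn hψ).mul continuousOn_const
    · refine (ae_restrict_iff' measurableSet_Ioi).2 (Eventually.of_forall fun ρ hρ => ?_)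
      have hρ0 : 0 < ρ := hδ.trans hρ
      have h3 := hM _ (hψ ρ hρ)
      rw [norm_mul_exp hρ0] at h3
      rw [norm_mul, Complex.norm_exp_ofReal_mul_I, mul_one, Real.rpow_neg hρ0.le,
        ← div_eq_mul_inv]
      exact_mod_cast h3
  refine ⟨?_, ?_, ?_⟩
  · simp only [exp_neg_mul_I]
    exact ray _ fun ρ hρ => h.lower_mem_support hδ hρ
  · refine ContinuousOn.intervalIntegrable ?_
    rw [uIcc_of_le (by linarith [h.pos])]
    exact (hf.comp (continuous_mul_exp' δ).continuousOn fun ψ hψ => h.arc_mem_support hδ hψ).mul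
      (by fun_prop)
  · exact ray _ fun ρ hρ => h.upper_mem_support hδ hρ

open Set Filter in
-- The two contours differ by the boundary of the truncated sector `δ ≤ |w| ≤ δ'`, `|arg w| ≤ φ`, in
-- which `f` is holomorphic.
theorem contourIntegral_eq_of_le {φ θ δ δ' : ℝ} (h : ContourAngles φ θ) (hδ : 0 < δ)
    (hδ' : δ ≤ δ') {f : ℂ → ℂ} (hf : DifferentiableOn ℂ f (sector θ))
    (hi : ContourIntegrable φ δ f) :
    contourIntegral φ δ f = contourIntegral φ δ' f := by
  have h0 := integral_boundary_polarRect_eq_zero (g := f) (a := -φ) (b := φ) hδ hδ'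
    (by linarith [h.pos]) (fun ρ hρ ψ hψ => (hf.differentiableAt
      ((isOpen_sector h.upper).mem_nhds (h.ray_mem (hδ.trans_le hρ.1) hψ))))
  have split : ∀ g : ℝ → ℂ, IntegrableOn g (Ioi δ) →
      ∫ ρ in Ioi δ, g ρ = (∫ ρ in δ..δ', g ρ) + ∫ ρ in Ioi δ', g ρ := by
    intro g hg
    rw [intervalIntegral.integral_of_le hδ', ← setIntegral_union _ measurableSet_Ioi
      (hg.mono_set Ioc_subset_Ioi_self) (hg.mono_set (Ioi_subset_Ioi hδ')),
      Ioc_union_Ioi_eq_Ioi hδ']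
    exact disjoint_left.2 fun x hx hx' => not_lt.2 hx.2 hx'
  unfold contourIntegral
  rw [split _ hi.lower, split _ hi.upper]
  simp only [exp_neg_mul_I]
  linear_combination -h0

open Set Filter in
theorem contourIntegral_eq {φ θ δ δ' : ℝ} (h : ContourAngles φ θ) (hδ : 0 < δ)
    (hδ' : 0 < δ') {f : ℂ → ℂ} (hf : DifferentiableOn ℂ f (sector θ))
    (hi : ∀ ε, 0 < ε → ContourIntegrable φ ε f) :
    contourIntegral φ δ f = contourIntegral φ δ' f := by
  rcases le_total δ δ' with h1 | h1
  · exact contourIntegral_eq_of_le h hδ h1 hf (hi δ hδ)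
  · exact (contourIntegral_eq_of_le h hδ' h1 hf (hi δ' hδ')).symm

open Set Filter in
/-- The contour can be closed at infinity on the right. -/
theorem contourIntegral_eq_zero {φ θ M R δ : ℝ} (h : ContourAngles φ θ) (hδ : 0 < δ)
    {g : ℂ → ℂ} (hg : DifferentiableOn ℂ g (sector θ))
    (hM : ∀ z ∈ sector θ, R ≤ ‖z‖ → ‖g z‖ ≤ M / ‖z‖ ^ 2) : contourIntegral φ δ g = 0 := by
  -- Quadratic decay is assumed only for `|z| ≥ R`. On the remaining compact piece a bound `B`
  -- exists, and `B ≤ B R² / ρ²` there, so `max M (B R²)` serves for all radii.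
  have hc : IsCompact ((fun p : ℝ × ℝ => (p.1 : ℂ) * Complex.exp (p.2 * Complex.I)) ''
      (Icc δ R ×ˢ Icc (-φ) φ)) :=
    (isCompact_Icc.prod isCompact_Icc).image (by fun_prop)
  obtain ⟨B, hB⟩ := hc.exists_bound_of_continuousOn (f := g) (hg.continuousOn.mono (by
    rintro _ ⟨p, hp, rfl⟩
    exact h.ray_mem (hδ.trans_le hp.1.1) hp.2))
  have h0 := integral_boundary_infinitePolarRect_eq_zero (g := g) (a := -φ) (b := φ)
    (M := max M (B * R ^ 2)) hδ (by linarith [h.pos])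
    (fun ρ hρ ψ hψ => (hg.differentiableAt
      ((isOpen_sector h.upper).mem_nhds (h.ray_mem (hδ.trans_le hρ) hψ)))) ?_
  · unfold contourIntegral
    simp only [exp_neg_mul_I]
    linear_combination -h0
  · intro ρ hρ ψ hψ
    have hρ0 : 0 < ρ := hδ.trans_le hρ
    rcases le_total R ρ with h1 | h1
    · have h2 := hM _ (h.ray_mem hρ0 hψ) (by rwa [norm_mul_exp hρ0])
      rw [norm_mul_exp hρ0] at h2
      exact h2.trans (div_le_div_of_nonneg_right (le_max_left _ _) (by positivity))
    · have h2 := hB _ (mem_image_of_mem _ (show (ρ, ψ) ∈ Icc δ R ×ˢ Icc (-φ) φ from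
        ⟨⟨hρ, h1⟩, hψ⟩))
      rw [le_div_iff₀ (by positivity)]
      refine le_trans ?_ (le_max_right _ _)
      have h3 := (norm_nonneg _).trans h2
      gcongr

/-- On the complementary sector, to the left of the contour, this bounds the real part of `ρ e^{iψ}`
by `ρ cos φ`, which separates it from the right half plane. -/
theorem cos_le_of_mem_reflected {φ ψ : ℝ} (h1 : 0 ≤ φ)
    (hψ : ψ ∈ Set.Icc φ (2 * Real.pi - φ)) : Real.cos ψ ≤ Real.cos φ := by
  rcases le_total ψ Real.pi with h | h
  · exact Real.cos_le_cos_of_nonneg_of_le_pi h1 h hψ.1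
  · rw [← Real.cos_two_pi_sub ψ]
    exact Real.cos_le_cos_of_nonneg_of_le_pi h1 (by linarith) (by linarith [hψ.2])

open Set Filter in
-- The kernel has no branch cut and decays quadratically, so the contour can be closed at infinity
-- on the left. What is left is the full circle `|w| = δ`, which encloses `0` but not `z`; Cauchy's
-- formula at `0` gives the value.
theorem contourIntegral_kernel {φ θ δ : ℝ} (h : ContourAngles φ θ) (hδ : 0 < δ) {z : ℂ}
    (hz : 0 < z.re) (hzδ : δ < ‖z‖) :
    contourIntegral φ δ (fun w => w⁻¹ * (z - w)⁻¹) = 2 * Real.pi * Complex.I * z⁻¹ := by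
  have hφπ : φ ≤ Real.pi := h.lt.le.trans h.upper
  have hcos := h.cos_neg
  have hne : ∀ ρ : ℝ, δ ≤ ρ → ∀ ψ ∈ Icc φ (2 * Real.pi - φ),
      -Real.cos φ * ρ ≤ ‖z - ρ * Complex.exp (ψ * Complex.I)‖ := by
    intro ρ hρ ψ hψ
    have h1 : (z - ρ * Complex.exp (ψ * Complex.I)).re = z.re - ρ * Real.cos ψ := by
      rw [Complex.sub_re, re_mul_exp]
    have h2 := cos_le_of_mem_reflected h.pos.le hψ
    have h3 := Complex.re_le_norm (z - ρ * Complex.exp (ψ * Complex.I))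
    nlinarith [hδ.trans_le hρ]
  have h0 := integral_boundary_infinitePolarRect_eq_zero (g := fun w => w⁻¹ * (z - w)⁻¹)
    (a := φ) (b := 2 * Real.pi - φ) (M := (-Real.cos φ)⁻¹) hδ (by linarith) ?_ ?_
  · have per : ∀ ψ : ℝ, Complex.exp (((ψ + 2 * Real.pi : ℝ) : ℂ) * Complex.I)
        = Complex.exp (ψ * Complex.I) := fun ψ => by
      rw [Complex.ofReal_add, add_mul, Complex.ofReal_mul, Complex.ofReal_ofNat,
        Complex.exp_add, Complex.exp_two_pi_mul_I, mul_one]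
    -- The lower ray, with angle `-φ`, is the second side of the complementary sector `φ ≤ ψ ≤ 2π -
    -- φ`.
    have e1 : Complex.exp (((2 * Real.pi - φ : ℝ) : ℂ) * Complex.I)
        = Complex.exp (((-φ : ℝ) : ℂ) * Complex.I) := by
      rw [← per (-φ)]
      congr 3
      ring
    set q : ℝ → ℂ := fun ψ => ((δ : ℂ) * Complex.exp (ψ * Complex.I))⁻¹ *
      (z - δ * Complex.exp (ψ * Complex.I))⁻¹ *
      (Complex.I * (δ * Complex.exp (ψ * Complex.I))) with hq
    have hqc : Continuous q := by
      have c1 : ∀ ψ : ℝ, (δ : ℂ) * Complex.exp (ψ * Complex.I) ≠ 0 := fun ψ =>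
        mul_ne_zero (by exact_mod_cast hδ.ne') (Complex.exp_ne_zero _)
      have c2 : ∀ ψ : ℝ, z - (δ : ℂ) * Complex.exp (ψ * Complex.I) ≠ 0 := fun ψ h1 => by
        rw [sub_eq_zero] at h1
        rw [h1, norm_mul_exp hδ] at hzδ
        exact lt_irrefl _ hzδ
      exact (((continuous_mul_exp' δ).inv₀ c1).mul
        ((continuous_const.sub (continuous_mul_exp' δ)).inv₀ c2)).mul (by fun_prop)
    have e2 : (∫ ψ in (-φ)..φ, q ψ) + ∫ ψ in φ..(2 * Real.pi - φ), q ψ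
        = 2 * Real.pi * Complex.I * z⁻¹ := by
      rw [intervalIntegral.integral_add_adjacent_intervals (hqc.intervalIntegrable _ _)
        (hqc.intervalIntegrable _ _)]
      have hper : Function.Periodic q (2 * Real.pi) := fun ψ => by
        simp only [hq, per]
      have e3 := hper.intervalIntegral_add_eq (-φ) 0
      rw [show -φ + 2 * Real.pi = 2 * Real.pi - φ by ring, zero_add] at e3
      rw [e3]
      have hd : DiffContOnCl ℂ (fun w : ℂ => (z - w)⁻¹) (Metric.ball 0 δ) := by
        refine DifferentiableOn.diffContOnCl fun w hw => ?_
        have hw' : ‖w‖ ≤ δ := by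
          simpa using (closure_mono Metric.ball_subset_closedBall).trans
            Metric.isClosed_closedBall.closure_eq.subset hw
        refine DifferentiableAt.differentiableWithinAt (DifferentiableAt.inv (by fun_prop) ?_)
        intro h1
        rw [sub_eq_zero] at h1
        rw [h1] at hzδ
        exact not_lt.2 hw' hzδ
      have e4 := hd.circleIntegral_sub_inv_smul (w := 0) (Metric.mem_ball_self hδ)
      simp only [sub_zero, smul_eq_mul] at e4
      rw [← e4, circleIntegral]
      refine intervalIntegral.integral_congr fun ψ _ => ?_
      simp only [hq, deriv_circleMap, circleMap, zero_add, smul_eq_mul]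
      ring
    unfold contourIntegral
    simp only [exp_neg_mul_I]
    rw [e1] at h0
    linear_combination h0 + e2
  · intro ρ hρ ψ hψ
    have hρ0 := hδ.trans_le hρ
    have h1 : (ρ : ℂ) * Complex.exp (ψ * Complex.I) ≠ 0 :=
      mul_ne_zero (by exact_mod_cast hρ0.ne') (Complex.exp_ne_zero _)
    have h2 : z - (ρ : ℂ) * Complex.exp (ψ * Complex.I) ≠ 0 := norm_pos_iff.1
      (lt_of_lt_of_le (mul_pos (neg_pos.2 hcos) hρ0) (hne ρ hρ ψ hψ))
    exact (differentiableAt_inv h1).mul ((differentiableAt_const z).sub differentiableAt_id |>.inv h2)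
  · intro ρ hρ ψ hψ
    have hρ0 := hδ.trans_le hρ
    have h2 := hne ρ hρ ψ hψ
    have h3 : 0 < -Real.cos φ * ρ := mul_pos (neg_pos.2 hcos) hρ0
    rw [norm_mul, norm_inv, norm_inv, norm_mul_exp hρ0]
    calc _ ≤ ρ⁻¹ * (-Real.cos φ * ρ)⁻¹ := by gcongr
      _ = _ := by
        rw [mul_inv]
        ring

theorem mem_sector_of_re_pos {θ : ℝ} (hθ : Real.pi / 2 < θ) {z : ℂ} (hz : 0 < z.re) :
    z ∈ sector θ :=
  ⟨fun h => by simp [h] at hz,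
    (Complex.abs_arg_lt_pi_div_two_iff.2 (Or.inl hz)).trans hθ⟩

open Set Filter in
/-- Cauchy's integral formula for the contour and functions that decay at infinity. -/
theorem contourIntegral_cauchy {φ θ M δ : ℝ} (h : ContourAngles φ θ) (hδ : 0 < δ) {G : ℂ → ℂ}
    (hG : DifferentiableOn ℂ G (sector θ)) (hM : ∀ z ∈ sector θ, ‖G z‖ ≤ M / ‖z‖) {z : ℂ}
    (hz : 0 < z.re) (hzδ : δ < ‖z‖) :
    contourIntegral φ δ (fun w => G w * (z - w)⁻¹) = 2 * Real.pi * Complex.I * G z := by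
  have hzs : z ∈ sector θ := mem_sector_of_re_pos (h.lower.trans h.lt) hz
  have hz0 : z ≠ 0 := hzs.1
  have hzn : 0 < ‖z‖ := norm_pos_iff.2 hz0
  -- Subtracting a multiple of `1/w`, which decays like `G`, makes the function vanish at `z`. Its
  -- difference quotient is then holomorphic in the whole sector and decays quadratically, so it
  -- integrates to zero; the subtracted term is handled by `contourIntegral_kernel`.
  set N : ℂ → ℂ := fun w => G w - G z * z * w⁻¹ with hN
  have hNz : N z = 0 := by simp [hN, hz0]
  have hNd : DifferentiableOn ℂ N (sector θ) :=
    hG.sub ((differentiableOn_inv.mono fun w hw => hw.1).const_mul _)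
  have hNM : ∀ w ∈ sector θ, ‖N w‖ ≤ (M + ‖G z * z‖) / ‖w‖ := by
    intro w hw
    refine (norm_sub_le _ _).trans ?_
    rw [add_div, norm_mul (G z * z), norm_inv, ← div_eq_mul_inv]
    exact add_le_add (hM w hw) le_rfl
  have hds : DifferentiableOn ℂ (dslope N z) (sector θ) :=
    (Complex.differentiableOn_dslope ((isOpen_sector h.upper).mem_nhds hzs)).2 hNd
  have hdv : ∀ w, w ≠ z → dslope N z w = (w - z)⁻¹ * N w := by
    intro w hw
    rw [dslope_of_ne _ hw, slope, hNz, vsub_eq_sub, sub_zero, smul_eq_mul]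
  have hdM : ∀ w ∈ sector θ, 2 * ‖z‖ ≤ ‖w‖ →
      ‖dslope N z w‖ ≤ (2 * (M + ‖G z * z‖)) / ‖w‖ ^ 2 := by
    intro w hw hzw
    have hw0 : 0 < ‖w‖ := norm_pos_iff.2 hw.1
    have h1 : ‖w‖ / 2 ≤ ‖w - z‖ := by linarith [norm_sub_norm_le w z]
    have h2 : w ≠ z := fun h2 => by rw [h2] at hzw; linarith
    rw [hdv w h2, norm_mul, norm_inv]
    calc ‖w - z‖⁻¹ * ‖N w‖ ≤ (‖w‖ / 2)⁻¹ * ((M + ‖G z * z‖) / ‖w‖) := by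
          gcongr
          exact hNM w hw
      _ = _ := by field_simp
  have hne : ∀ w ∈ contourSupport θ δ, w ≠ z := by
    rintro w ⟨_, h1 | h1⟩ rfl
    · exact hzδ.ne' h1
    · exact not_lt.2 h1.2.le hz
  have hsub : contourSupport θ δ ⊆ sector θ := fun w hw => hw.1
  have hcinv : ContinuousOn (fun w : ℂ => w⁻¹ * (z - w)⁻¹) (contourSupport θ δ) :=
    ContinuousOn.mul (continuousOn_inv₀.mono fun w hw => hw.1.1)
      (ContinuousOn.inv₀ (by fun_prop) fun w hw => sub_ne_zero.2 (hne w hw).symm)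
  have hlow : ∀ w ∈ contourSupport θ δ, δ ≤ ‖w‖ := by
    rintro w ⟨_, h1 | h1⟩
    · exact h1.ge
    · exact h1.1.le
  -- The distance from `z` to the contour is comparable to the distance from the origin.
  have hdist : ∀ w ∈ contourSupport θ δ,
      ‖w‖ * min (1 / 2) (min (z.re / (2 * ‖z‖)) ((‖z‖ - δ) / (2 * ‖z‖))) ≤ ‖z - w‖ := by
    intro w hw
    have hw0 : 0 < ‖w‖ := hδ.trans_le (hlow w hw)
    rcases le_total (2 * ‖z‖) ‖w‖ with h1 | h1
    · refine (mul_le_mul_of_nonneg_left (min_le_left _ _) hw0.le).trans ?_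
      have := norm_sub_norm_le w z
      rw [norm_sub_rev] at this
      linarith
    · obtain ⟨_, h2 | h2⟩ := hw
      · refine (mul_le_mul_of_nonneg_left ((min_le_right _ _).trans (min_le_right _ _))
          hw0.le).trans ?_
        have h3 := norm_sub_norm_le z w
        rw [h2] at h3
        refine le_trans ?_ h3
        rw [mul_div_assoc', div_le_iff₀ (by positivity), mul_comm]
        exact mul_le_mul_of_nonneg_left h1 (by linarith)
      · refine (mul_le_mul_of_nonneg_left ((min_le_right _ _).trans (min_le_left _ _))
          hw0.le).trans ?_
        have h3 := Complex.re_le_norm (z - w)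
        rw [Complex.sub_re] at h3
        refine le_trans ?_ (show z.re ≤ ‖z - w‖ by linarith)
        rw [mul_div_assoc', div_le_iff₀ (by positivity), mul_comm]
        exact mul_le_mul_of_nonneg_left h1 hz.le
  have hmin : 0 < min (1 / 2) (min (z.re / (2 * ‖z‖)) ((‖z‖ - δ) / (2 * ‖z‖))) :=
    lt_min (by norm_num) (lt_min (by positivity) (div_pos (by linarith) (by positivity)))
  set d := min (1 / 2) (min (z.re / (2 * ‖z‖)) ((‖z‖ - δ) / (2 * ‖z‖))) with hd
  have hi1 : ContourIntegrable φ δ (fun w => w⁻¹ * (z - w)⁻¹) := by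
    refine contourIntegrable_of_quadratic_decay h hδ (M := d⁻¹) hcinv fun w hw => ?_
    have hw0 : 0 < ‖w‖ := hδ.trans_le (hlow w hw)
    rw [norm_mul, norm_inv, norm_inv]
    calc _ ≤ ‖w‖⁻¹ * (‖w‖ * d)⁻¹ := by
          gcongr
          exact hdist w hw
      _ = _ := by field_simp
  have hi2 : ContourIntegrable φ δ (dslope N z) := by
    refine contourIntegrable_of_quadratic_decay h hδ (M := (M + ‖G z * z‖) * d⁻¹)
      (hds.continuousOn.mono hsub) fun w hw => ?_
    have hw0 : 0 < ‖w‖ := hδ.trans_le (hlow w hw)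
    rw [hdv w (hne w hw), norm_mul, norm_inv, norm_sub_rev]
    calc _ ≤ (‖w‖ * d)⁻¹ * ((M + ‖G z * z‖) / ‖w‖) := by
          gcongr
          · exact hdist w hw
          · exact hNM w (hsub hw)
      _ = _ := by field_simp
  have e1 : contourIntegral φ δ (fun w => G w * (z - w)⁻¹)
      = contourIntegral φ δ (fun w => (-1) * dslope N z w + (G z * z) * (w⁻¹ * (z - w)⁻¹)) := by
    refine contourIntegral_congr h hδ fun w hw => ?_
    rw [hdv w (hne w hw)]
    have h1 : w - z ≠ 0 := sub_ne_zero.2 (hne w hw)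
    have h2 : z - w ≠ 0 := sub_ne_zero.2 (hne w hw).symm
    have h3 : (w - z)⁻¹ = -(z - w)⁻¹ := by rw [← inv_neg, neg_sub]
    rw [h3, hN]
    ring
  rw [e1, contourIntegral_add (hi2.const_mul _) (hi1.const_mul _), contourIntegral_const_mul,
    contourIntegral_const_mul, contourIntegral_eq_zero h hδ hds hdM,
    contourIntegral_kernel h hδ hz hzδ]
  field_simp
  ring

/-! ### Laplace transforms of contour integrals and uniqueness -/

open Set Filter in
-- Fubini: integrating `e^{-(z - γ)t}` in `t` gives `1/(z - γ)`, and doing the same with absolute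
-- values gives precisely the integrand of `hint`, so that hypothesis is absolute integrability on
-- the product.
theorem laplace_integral {S : Set ℝ} (hS : MeasurableSet S) {γ H : ℝ → ℂ}
    (hγ : ContinuousOn γ S) (hH : ContinuousOn H S) {z : ℂ} (hre : ∀ s ∈ S, (γ s).re < z.re)
    (hint : IntegrableOn (fun s => ‖H s‖ / (z.re - (γ s).re)) S) :
    IntegrableOn (fun t : ℝ => Complex.exp (-(z * t)) * ∫ s in S, Complex.exp (γ s * t) * H s)
      (Ioi 0) ∧
    ∫ t in Ioi (0 : ℝ), Complex.exp (-(z * t)) * ∫ s in S, Complex.exp (γ s * t) * H s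
      = ∫ s in S, H s * (z - γ s)⁻¹ := by
  have e0 : ∀ (t s : ℝ), Complex.exp (-(z * t)) * (Complex.exp (γ s * t) * H s)
      = Complex.exp ((γ s - z) * t) * H s := fun t s => by
    rw [← mul_assoc, ← Complex.exp_add]
    ring_nf
  have hneg : ∀ s ∈ S, (γ s - z).re < 0 := fun s hs => by
    rw [Complex.sub_re]
    linarith [hre s hs]
  have hnorm : ∀ s ∈ S, ∫ t in Ioi (0 : ℝ), ‖Complex.exp ((γ s - z) * t) * H s‖
      = ‖H s‖ / (z.re - (γ s).re) := by
    intro s hs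
    simp only [norm_mul, norm_exp_mul_real]
    rw [integral_mul_const, integral_exp_mul_Ioi (hneg s hs), mul_zero, Real.exp_zero,
      Complex.sub_re, ← neg_sub z.re, neg_div_neg_eq]
    ring
  have hprod : Integrable (Function.uncurry fun (t s : ℝ) => Complex.exp ((γ s - z) * t) * H s)
      ((volume.restrict (Ioi (0 : ℝ))).prod (volume.restrict S)) := by
    rw [integrable_prod_iff']
    · refine ⟨(ae_restrict_iff' hS).2 (Eventually.of_forall fun s hs => ?_), ?_⟩
      · exact (integrableOn_exp_mul_complex_Ioi (hneg s hs) 0).mul_const (H s)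
      · refine hint.congr ((ae_restrict_iff' hS).2 (Eventually.of_forall fun s hs => ?_))
        exact (hnorm s hs).symm
    · rw [Measure.prod_restrict]
      refine ContinuousOn.aestronglyMeasurable ?_ (measurableSet_Ioi.prod hS)
      have c1 : ContinuousOn (fun p : ℝ × ℝ => γ p.2) (Ioi (0 : ℝ) ×ˢ S) :=
        hγ.comp continuousOn_snd fun p hp => hp.2
      have c2 : ContinuousOn (fun p : ℝ × ℝ => H p.2) (Ioi (0 : ℝ) ×ˢ S) :=
        hH.comp continuousOn_snd fun p hp => hp.2
      exact ((c1.sub continuousOn_const).mul (by fun_prop)).cexp.mul c2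
  have e1 : (fun t : ℝ => Complex.exp (-(z * t)) * ∫ s in S, Complex.exp (γ s * t) * H s)
      = fun t : ℝ => ∫ s in S, Complex.exp ((γ s - z) * t) * H s := by
    funext t
    rw [← integral_const_mul]
    simp only [e0]
  rw [e1]
  refine ⟨hprod.integral_prod_left, ?_⟩
  rw [integral_integral_swap hprod]
  refine setIntegral_congr_fun hS fun s hs => ?_
  rw [integral_mul_const, integral_exp_mul_complex_Ioi (hneg s hs), Complex.ofReal_zero, mul_zero,
    Complex.exp_zero, neg_div, one_div, ← inv_neg, neg_sub, mul_comm]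

open Set Filter Topology in
-- Dominated convergence on `t₀/2 < t < 2t₀`. Writing `t = t₀/2 + (t - t₀/2)`, the first part keeps
-- the decay needed for integrability and the second costs at most `exp (2 K t₀)`.
theorem continuousAt_laplace_integral {S : Set ℝ} (hS : MeasurableSet S) {γ H : ℝ → ℂ} {K : ℝ}
    (hK : 0 ≤ K) (hγ : ContinuousOn γ S) (hH : ContinuousOn H S) (hre : ∀ s ∈ S, (γ s).re ≤ K)
    (hint : ∀ ε : ℝ, 0 < ε → IntegrableOn (fun s => Real.exp ((γ s).re * ε) * ‖H s‖) S)
    {t₀ : ℝ} (ht₀ : 0 < t₀) :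
    ContinuousAt (fun t : ℝ => ∫ s in S, Complex.exp (γ s * t) * H s) t₀ := by
  refine continuousAt_of_dominated (bound := fun s => Real.exp (K * (2 * t₀)) *
    (Real.exp ((γ s).re * (t₀ / 2)) * ‖H s‖)) ?_ ?_ ?_ ?_
  · refine Eventually.of_forall fun t => ContinuousOn.aestronglyMeasurable ?_ hS
    exact (hγ.mul continuousOn_const).cexp.mul hH
  · filter_upwards [Ioo_mem_nhds (show t₀ / 2 < t₀ by linarith) (show t₀ < 2 * t₀ by linarith)]
      with t ht
    refine (ae_restrict_iff' hS).2 (Eventually.of_forall fun s hs => ?_)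
    rw [norm_mul, norm_exp_mul_real, ← mul_assoc, ← Real.exp_add]
    gcongr
    nlinarith [hre s hs, ht.1, ht.2]
  · exact (hint _ (by positivity)).const_mul _
  · exact Eventually.of_forall fun s => by fun_prop

open Set Filter in
/-- The Laplace transform of a contour integral. -/
theorem contourIntegral_laplace_aux {φ θ M δ : ℝ} (h : ContourAngles φ θ) (hδ : 0 < δ) {G : ℂ → ℂ}
    (hG : ContinuousOn G (sector θ)) (hM : ∀ z ∈ sector θ, ‖G z‖ ≤ M / ‖z‖) {z : ℂ}
    (hz : δ < z.re) :
    IntegrableOn (fun t : ℝ => Complex.exp (-(z * t)) *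
      contourIntegral φ δ (fun w => Complex.exp (w * t) * G w)) (Ioi 0) ∧
    ∫ t in Ioi (0 : ℝ), Complex.exp (-(z * t)) *
      contourIntegral φ δ (fun w => Complex.exp (w * t) * G w)
      = contourIntegral φ δ (fun w => G w * (z - w)⁻¹) := by
  have ray : ∀ ψ ∈ Icc (-φ) φ, Real.cos ψ = Real.cos φ →
      IntegrableOn (fun t : ℝ => Complex.exp (-(z * t)) * ∫ ρ in Ioi δ,
        Complex.exp ((ρ * Complex.exp (ψ * Complex.I)) * t) *
          (G (ρ * Complex.exp (ψ * Complex.I)) * Complex.exp (ψ * Complex.I))) (Ioi 0) ∧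
      ∫ t in Ioi (0 : ℝ), Complex.exp (-(z * t)) * ∫ ρ in Ioi δ,
        Complex.exp ((ρ * Complex.exp (ψ * Complex.I)) * t) *
          (G (ρ * Complex.exp (ψ * Complex.I)) * Complex.exp (ψ * Complex.I))
        = ∫ ρ in Ioi δ, (G (ρ * Complex.exp (ψ * Complex.I)) * Complex.exp (ψ * Complex.I)) *
          (z - ρ * Complex.exp (ψ * Complex.I))⁻¹ := by
    intro ψ hψ hcos
    have hneg : ∀ ρ : ℝ, δ < ρ → ((ρ : ℂ) * Complex.exp (ψ * Complex.I)).re < 0 := fun ρ hρ => by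
      rw [re_mul_exp, hcos]
      exact mul_neg_of_pos_of_neg (hδ.trans hρ) h.cos_neg
    have hGc : ContinuousOn (fun ρ : ℝ => G (ρ * Complex.exp (ψ * Complex.I)) *
        Complex.exp (ψ * Complex.I)) (Ioi δ) :=
      (hG.comp (continuous_mul_exp ψ).continuousOn
        fun ρ hρ => h.ray_mem (hδ.trans hρ) hψ).mul continuousOn_const
    refine laplace_integral measurableSet_Ioi (continuous_mul_exp ψ).continuousOn hGc
      (fun ρ hρ => (hneg ρ hρ).trans (hδ.trans hz)) ?_
    have h2 : IntegrableOn (fun ρ : ℝ => M / (-Real.cos φ) * ρ ^ (-2 : ℝ)) (Ioi δ) :=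
      (integrableOn_Ioi_rpow_of_lt (by norm_num) hδ).const_mul _
    refine Integrable.mono' h2 ?_ ?_
    · refine ContinuousOn.aestronglyMeasurable (ContinuousOn.div hGc.norm ?_ ?_) measurableSet_Ioi
      · exact continuousOn_const.sub
          (Complex.continuous_re.comp (continuous_mul_exp ψ)).continuousOn
      · exact fun ρ hρ => ne_of_gt (by linarith [hneg ρ hρ])
    · refine (ae_restrict_iff' measurableSet_Ioi).2 (Eventually.of_forall fun ρ hρ => ?_)
      have hρ0 : 0 < ρ := hδ.trans hρ
      have h3 := hM _ (h.ray_mem hρ0 hψ)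
      have hc := h.cos_neg
      rw [norm_mul_exp hρ0] at h3
      have h4 : 0 < z.re - ((ρ : ℂ) * Complex.exp (ψ * Complex.I)).re := by
        linarith [hneg ρ hρ]
      rw [Real.norm_of_nonneg (by positivity), norm_mul, Complex.norm_exp_ofReal_mul_I, mul_one]
      have h5 : 0 < -Real.cos φ * ρ := mul_pos (neg_pos.2 hc) hρ0
      calc _ ≤ (M / ρ) / (-Real.cos φ * ρ) := by
            refine div_le_div₀ ((norm_nonneg _).trans h3) h3 h5 ?_
            rw [re_mul_exp, hcos]
            linarith
        _ = _ := by
          rw [Real.rpow_neg hρ0.le, Real.rpow_ofNat]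
          field_simp
  have up := ray φ h.mem rfl
  have low := ray (-φ) h.neg_mem (Real.cos_neg φ)
  have arc := laplace_integral (S := Ioc (-φ) φ) measurableSet_Ioc
    (γ := fun ψ : ℝ => (δ : ℂ) * Complex.exp (ψ * Complex.I))
    (H := fun ψ : ℝ => G (δ * Complex.exp (ψ * Complex.I)) *
      (Complex.I * (δ * Complex.exp (ψ * Complex.I)))) (z := z)
    (continuous_mul_exp' δ).continuousOn ((continuous_arc h hδ hG).mono Ioc_subset_Icc_self)
    (fun ψ _ => by
      rw [re_mul_exp]
      nlinarith [Real.cos_le_one ψ])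
    (by
      refine IntegrableOn.mono_set (ContinuousOn.integrableOn_Icc ?_) Ioc_subset_Icc_self
      refine (continuous_arc h hδ hG).norm.div ?_ ?_
      · exact continuousOn_const.sub
          (Complex.continuous_re.comp (continuous_mul_exp' δ)).continuousOn
      · intro ψ _
        rw [re_mul_exp]
        nlinarith [Real.cos_le_one ψ])
  have hle : -φ ≤ φ := by linarith [h.pos]
  have expand : ∀ t : ℝ, Complex.exp (-(z * t)) *
      contourIntegral φ δ (fun w => Complex.exp (w * t) * G w)
      = -(Complex.exp (-(z * t)) * ∫ ρ in Ioi δ,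
          Complex.exp ((ρ * Complex.exp ((-φ : ℝ) * Complex.I)) * t) *
          (G (ρ * Complex.exp ((-φ : ℝ) * Complex.I)) * Complex.exp ((-φ : ℝ) * Complex.I)))
        + (Complex.exp (-(z * t)) * ∫ ψ in Ioc (-φ) φ,
          Complex.exp ((δ * Complex.exp (ψ * Complex.I)) * t) *
          (G (δ * Complex.exp (ψ * Complex.I)) *
          (Complex.I * (δ * Complex.exp (ψ * Complex.I)))))
        + (Complex.exp (-(z * t)) * ∫ ρ in Ioi δ,
          Complex.exp ((ρ * Complex.exp (φ * Complex.I)) * t) *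
          (G (ρ * Complex.exp (φ * Complex.I)) * Complex.exp (φ * Complex.I))) := by
    intro t
    rw [contourIntegral, intervalIntegral.integral_of_le hle]
    simp only [exp_neg_mul_I, mul_assoc]
    ring
  simp only [expand]
  refine ⟨(low.1.neg.add arc.1).add up.1, ?_⟩
  have split : ∀ {A B C : ℝ → ℂ}, IntegrableOn A (Ioi 0) → IntegrableOn B (Ioi 0) →
      IntegrableOn C (Ioi 0) → ∫ t in Ioi (0 : ℝ), (-A t + B t + C t)
        = -(∫ t in Ioi (0 : ℝ), A t) + (∫ t in Ioi (0 : ℝ), B t) + ∫ t in Ioi (0 : ℝ), C t := by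
    intro A B C hA hB hC
    refine (integral_add (hA.neg.add hB) hC).trans ?_
    congr 1
    exact (integral_add hA.neg hB).trans (congrArg (· + _) (integral_neg A))
  refine (split low.1 arc.1 up.1).trans ?_
  rw [low.2, arc.2, up.2, contourIntegral, intervalIntegral.integral_of_le hle]
  simp only [exp_neg_mul_I, mul_right_comm]

open Set Filter in
theorem continuousAt_contourIntegral {φ θ M s δ : ℝ} (h : ContourAngles φ θ) (hδ : 0 < δ)
    {G : ℂ → ℂ} (hG : ContinuousOn G (sector θ)) (hM : ∀ z ∈ sector θ, ‖G z‖ ≤ M * ‖z‖ ^ s)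
    {t₀ : ℝ} (ht₀ : 0 < t₀) :
    ContinuousAt (fun t : ℝ => contourIntegral φ δ (fun w => Complex.exp (w * t) * G w)) t₀ := by
  have ray : ∀ ψ ∈ Icc (-φ) φ, Real.cos ψ = Real.cos φ →
      ContinuousAt (fun t : ℝ => ∫ ρ in Ioi δ,
        Complex.exp ((ρ * Complex.exp (ψ * Complex.I)) * t) *
          (G (ρ * Complex.exp (ψ * Complex.I)) * Complex.exp (ψ * Complex.I))) t₀ := by
    intro ψ hψ hcos
    have hcos' : Real.cos ψ < 0 := hcos ▸ h.cos_neg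
    refine continuousAt_laplace_integral measurableSet_Ioi le_rfl
      (continuous_mul_exp ψ).continuousOn ?_ ?_ ?_ ht₀
    · exact (hG.comp (continuous_mul_exp ψ).continuousOn
        fun ρ hρ => h.ray_mem (hδ.trans hρ) hψ).mul continuousOn_const
    · intro ρ hρ
      rw [re_mul_exp]
      exact (mul_neg_of_pos_of_neg (hδ.trans hρ) hcos').le
    · intro ε hε
      refine (integrableOn_ray (h.abs_lt_of_mem hψ) h.upper hcos' hε hδ hG hM).norm.congr ?_
      refine Eventually.of_forall fun ρ => ?_
      simp only [norm_mul, norm_exp_mul_real]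
      ring
  have up := ray φ h.mem rfl
  have low := ray (-φ) h.neg_mem (Real.cos_neg φ)
  have arc := continuousAt_laplace_integral (S := Ioc (-φ) φ) measurableSet_Ioc hδ.le
    (γ := fun ψ : ℝ => (δ : ℂ) * Complex.exp (ψ * Complex.I))
    (H := fun ψ : ℝ => G (δ * Complex.exp (ψ * Complex.I)) *
      (Complex.I * (δ * Complex.exp (ψ * Complex.I))))
    (continuous_mul_exp' δ).continuousOn ((continuous_arc h hδ hG).mono Ioc_subset_Icc_self)
    (fun ψ _ => by
      rw [re_mul_exp]
      nlinarith [Real.cos_le_one ψ])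
    (by
      intro ε _
      refine IntegrableOn.mono_set (ContinuousOn.integrableOn_Icc ?_) Ioc_subset_Icc_self
      exact (((Complex.continuous_re.comp (continuous_mul_exp' δ)).mul
        continuous_const).rexp.continuousOn).mul (continuous_arc h hδ hG).norm) ht₀
  have hle : -φ ≤ φ := by linarith [h.pos]
  refine ((low.neg.add arc).add up).congr (Eventually.of_forall fun t => ?_)
  simp only [contourIntegral, intervalIntegral.integral_of_le hle, exp_neg_mul_I, mul_assoc]
  rfl

open Set Filter FourierTransform in
/-- Uniqueness for the Laplace transform. -/
theorem eq_zero_of_laplace_eq_zero {D : ℝ → ℂ} {K b : ℝ} (hD : ContinuousOn D (Ioi 0))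
    (hK : ∀ t, 0 < t → ‖D t‖ ≤ K * Real.exp (b * t))
    (h0 : ∀ z : ℂ, b < z.re → ∫ t in Ioi (0 : ℝ), Complex.exp (-(z * t)) * D t = 0)
    {t : ℝ} (ht : 0 < t) : D t = 0 := by
  -- The damped function, extended by zero to negative times, is integrable. Its Fourier transform
  -- consists of the values of the Laplace transform on the line `Re z = b + 1`, which vanish;
  -- Fourier inversion at points of continuity concludes.
  set g : ℝ → ℂ := fun s => Complex.exp (-(((b + 1 : ℝ) : ℂ) * s)) * D s with hg
  have hgc : ContinuousOn g (Ioi 0) := ContinuousOn.mul (by fun_prop) hD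
  have hgi : IntegrableOn g (Ioi 0) := by
    refine Integrable.mono' (((exp_neg_integrableOn_Ioi 0 one_pos)).const_mul K)
      (hgc.aestronglyMeasurable measurableSet_Ioi) ?_
    refine (ae_restrict_iff' measurableSet_Ioi).2 (Eventually.of_forall fun s hs => ?_)
    have e1 : Real.exp (-1 * s) = Real.exp (-((b + 1) * s)) * Real.exp (b * s) := by
      rw [← Real.exp_add]
      ring_nf
    have e2 : ‖Complex.exp (-(((b + 1 : ℝ) : ℂ) * s))‖ = Real.exp (-((b + 1) * s)) := by
      rw [Complex.norm_exp]
      simp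
    rw [hg, norm_mul, e2, e1, mul_left_comm]
    exact mul_le_mul_of_nonneg_left (hK s hs) (Real.exp_pos _).le
  set f : ℝ → ℂ := (Ioi (0 : ℝ)).indicator g with hf
  have hfi : Integrable f := (integrable_indicator_iff measurableSet_Ioi).2 hgi
  have hF : 𝓕 f = 0 := by
    funext w
    rw [Real.fourier_real_eq_integral_exp_smul]
    have e3 : ∀ v : ℝ, Complex.exp (↑(-2 * Real.pi * v * w) * Complex.I) • f v
        = (Ioi (0 : ℝ)).indicator (fun v : ℝ =>
          Complex.exp (-((((b + 1 : ℝ) : ℂ) + 2 * Real.pi * w * Complex.I) * v)) * D v) v := by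
      intro v
      by_cases hv : v ∈ Ioi (0 : ℝ)
      · rw [hf, indicator_of_mem hv, indicator_of_mem hv, hg, smul_eq_mul, ← mul_assoc,
          ← Complex.exp_add]
        congr 2
        push_cast
        ring
      · rw [hf, indicator_of_notMem hv, indicator_of_notMem hv, smul_zero]
    simp only [e3]
    rw [integral_indicator measurableSet_Ioi, h0 _ (by simp)]
    rfl
  have h1 := hfi.fourierInv_fourier_eq (by rw [hF]; exact integrable_zero _ _ _) (v := t) (by
    have h2 : f =ᶠ[nhds t] g := by
      filter_upwards [Ioi_mem_nhds ht] with s hs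
      rw [hf, indicator_of_mem hs]
    exact (hgc.continuousAt (Ioi_mem_nhds ht)).congr h2.symm)
  have h3 : 𝓕⁻ (0 : ℝ → ℂ) t = 0 := by
    rw [Real.fourierInv_eq]
    simp
  rw [hF, h3, hf, indicator_of_mem (show t ∈ Ioi (0 : ℝ) from ht), hg] at h1
  exact (mul_eq_zero.1 h1.symm).resolve_left (Complex.exp_ne_zero _)

theorem mul_norm_rpow_neg_one (M : ℝ) (z : ℂ) : M * ‖z‖ ^ (-1 : ℝ) = M / ‖z‖ := by
  rw [Real.rpow_neg_one, div_eq_mul_inv]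

/-! ### The contour integral as an inverse Laplace transform -/

section InverseLaplace

variable {φ θ M : ℝ} (h : ContourAngles φ θ) {G : ℂ → ℂ}
  (hG : DifferentiableOn ℂ G (sector θ)) (hM : ∀ z ∈ sector θ, ‖G z‖ ≤ M / ‖z‖)
include h hG hM

/-- The radius `1/t` is right for bounds at time `t`, but continuity in `t` and Laplace transforms
require a contour that does not move with `t`; this passes from one to the other. -/
theorem contourIntegral_exp_eq {t δ δ' : ℝ} (ht : 0 < t) (hδ : 0 < δ) (hδ' : 0 < δ') :
    contourIntegral φ δ (fun w => Complex.exp (w * t) * G w)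
      = contourIntegral φ δ' (fun w => Complex.exp (w * t) * G w) := by
  refine contourIntegral_eq h hδ hδ' (DifferentiableOn.mul (by fun_prop) hG) fun ε hε => ?_
  exact contourIntegrable_exp_mul h ht hε hG.continuousOn (M := M) (s := -1)
    fun z hz => (hM z hz).trans_eq (mul_norm_rpow_neg_one M z).symm

theorem continuousOn_inverseLaplace :
    ContinuousOn (fun t : ℝ => contourIntegral φ (1 / t) (fun w => Complex.exp (w * t) * G w))
      (Set.Ioi 0) := by
  refine ContinuousOn.congr (f := fun t : ℝ =>
    contourIntegral φ 1 (fun w => Complex.exp (w * t) * G w)) (fun t ht => ?_) fun t ht => ?_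
  · exact (continuousAt_contourIntegral h one_pos hG.continuousOn (M := M) (s := -1)
      (fun z hz => (hM z hz).trans_eq (mul_norm_rpow_neg_one M z).symm) ht).continuousWithinAt
  · exact contourIntegral_exp_eq h hG hM ht (one_div_pos.2 ht) one_pos

theorem laplace_inverseLaplace {z : ℂ} (hz : 0 < z.re) :
    ∫ t in Set.Ioi (0 : ℝ), Complex.exp (-(z * t)) *
      contourIntegral φ (1 / t) (fun w => Complex.exp (w * t) * G w)
      = 2 * Real.pi * Complex.I * G z := by
  -- With this radius every point of the contour has real part below `Re z`, so the transform at `z`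
  -- converges.
  have hδ : 0 < z.re / 2 := by positivity
  have hlt : z.re / 2 < z.re := by linarith
  rw [← contourIntegral_cauchy h hδ hG hM hz (hlt.trans_le (Complex.re_le_norm z)),
    ← (contourIntegral_laplace_aux h hδ hG.continuousOn hM hlt).2]
  refine setIntegral_congr_fun measurableSet_Ioi fun t ht => ?_
  rw [contourIntegral_exp_eq h hG hM ht (one_div_pos.2 ht) hδ]

theorem integrableOn_laplace_inverseLaplace {z : ℂ} (hz : 0 < z.re) :
    IntegrableOn (fun t : ℝ => Complex.exp (-(z * t)) *
      contourIntegral φ (1 / t) (fun w => Complex.exp (w * t) * G w)) (Set.Ioi 0) := by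
  have hδ : 0 < z.re / 2 := by positivity
  have hlt : z.re / 2 < z.re := by linarith
  refine (contourIntegral_laplace_aux h hδ hG.continuousOn hM hlt).1.congr_fun (fun t ht => ?_)
    measurableSet_Ioi
  simp only
  rw [contourIntegral_exp_eq h hG hM ht (one_div_pos.2 ht) hδ]

/-- A continuous, exponentially bounded function is the contour integral of its Laplace
transform. -/
theorem eq_inverseLaplace {y : ℝ → ℂ} {K b : ℝ} (hb : 0 ≤ b) (hy : ContinuousOn y (Set.Ioi 0))
    (hK : ∀ t, 0 < t → ‖y t‖ ≤ K * Real.exp (b * t))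
    (hL : ∀ z : ℂ, b < z.re → ∫ t in Set.Ioi (0 : ℝ), Complex.exp (-(z * t)) * y t = G z)
    {t : ℝ} (ht : 0 < t) :
    y t = (2 * Real.pi * Complex.I)⁻¹ *
      contourIntegral φ (1 / t) (fun w => Complex.exp (w * t) * G w) := by
  have hpi : (2 * Real.pi * Complex.I : ℂ) ≠ 0 := Complex.two_pi_I_ne_zero
  set U : ℝ → ℂ := fun t => contourIntegral φ (1 / t) (fun w => Complex.exp (w * t) * G w) with hU
  have hUK : ∀ t, 0 < t → ‖(2 * Real.pi * Complex.I : ℂ)⁻¹ * U t‖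
      ≤ ‖(2 * Real.pi * Complex.I : ℂ)⁻¹‖ * (M * contourConst φ (-1)) := by
    intro t ht
    have := norm_contourIntegral_le h ht (f := G) (M := M) (s := -1)
      fun z hz => (hM z hz).trans_eq (mul_norm_rpow_neg_one M z).symm
    rw [neg_neg, sub_self, Real.rpow_zero, mul_one] at this
    rw [norm_mul]
    gcongr
  -- Uniqueness is applied to the difference. The exponent `s = -1` leaves no power of `t` in the
  -- contour bound, so the contour integral is bounded on all of `(0, ∞)`.
  have h1 := eq_zero_of_laplace_eq_zero
    (D := fun t => y t - (2 * Real.pi * Complex.I)⁻¹ * U t) (b := b)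
    (K := K + ‖(2 * Real.pi * Complex.I : ℂ)⁻¹‖ * (M * contourConst φ (-1)))
    (hy.sub (continuousOn_const.mul (continuousOn_inverseLaplace h hG hM))) ?_ ?_ ht
  · exact sub_eq_zero.1 h1
  · intro t ht
    refine (norm_sub_le _ _).trans ?_
    rw [add_mul]
    refine add_le_add (hK t ht) ((hUK t ht).trans ?_)
    exact le_mul_of_one_le_right ((norm_nonneg _).trans (hUK t ht))
      (Real.one_le_exp (by positivity))
  · intro z hz
    have hz0 : 0 < z.re := hb.trans_lt hz
    have iU := (integrableOn_laplace_inverseLaplace h hG hM hz0).const_mul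
      ((2 * Real.pi * Complex.I : ℂ)⁻¹)
    have iy : IntegrableOn (fun t : ℝ => Complex.exp (-(z * t)) * y t) (Set.Ioi 0) := by
      refine Integrable.mono' ((exp_neg_integrableOn_Ioi 0 (sub_pos.2 hz)).const_mul K) ?_ ?_
      · exact ContinuousOn.aestronglyMeasurable (ContinuousOn.mul (by fun_prop) hy)
          measurableSet_Ioi
      · refine (ae_restrict_iff' measurableSet_Ioi).2 (Filter.Eventually.of_forall fun s hs => ?_)
        have e1 : Real.exp (-(z.re - b) * s) = Real.exp (-(z.re * s)) * Real.exp (b * s) := by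
          rw [← Real.exp_add]
          ring_nf
        have e2 : ‖Complex.exp (-(z * s))‖ = Real.exp (-(z.re * s)) := by
          rw [Complex.norm_exp]
          simp
        rw [norm_mul, e2, e1, mul_left_comm]
        exact mul_le_mul_of_nonneg_left (hK s hs) (Real.exp_pos _).le
    have e3 : ∀ t : ℝ, Complex.exp (-(z * t)) * (y t - (2 * Real.pi * Complex.I)⁻¹ * U t)
        = Complex.exp (-(z * t)) * y t
          - (2 * Real.pi * Complex.I)⁻¹ * (Complex.exp (-(z * t)) * U t) := fun t => by ring
    simp only [e3]
    rw [integral_sub iy iU, integral_const_mul, hL z hz, laplace_inverseLaplace h hG hM hz0,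
      inv_mul_cancel_left₀ hpi, sub_self]

end InverseLaplace

/-! ### Coercivity on sectors and scalar resolvents -/

/-- The constant in the coercivity estimate for `ζ + s`, `ζ ∈ Σ_θ`, `s ≥ 0`. -/
noncomputable def sectorConst (θ : ℝ) : ℝ := Real.sqrt (2 / (1 + Real.cos θ))

theorem one_add_cos_pos {θ : ℝ} (hθ : θ ∈ Set.Ioo (Real.pi / 2) Real.pi) : 0 < 1 + Real.cos θ := by
  have h1 := Real.cos_lt_cos_of_nonneg_of_le_pi (by linarith [hθ.1, Real.pi_pos]) le_rfl hθ.2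
  rw [Real.cos_pi] at h1
  linarith

theorem sectorConst_pos {θ : ℝ} (hθ : θ ∈ Set.Ioo (Real.pi / 2) Real.pi) : 0 < sectorConst θ :=
  Real.sqrt_pos.2 (div_pos two_pos (one_add_cos_pos hθ))

/-- With `c = cos θ`, `|ζ + s|² ≥ |ζ|² + 2c s|ζ| + s²`, and the right-hand side is `(1 + c)/2 · (|ζ|
+ s)² + (1 - c)/2 · (|ζ| - s)²`. Dropping the second square gives the constant `√(2 / (1 + cos θ))`.
-/
theorem sector_coercive {θ : ℝ} (hθ : θ ∈ Set.Ioo (Real.pi / 2) Real.pi) {ζ : ℂ}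
    (hζ : ζ ∈ sector θ) {s : ℝ} (hs : 0 ≤ s) : ‖ζ‖ + s ≤ sectorConst θ * ‖ζ + s‖ := by
  have hc := one_add_cos_pos hθ
  have hcos : Real.cos θ ≤ Real.cos ζ.arg := by
    rw [← Real.cos_abs ζ.arg]
    exact Real.cos_le_cos_of_nonneg_of_le_pi (abs_nonneg _) hθ.2.le hζ.2.le
  have hneg : Real.cos θ ≤ 0 :=
    Real.cos_nonpos_of_pi_div_two_le_of_le hθ.1.le (by linarith [hθ.2, Real.pi_pos])
  have hre : ζ.re = ‖ζ‖ * Real.cos ζ.arg := (Complex.norm_mul_cos_arg ζ).symm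
  have hn : ‖ζ‖ ^ 2 = ζ.re ^ 2 + ζ.im ^ 2 := by
    rw [Complex.sq_norm, Complex.normSq_apply]
    ring
  have hn' : ‖ζ + s‖ ^ 2 = (ζ.re + s) ^ 2 + ζ.im ^ 2 := by
    rw [Complex.sq_norm, Complex.normSq_apply]
    simp
    ring
  have h1 : ‖ζ‖ * Real.cos θ ≤ ζ.re := by
    rw [hre]
    exact mul_le_mul_of_nonneg_left hcos (norm_nonneg _)
  have h2 : (‖ζ‖ + s) ^ 2 ≤ 2 / (1 + Real.cos θ) * ‖ζ + s‖ ^ 2 := by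
    rw [div_mul_eq_mul_div, le_div_iff₀ hc, hn']
    have h3 : s * (‖ζ‖ * Real.cos θ) ≤ s * ζ.re := mul_le_mul_of_nonneg_left h1 hs
    nlinarith [mul_nonneg (neg_nonneg.2 hneg) (sq_nonneg (‖ζ‖ - s)), mul_nonneg hc.le
      (sq_nonneg (‖ζ‖ - s))]
  rw [sectorConst]
  refine le_of_sq_le_sq ?_ (by positivity)
  rw [mul_pow, Real.sq_sqrt (by positivity)]
  exact h2

theorem sector_add_ne_zero {θ : ℝ} (hθ : θ ∈ Set.Ioo (Real.pi / 2) Real.pi) {ζ : ℂ}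
    (hζ : ζ ∈ sector θ) {s : ℝ} (hs : 0 ≤ s) : ζ + s ≠ 0 := by
  intro h
  have h1 := sector_coercive hθ hζ hs
  rw [h, norm_zero, mul_zero] at h1
  linarith [norm_pos_iff.2 hζ.1]

theorem norm_eq_norm_mul_div {z : ℂ} (hz : z ≠ 0) (b : ℂ) : ‖b‖ = ‖z * b‖ / ‖z‖ := by
  rw [norm_mul, mul_div_cancel_left₀ _ (norm_ne_zero_iff.2 hz)]

namespace IsSectorialKernel

variable {θ θ' : ℝ} {β : ℂ → ℂ} (hβ : IsSectorialKernel θ θ' β)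
include hβ

theorem contourAngles {φ : ℝ} (hφ : φ ∈ Set.Ioo (Real.pi / 2) θ) : ContourAngles φ θ :=
  ⟨hφ.1, hφ.2, hβ.angle.2.le⟩

theorem resolvent_differentiableOn {s : ℝ} (hs : 0 ≤ s) :
    DifferentiableOn ℂ (fun z => β z * (z * β z + s)⁻¹) (sector θ) :=
  hβ.holo.mul (((differentiableOn_id.mul hβ.holo).add_const _).inv
    fun z hz => sector_add_ne_zero hβ.angle' (hβ.mapsTo z hz) hs)

/-- With `ζ = z β(z)` the function is `z⁻¹ · ζ / (ζ + s)`, and coercivity bounds the second factor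
uniformly in `s`. -/
theorem norm_resolvent_le {s : ℝ} (hs : 0 ≤ s) {z : ℂ} (hz : z ∈ sector θ) :
    ‖β z * (z * β z + s)⁻¹‖ ≤ sectorConst θ' / ‖z‖ := by
  have h1 := sector_coercive hβ.angle' (hβ.mapsTo z hz) hs
  have h2 : 0 < ‖z * β z + s‖ := norm_pos_iff.2
    (sector_add_ne_zero hβ.angle' (hβ.mapsTo z hz) hs)
  have h3 : 0 < ‖z‖ := norm_pos_iff.2 hz.1
  rw [norm_mul, norm_inv, norm_eq_norm_mul_div hz.1 (β z), ← div_eq_mul_inv, div_div, mul_comm ‖z‖, ← div_div]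
  gcongr
  rw [div_le_iff₀ h2]
  linarith

end IsSectorialKernel

/-! ### Scalar evolution equations and Volterra equations -/

section EvolutionEquation

open Set Filter Topology

section Volterra

variable {κ : ℝ → ℝ} {a : ℝ}

theorem integrableOn_exp_mul_abs {b : ℝ} (hκ : ∀ z : ℂ, a < z.re →
      IntegrableOn (fun t : ℝ => Complex.exp (-(z * t)) * (κ t : ℂ)) (Ioi 0)) (hb : a < b) :
    IntegrableOn (fun t => Real.exp (-(b * t)) * |κ t|) (Ioi 0) := by
  refine (hκ b hb).norm.congr (Eventually.of_forall fun t => ?_)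
  simp only [norm_mul, Complex.norm_real, Complex.norm_exp]
  simp

theorem integrableOn_of_laplace (hκ : ∀ z : ℂ, a < z.re →
      IntegrableOn (fun t : ℝ => Complex.exp (-(z * t)) * (κ t : ℂ)) (Ioi 0)) (T : ℝ) :
    IntegrableOn (fun t => (κ t : ℂ)) (Ioc 0 T) := by
  have h1 := (hκ ((a + 1 : ℝ) : ℂ) (by simp)).mono_set
    (fun s (hs : s ∈ Ioc 0 T) => hs.1)
  have h2 : IntegrableOn (fun t : ℝ => Complex.exp (-((a + 1 : ℝ) * t)) * (κ t : ℂ)) (Icc 0 T) :=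
    (integrableOn_Icc_iff_integrableOn_Ioc (by simp)).2 h1
  have h3 := (h2.continuousOn_mul (g := fun t : ℝ => Complex.exp ((a + 1 : ℝ) * t))
    (by fun_prop) isCompact_Icc).mono_set Ioc_subset_Icc_self
  refine h3.congr (Eventually.of_forall fun t => ?_)
  simp only
  rw [← mul_assoc, ← Complex.exp_add, add_neg_cancel, Complex.exp_zero, one_mul]

theorem intervalIntegrable_convolution {y : ℝ → ℂ} (hκ : ∀ z : ℂ, a < z.re →
      IntegrableOn (fun t : ℝ => Complex.exp (-(z * t)) * (κ t : ℂ)) (Ioi 0))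
    (hy : ContinuousOn y (Ici 0)) {τ : ℝ} (hτ : 0 ≤ τ) :
    IntervalIntegrable (fun s => (κ (τ - s) : ℂ) * y s) volume 0 τ := by
  have h1 : IntervalIntegrable (fun t => (κ t : ℂ)) volume 0 τ :=
    (intervalIntegrable_iff_integrableOn_Ioc_of_le hτ).2 (integrableOn_of_laplace hκ τ)
  have h2 := (h1.comp_sub_left τ).symm
  rw [sub_zero, sub_self] at h2
  refine h2.mul_continuousOn (hy.mono ?_)
  rw [uIcc_of_le hτ]
  exact Icc_subset_Ici_self

/-- The integrated form of the evolution equation. -/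
theorem volterra_of_hasDerivAt (hκ : ∀ z : ℂ, a < z.re →
      IntegrableOn (fun t : ℝ => Complex.exp (-(z * t)) * (κ t : ℂ)) (Ioi 0)) {y g : ℝ → ℂ}
    (hy : ContinuousOn y (Ici 0)) (hg : ContinuousOn g (Ici 0))
    (heq : ∀ t, 0 < t → ∃ d : ℂ, HasDerivAt y d t ∧
      HasDerivAt (fun τ : ℝ => ∫ s in (0 : ℝ)..τ, (κ (τ - s) : ℂ) * g s) (-d) t)
    {t : ℝ} (ht : 0 < t) :
    y t + ∫ s in (0 : ℝ)..t, (κ (t - s) : ℂ) * g s = y 0 := by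
  set Φ : ℝ → ℂ := fun τ => ∫ s in (0 : ℝ)..τ, (κ (τ - s) : ℂ) * g s with hΦ
  have hF : ∀ s, 0 < s → HasDerivAt (fun τ => y τ + Φ τ) 0 s := by
    intro s hs
    obtain ⟨d, h1, h2⟩ := heq s hs
    have h3 := h1.add h2
    rw [add_neg_cancel] at h3
    exact h3
  have hconst : ∀ s ∈ Ioi (0 : ℝ), y s + Φ s = y t + Φ t := by
    intro s hs
    refine isOpen_Ioi.is_const_of_deriv_eq_zero (𝕜 := ℝ) (convex_Ioi (0 : ℝ)).isPreconnected
      (f := fun τ => y τ + Φ τ)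
      (fun x hx => (hF x hx).differentiableAt.differentiableWithinAt)
      (fun x hx => (hF x hx).deriv) hs ht
  -- `y + Φ` is constant on `(0, ∞)`; the constant is identified at `0⁺`. The kernel may be singular
  -- at `0`, but `‖Φ τ‖` is at most `C ∫₀^τ |κ|`, which tends to zero because `κ` is integrable near
  -- `0`.
  obtain ⟨C, hC⟩ := isCompact_Icc.exists_bound_of_continuousOn
    (hg.mono fun s (hs : s ∈ Icc (0 : ℝ) 1) => hs.1)
  have hint : ∀ τ, IntegrableOn (fun s => |κ s|) (Ioc 0 τ) := fun τ => by
    have h := (integrableOn_of_laplace hκ τ).norm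
    simp only [Complex.norm_real, Real.norm_eq_abs] at h
    exact h
  have hbound : ∀ τ ∈ Ioo (0 : ℝ) 1, ‖Φ τ‖ ≤ C * ∫ s in (0 : ℝ)..τ, |κ s| := by
    intro τ hτ
    have h2 : IntervalIntegrable (fun s => |κ s|) volume 0 τ :=
      (intervalIntegrable_iff_integrableOn_Ioc_of_le hτ.1.le).2 (hint τ)
    have h3 := (h2.comp_sub_left τ).symm
    rw [sub_zero, sub_self] at h3
    have h4 : ∫ s in (0 : ℝ)..τ, |κ s| = ∫ s in (0 : ℝ)..τ, |κ (τ - s)| := by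
      rw [intervalIntegral.integral_comp_sub_left (fun s => |κ s|) τ, sub_self, sub_zero]
    rw [h4, ← intervalIntegral.integral_const_mul]
    refine intervalIntegral.norm_integral_le_of_norm_le hτ.1.le ?_ (h3.const_mul C)
    refine Eventually.of_forall fun s hs => ?_
    rw [norm_mul, Complex.norm_real, Real.norm_eq_abs, mul_comm]
    exact mul_le_mul_of_nonneg_right (hC s ⟨hs.1.le, hs.2.trans hτ.2.le⟩) (abs_nonneg _)
  have hΦ0 : Tendsto Φ (𝓝[>] 0) (𝓝 0) := by
    have h5 : ContinuousOn (fun τ => ∫ s in (0 : ℝ)..τ, |κ s|) (uIcc 0 1) :=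
      intervalIntegral.continuousOn_primitive_interval
        (by rw [uIcc_of_le zero_le_one]; exact (integrableOn_Icc_iff_integrableOn_Ioc (by simp)).2 (hint 1))
    rw [uIcc_of_le zero_le_one] at h5
    have h6 := (h5 0 (by simp)).tendsto
    rw [intervalIntegral.integral_same] at h6
    have h7 := (h6.mono_left (nhdsWithin_mono 0 Ioo_subset_Icc_self)).const_mul C
    rw [mul_zero, nhdsWithin_Ioo_eq_nhdsGT zero_lt_one] at h7
    refine squeeze_zero_norm' ?_ h7
    filter_upwards [Ioo_mem_nhdsGT (zero_lt_one' ℝ)] with τ hτ using hbound τ hτ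
  have hy0 : Tendsto y (𝓝[>] 0) (𝓝 (y 0)) :=
    (hy 0 self_mem_Ici).tendsto.mono_left (nhdsWithin_mono 0 Ioi_subset_Ici_self)
  have h8 := hy0.add hΦ0
  rw [add_zero] at h8
  refine tendsto_nhds_unique (tendsto_const_nhds.congr' ?_) h8
  filter_upwards [self_mem_nhdsWithin] with s hs using (hconst s hs).symm

/-- Dominated convergence as `b → ∞`. In the norm weighted by `e^{-bt}`, convolution with `κ`
becomes as small as desired, which is what the growth bound for Volterra equations requires. -/
theorem exists_exp_rate (hκ : ∀ z : ℂ, a < z.re →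
      IntegrableOn (fun t : ℝ => Complex.exp (-(z * t)) * (κ t : ℂ)) (Ioi 0)) {ε : ℝ}
    (hε : 0 < ε) :
    ∃ b, a < b ∧ 0 ≤ b ∧ ∫ t in Ioi (0 : ℝ), Real.exp (-(b * t)) * |κ t| ≤ ε := by
  have h1 : Tendsto (fun b : ℝ => ∫ t in Ioi (0 : ℝ), Real.exp (-(b * t)) * |κ t|) atTop
      (𝓝 (∫ t in Ioi (0 : ℝ), (0 : ℝ))) := by
    refine tendsto_integral_filter_of_dominated_convergence
      (fun t => Real.exp (-((a + 1) * t)) * |κ t|) ?_ ?_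
      (integrableOn_exp_mul_abs hκ (by linarith)) ?_
    · filter_upwards [eventually_gt_atTop a] with b hb
      exact (integrableOn_exp_mul_abs hκ hb).aestronglyMeasurable
    · filter_upwards [eventually_ge_atTop (a + 1)] with b hb
      refine (ae_restrict_iff' measurableSet_Ioi).2 (Eventually.of_forall fun t ht => ?_)
      have : (0 : ℝ) < t := ht
      rw [Real.norm_of_nonneg (by positivity)]
      gcongr
    · refine (ae_restrict_iff' measurableSet_Ioi).2 (Eventually.of_forall fun t ht => ?_)
      have h2 : Tendsto (fun b : ℝ => -(b * t)) atTop atBot :=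
        tendsto_neg_atTop_atBot.comp (tendsto_id.atTop_mul_const ht)
      simpa using (Real.tendsto_exp_atBot.comp h2).mul_const |κ t|
  rw [integral_zero] at h1
  obtain ⟨b, hb⟩ := ((h1.eventually (gt_mem_nhds hε)).and
    ((eventually_gt_atTop a).and (eventually_ge_atTop 0))).exists
  exact ⟨b, hb.2.1, hb.2.2, hb.1.le⟩

/-- Solutions of Volterra equations grow at most exponentially. -/
theorem norm_le_exp_of_volterra {b l : ℝ} (hκ : ∀ z : ℂ, a < z.re →
      IntegrableOn (fun t : ℝ => Complex.exp (-(z * t)) * (κ t : ℂ)) (Ioi 0))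
    (hb : a < b) (hb0 : 0 ≤ b) (hl : 0 ≤ l)
    (hbl : l * ∫ t in Ioi (0 : ℝ), Real.exp (-(b * t)) * |κ t| ≤ 1 / 2)
    {y : ℝ → ℂ} (hy : ContinuousOn y (Ici 0))
    (hV : ∀ t, 0 < t → y t + ∫ s in (0 : ℝ)..t, (κ (t - s) : ℂ) * (l * y s) = y 0)
    {t : ℝ} (ht : 0 < t) : ‖y t‖ ≤ 2 * ‖y 0‖ * Real.exp (b * t) := by
  set w : ℝ → ℝ := fun s => Real.exp (-(b * s)) * ‖y s‖ with hw
  have hwc : ContinuousOn w (Icc 0 t) :=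
    ContinuousOn.mul (by fun_prop) (hy.mono Icc_subset_Ici_self).norm
  -- At a maximum point `r` of the weighted norm, the equation gives `w r ≤ ‖y 0‖ + w r / 2`, and
  -- the last term is absorbed.
  obtain ⟨r, hr, hmax⟩ := isCompact_Icc.exists_isMaxOn (nonempty_Icc.2 ht.le) hwc
  have hyw : ∀ s, ‖y s‖ = Real.exp (b * s) * w s := fun s => by
    rw [hw, ← mul_assoc, ← Real.exp_add, add_neg_cancel, Real.exp_zero, one_mul]
  have hw0 : 0 ≤ w r := by positivity
  have key : w r ≤ 2 * ‖y 0‖ := by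
    rcases hr.1.eq_or_lt with h0 | h0
    · rw [← h0, hw]
      simp only
      rw [mul_zero, neg_zero, Real.exp_zero, one_mul]
      linarith [norm_nonneg (y 0)]
    · have hi := integrableOn_exp_mul_abs hκ hb
      have h1 : IntervalIntegrable (fun s => Real.exp (-(b * s)) * |κ s|) volume 0 r :=
        (intervalIntegrable_iff_integrableOn_Ioc_of_le hr.1).2 (hi.mono_set Ioc_subset_Ioi_self)
      have h3 := (h1.comp_sub_left r).symm
      rw [sub_zero, sub_self] at h3
      have h4 : ‖∫ s in (0 : ℝ)..r, (κ (r - s) : ℂ) * (l * y s)‖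
          ≤ ∫ s in (0 : ℝ)..r, (Real.exp (b * r) * l * w r) *
            (Real.exp (-(b * (r - s))) * |κ (r - s)|) := by
        refine intervalIntegral.norm_integral_le_of_norm_le hr.1 ?_ (h3.const_mul _)
        refine Eventually.of_forall fun s hs => ?_
        have h5 : w s ≤ w r := hmax ⟨hs.1.le, hs.2.trans hr.2⟩
        have h6 : Real.exp (b * s) = Real.exp (b * r) * Real.exp (-(b * (r - s))) := by
          rw [← Real.exp_add]
          ring_nf
        rw [norm_mul, norm_mul, Complex.norm_real, Complex.norm_real, Real.norm_of_nonneg hl,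
          Real.norm_eq_abs, hyw s, h6]
        calc _ = Real.exp (b * r) * l * w s * (Real.exp (-(b * (r - s))) * |κ (r - s)|) := by ring
          _ ≤ _ := by gcongr
      rw [intervalIntegral.integral_const_mul,
        intervalIntegral.integral_comp_sub_left (fun s => Real.exp (-(b * s)) * |κ s|) r,
        sub_self, sub_zero] at h4
      have h7 : ∫ s in (0 : ℝ)..r, Real.exp (-(b * s)) * |κ s|
          ≤ ∫ s in Ioi (0 : ℝ), Real.exp (-(b * s)) * |κ s| := by
        rw [intervalIntegral.integral_of_le hr.1]
        exact setIntegral_mono_set hi (Eventually.of_forall fun s => by positivity)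
          (Ioc_subset_Ioi_self.eventuallyLE)
      have h8 : ‖y r‖ ≤ ‖y 0‖ + Real.exp (b * r) * w r * (1 / 2) := by
        rw [eq_sub_of_add_eq (hV r h0)]
        refine (norm_sub_le _ _).trans (add_le_add le_rfl (h4.trans ?_))
        calc _ = Real.exp (b * r) * w r * (l * ∫ s in (0 : ℝ)..r, Real.exp (-(b * s)) * |κ s|) := by
              ring
          _ ≤ _ := by
            refine mul_le_mul_of_nonneg_left (le_trans ?_ hbl) (by positivity)
            exact mul_le_mul_of_nonneg_left h7 hl
      have h9 : w r = Real.exp (-(b * r)) * ‖y r‖ := rfl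
      have h10 : Real.exp (-(b * r)) ≤ 1 := Real.exp_le_one_iff.2 (by nlinarith)
      have h11 : Real.exp (-(b * r)) * Real.exp (b * r) = 1 := by
        rw [← Real.exp_add, neg_add_cancel, Real.exp_zero]
      have h12 := mul_le_mul_of_nonneg_left h8 (Real.exp_pos (-(b * r))).le
      have h13 : Real.exp (-(b * r)) * (‖y 0‖ + Real.exp (b * r) * w r * (1 / 2))
          = Real.exp (-(b * r)) * ‖y 0‖ + w r * (1 / 2) := by
        linear_combination (w r / 2) * h11
      nlinarith [norm_nonneg (y 0)]
  rw [hyw t, mul_comm]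
  gcongr
  exact (hmax (right_mem_Icc.2 ht.le)).trans key

/-- The Laplace transform of the solution of a Volterra equation. -/
theorem laplace_of_volterra (hκ : ∀ z : ℂ, a < z.re →
      IntegrableOn (fun t : ℝ => Complex.exp (-(z * t)) * (κ t : ℂ)) (Ioi 0)) {l b K : ℝ}
    (hb : a < b) (hb0 : 0 ≤ b) {y : ℝ → ℂ} (hy : ContinuousOn y (Ici 0))
    (hV : ∀ t, 0 < t → y t + ∫ s in (0 : ℝ)..t, (κ (t - s) : ℂ) * (l * y s) = y 0)
    (hK : ∀ t, 0 < t → ‖y t‖ ≤ K * Real.exp (b * t)) {z : ℂ} (hz : b < z.re) :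
    (∫ t in Ioi (0 : ℝ), Complex.exp (-(z * t)) * y t) *
      (1 + l * ∫ t in Ioi (0 : ℝ), Complex.exp (-(z * t)) * (κ t : ℂ)) = y 0 / z := by
  have hzre : 0 < z.re := hb0.trans_lt hz
  have iy : IntegrableOn (fun t : ℝ => Complex.exp (-(z * t)) * y t) (Ioi 0) := by
    refine Integrable.mono' ((exp_neg_integrableOn_Ioi 0 (sub_pos.2 hz)).const_mul K) ?_ ?_
    · exact ContinuousOn.aestronglyMeasurable
        (ContinuousOn.mul (by fun_prop) (hy.mono Ioi_subset_Ici_self)) measurableSet_Ioi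
    · refine (ae_restrict_iff' measurableSet_Ioi).2 (Eventually.of_forall fun s hs => ?_)
      have e1 : Real.exp (-(z.re - b) * s) = Real.exp (-(z.re * s)) * Real.exp (b * s) := by
        rw [← Real.exp_add]
        ring_nf
      have e2 : ‖Complex.exp (-(z * s))‖ = Real.exp (-(z.re * s)) := by
        rw [Complex.norm_exp]
        simp
      rw [norm_mul, e2, e1, mul_left_comm]
      exact mul_le_mul_of_nonneg_left (hK s hs) (Real.exp_pos _).le
  -- The convolution theorem is applied to `e^{-zt} κ` and `e^{-zt} l y`: their convolution is
  -- `e^{-zx}` times that of `κ` and `l y`, which the Volterra equation replaces by `y 0 - y x`.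
  have h1 := integral_posConvolution (μ := volume) (ν := volume) (hκ z (hb.trans hz))
    (iy.const_mul (l : ℂ)) (ContinuousLinearMap.mul ℝ ℂ)
  simp only [ContinuousLinearMap.mul_apply'] at h1
  have h2 : ∀ x ∈ Ioi (0 : ℝ), ∫ t in (0 : ℝ)..x, Complex.exp (-(z * t)) * (κ t : ℂ) *
      (l * (Complex.exp (-(z * (x - t : ℝ))) * y (x - t)))
      = y 0 * Complex.exp (-z * x) - Complex.exp (-(z * x)) * y x := by
    intro x hx
    have h3 : ∀ t : ℝ, Complex.exp (-(z * t)) * (κ t : ℂ) *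
        (l * (Complex.exp (-(z * (x - t : ℝ))) * y (x - t)))
        = Complex.exp (-(z * x)) * ((κ t : ℂ) * (l * y (x - t))) := by
      intro t
      have : Complex.exp (-(z * x))
          = Complex.exp (-(z * t)) * Complex.exp (-(z * (x - t : ℝ))) := by
        rw [← Complex.exp_add]
        push_cast
        ring_nf
      rw [this]
      ring
    simp only [h3]
    have h4 := intervalIntegral.integral_comp_sub_left
      (fun t => (κ t : ℂ) * (l * y (x - t))) (a := 0) (b := x) x
    simp only [sub_sub_cancel, sub_self, sub_zero] at h4
    rw [intervalIntegral.integral_const_mul, ← h4, eq_sub_of_add_eq' (hV x hx), neg_mul]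
    ring
  have hzneg : (-z).re < 0 := by simpa using hzre
  rw [setIntegral_congr_fun measurableSet_Ioi h2,
    integral_sub ((integrableOn_exp_mul_complex_Ioi hzneg 0).const_mul _) iy,
    integral_const_mul, integral_exp_mul_complex_Ioi hzneg, integral_const_mul,
    Complex.ofReal_zero, mul_zero, Complex.exp_zero, neg_div_neg_eq] at h1
  linear_combination -h1

end Volterra

/-- Solutions of the scalar evolution equation are represented by contour integrals. -/
theorem scalar_solution_eq {θ θ' φ : ℝ} {β : ℂ → ℂ} (hβ : IsSectorialKernel θ θ' β)
    (hφ : φ ∈ Set.Ioo (Real.pi / 2) θ) {κ : ℝ → ℝ} (hκ : HasSymbol κ β) {l : ℝ} (hl : 0 ≤ l)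
    {y : ℝ → ℂ} (hy : ContinuousOn y (Ici 0))
    (heq : ∀ t, 0 < t → ∃ d : ℂ, HasDerivAt y d t ∧
      HasDerivAt (fun τ : ℝ => ∫ s in (0 : ℝ)..τ, (κ (τ - s) : ℂ) * (l * y s)) (-d) t)
    {t : ℝ} (ht : 0 < t) :
    y t = y 0 * ((2 * Real.pi * Complex.I)⁻¹ * contourIntegral φ (1 / t)
      (fun z => Complex.exp (z * t) * (β z * (z * β z + l)⁻¹))) := by
  obtain ⟨a, ha, hLap⟩ := hκ
  have hκi := fun z hz => (hLap z hz).1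
  have hV := fun t ht => volterra_of_hasDerivAt hκi hy (hy.const_smul (l : ℂ)) heq (t := t) ht
  -- This smallness makes `l` times the weighted integral at most `1/2`; `l + 1` rather than `l`
  -- covers `l = 0`.
  obtain ⟨b, hab, hb0, hbl⟩ := exists_exp_rate hκi (ε := 1 / (2 * (l + 1))) (by positivity)
  have hbl' : l * ∫ t in Ioi (0 : ℝ), Real.exp (-(b * t)) * |κ t| ≤ 1 / 2 := by
    refine (mul_le_mul_of_nonneg_left hbl hl).trans ?_
    rw [mul_one_div, div_le_div_iff₀ (by positivity) two_pos]
    linarith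
  have hK := fun t ht => norm_le_exp_of_volterra hκi hab hb0 hl hbl' hy hV (t := t) ht
  have hG := (hβ.resolvent_differentiableOn hl).const_mul (y 0)
  have h1 := eq_inverseLaplace (hβ.contourAngles hφ) hG (M := ‖y 0‖ * sectorConst θ')
    (fun z hz => by
      rw [norm_mul, mul_div_assoc]
      exact mul_le_mul_of_nonneg_left (hβ.norm_resolvent_le hl hz) (norm_nonneg _))
    hb0 (hy.mono Ioi_subset_Ici_self) hK (fun z hz => ?_) ht
  · rw [h1]
    have h2 : ∀ z : ℂ, Complex.exp (z * t) * (y 0 * (β z * (z * β z + l)⁻¹))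
        = y 0 * (Complex.exp (z * t) * (β z * (z * β z + l)⁻¹)) := fun z => by ring
    simp only [h2, contourIntegral_const_mul]
    ring
  · have hzs : z ∈ sector θ := mem_sector_of_re_pos hβ.angle.1 (hb0.trans_lt hz)
    -- Inserting the transform `1/(z β)` of `κ` gives `ŷ (1 + l/(z β)) = y 0 / z`, that is `ŷ = y 0
    -- · β / (z β + l)`.
    have h3 := laplace_of_volterra hκi hab hb0 hy hV hK hz
    rw [(hLap z (hab.trans hz)).2] at h3
    have h4 := sector_add_ne_zero hβ.angle' (hβ.mapsTo z hzs) hl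
    have h5 : z * β z ≠ 0 := (hβ.mapsTo z hzs).1
    have h6 := left_ne_zero_of_mul h5
    have h7 := right_ne_zero_of_mul h5
    field_simp at h3 ⊢
    linear_combination h3

end EvolutionEquation

/-! ### The example kernels -/

section ExampleKernels

open Set

open Filter Topology in
-- Differentiation under the integral. On the ball of radius `Re z₀ / 2` the exponential decays at
-- least at the rate `Re z₀ / 2`, which dominates the derivative.
theorem differentiableOn_laplace_rpow {a : ℝ} (ha : 0 < a) :
    DifferentiableOn ℂ (fun z : ℂ => ∫ t in Ioi (0 : ℝ), (t : ℂ) ^ ((a : ℂ) - 1) *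
      Complex.exp (-(z * t))) {z | 0 < z.re} := by
  intro z₀ hz₀
  have hz₀' : 0 < z₀.re := hz₀
  have hr : 0 < z₀.re / 2 := by linarith
  have hcont : ∀ z : ℂ, ContinuousOn (fun t : ℝ => (t : ℂ) ^ ((a : ℂ) - 1) *
      Complex.exp (-(z * t))) (Ioi 0) := fun z =>
    ContinuousOn.mul (fun t ht => (Complex.continuousAt_ofReal_cpow_const t _
      (Or.inr (ne_of_gt ht))).continuousWithinAt) (by fun_prop)
  have hnorm : ∀ (z : ℂ) (t : ℝ), 0 < t → ‖(t : ℂ) ^ ((a : ℂ) - 1) * Complex.exp (-(z * t))‖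
      = t ^ (a - 1) * Real.exp (-(z.re * t)) := fun z t ht => by
    rw [norm_mul, Complex.norm_cpow_eq_rpow_re_of_pos ht, Complex.norm_exp]
    simp
  refine (hasDerivAt_integral_of_dominated_loc_of_deriv_le
    (μ := volume.restrict (Ioi (0 : ℝ)))
    (F := fun (z : ℂ) (t : ℝ) => (t : ℂ) ^ ((a : ℂ) - 1) * Complex.exp (-(z * t)))
    (F' := fun (z : ℂ) (t : ℝ) => (t : ℂ) ^ ((a : ℂ) - 1) * Complex.exp (-(z * t)) * (-t))
    (x₀ := z₀) (bound := fun t => t ^ a * Real.exp (-(z₀.re / 2) * t))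
    (Metric.ball_mem_nhds z₀ hr) ?_ ?_ ?_ ?_ ?_
    ?_).2.differentiableAt.differentiableWithinAt
  · exact Eventually.of_forall fun z => (hcont z).aestronglyMeasurable measurableSet_Ioi
  · refine Integrable.mono' (g := fun t => t ^ (a - 1) * Real.exp (-z₀.re * t)) ?_
      ((hcont z₀).aestronglyMeasurable measurableSet_Ioi) ?_
    · have h1 := integrableOn_rpow_mul_exp_neg_mul_rpow (s := a - 1) (p := 1) (b := z₀.re)
        (by linarith) one_pos hz₀'
      simp only [Real.rpow_one] at h1
      exact h1
    · refine (ae_restrict_iff' measurableSet_Ioi).2 (Eventually.of_forall fun t ht => ?_)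
      rw [hnorm z₀ t ht, neg_mul]
  · exact ((hcont z₀).mul (by fun_prop)).aestronglyMeasurable measurableSet_Ioi
  · refine (ae_restrict_iff' measurableSet_Ioi).2 (Eventually.of_forall fun t ht z hz => ?_)
    have ht0 : (0 : ℝ) < t := ht
    have h1 : z₀.re / 2 ≤ z.re := by
      have h2 := (Complex.abs_re_le_norm (z - z₀)).trans (mem_ball_iff_norm.1 hz).le
      rw [Complex.sub_re] at h2
      linarith [(abs_le.1 h2).1]
    rw [norm_mul, hnorm z t ht, norm_neg, Complex.norm_real, Real.norm_of_nonneg ht0.le]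
    have h3 : t ^ a = t ^ (a - 1) * t := by
      rw [← Real.rpow_add_one ht0.ne', sub_add_cancel]
    rw [h3, mul_right_comm]
    gcongr
    rw [← neg_mul]
    gcongr
  · have h1 := integrableOn_rpow_mul_exp_neg_mul_rpow (s := a) (p := 1) (b := z₀.re / 2)
      (by linarith) one_pos hr
    simp only [Real.rpow_one] at h1
    exact h1
  · refine Eventually.of_forall fun t z _ => ?_
    have h1 : HasDerivAt (fun z : ℂ => -(z * (t : ℂ))) (-(t : ℂ)) z := by
      have h2 := ((hasDerivAt_id z).mul_const (t : ℂ)).neg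
      rw [one_mul] at h2
      exact h2
    have h2 := h1.cexp.const_mul ((t : ℂ) ^ ((a : ℂ) - 1))
    simpa [mul_assoc] using h2

open Filter Topology in
-- For real `z > 0` this is the Gamma integral. Both sides are holomorphic in the right half plane
-- and agree at the real points above `1`, which accumulate at `1`, so the identity theorem applies.
theorem laplace_rpow {a : ℝ} (ha : 0 < a) {z : ℂ} (hz : 0 < z.re) :
    ∫ t in Ioi (0 : ℝ), (t : ℂ) ^ ((a : ℂ) - 1) * Complex.exp (-(z * t))
      = (1 / z) ^ (a : ℂ) * Complex.Gamma a := by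
  have hopen : IsOpen {z : ℂ | 0 < z.re} := isOpen_lt continuous_const Complex.continuous_re
  have hd : DifferentiableOn ℂ (fun z : ℂ => (1 / z) ^ (a : ℂ) * Complex.Gamma a)
      {z | 0 < z.re} := by
    intro w hw
    have hw' : 0 < w.re := hw
    have hw0 : w ≠ 0 := fun h => by simp [h] at hw'
    have h1 : 1 / w ∈ Complex.slitPlane := by
      refine Or.inl ?_
      rw [one_div, Complex.inv_re]
      exact div_pos hw' (Complex.normSq_pos.2 hw0)
    exact (((((differentiableAt_const 1).div differentiableAt_id hw0).cpow_const h1).mul_const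
      _)).differentiableWithinAt
  have hconv : IsPreconnected {z : ℂ | 0 < z.re} := (convex_halfSpace_re_gt 0).isPreconnected
  refine ((differentiableOn_laplace_rpow ha).analyticOnNhd
    hopen).eqOn_of_preconnected_of_frequently_eq (hd.analyticOnNhd hopen) hconv
    (z₀ := 1) (by simp) ?_ hz
  have h2 : Tendsto (fun r : ℝ => (r : ℂ)) (𝓝[>] 1) (𝓝[≠] 1) := by
    refine tendsto_nhdsWithin_iff.2 ⟨?_, ?_⟩
    · exact (Complex.continuous_ofReal.tendsto' 1 1 (by simp)).mono_left nhdsWithin_le_nhds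
    · filter_upwards [self_mem_nhdsWithin] with r hr h
      have : r = 1 := by simpa using h
      exact (ne_of_gt hr) this
  refine h2.frequently (Eventually.frequently ?_)
  filter_upwards [self_mem_nhdsWithin] with r hr
  exact Complex.integral_cpow_mul_exp_neg_mul_Ioi (a := (a : ℂ)) (by simpa)
    (zero_lt_one.trans hr)

theorem laplace_omega {a : ℝ} (ha : 0 < a) {z : ℂ} (hz : 0 < z.re) :
    IntegrableOn (fun t : ℝ => Complex.exp (-(z * t)) * (omega a t : ℂ)) (Ioi 0) ∧
    ∫ t in Ioi (0 : ℝ), Complex.exp (-(z * t)) * (omega a t : ℂ) = (z ^ (a : ℂ))⁻¹ := by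
  have hz0 : z ≠ 0 := fun h => by simp [h] at hz
  have harg : z.arg ≠ Real.pi := by
    have := Complex.abs_arg_lt_pi_div_two_iff.2 (Or.inl hz)
    intro h
    rw [h, abs_of_pos Real.pi_pos] at this
    linarith [Real.pi_pos]
  have hΓ : (Real.Gamma a : ℂ) ≠ 0 := by exact_mod_cast (Real.Gamma_pos_of_pos ha).ne'
  have h1 := laplace_rpow ha hz
  have h2 : ∫ t in Ioi (0 : ℝ), Complex.exp (-(z * t)) * (omega a t : ℂ) = (z ^ (a : ℂ))⁻¹ := by
    have h3 : ∀ t ∈ Ioi (0 : ℝ), Complex.exp (-(z * t)) * (omega a t : ℂ)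
        = ((t : ℂ) ^ ((a : ℂ) - 1) * Complex.exp (-z * t)) * (Real.Gamma a : ℂ)⁻¹ := by
      intro t ht
      rw [omega, Complex.ofReal_div, Complex.ofReal_cpow (le_of_lt ht), neg_mul]
      push_cast
      ring
    simp only [neg_mul] at h3
    rw [setIntegral_congr_fun measurableSet_Ioi h3, integral_mul_const, h1, one_div,
      Complex.inv_cpow _ _ harg, Complex.Gamma_ofReal, mul_inv_cancel_right₀ hΓ]
  refine ⟨?_, h2⟩
  -- A nonintegrable function has integral `0` by convention, whereas the value found is nonzero; so
  -- the formula itself implies integrability.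
  by_contra h3
  rw [integral_undef h3] at h2
  exact inv_ne_zero ((Complex.cpow_ne_zero_iff).2 (Or.inl hz0)) h2.symm

theorem laplace_one {z : ℂ} (hz : 0 < z.re) :
    IntegrableOn (fun t : ℝ => Complex.exp (-(z * t))) (Ioi 0) ∧
    ∫ t in Ioi (0 : ℝ), Complex.exp (-(z * t)) = z⁻¹ := by
  have h1 : (-z).re < 0 := by simpa using hz
  have h2 := integrableOn_exp_mul_complex_Ioi h1 0
  have h3 := integral_exp_mul_complex_Ioi h1 0
  simp only [neg_mul] at h2 h3
  refine ⟨h2, h3.trans ?_⟩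
  simp

theorem laplace_one_add {a c : ℝ} (ha : 0 < a) {z : ℂ} (hz : 0 < z.re) :
    IntegrableOn (fun t : ℝ => Complex.exp (-(z * t)) * ((1 + c * omega a t : ℝ) : ℂ)) (Ioi 0) ∧
    ∫ t in Ioi (0 : ℝ), Complex.exp (-(z * t)) * ((1 + c * omega a t : ℝ) : ℂ)
      = z⁻¹ + c * (z ^ (a : ℂ))⁻¹ := by
  obtain ⟨h1, h2⟩ := laplace_omega ha hz
  obtain ⟨h3, h4⟩ := laplace_one hz
  have h5 : ∀ t : ℝ, Complex.exp (-(z * t)) * ((1 + c * omega a t : ℝ) : ℂ)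
      = Complex.exp (-(z * t)) + c * (Complex.exp (-(z * t)) * (omega a t : ℂ)) := by
    intro t
    push_cast
    ring
  simp only [h5]
  refine ⟨h3.add (h1.const_mul _), ?_⟩
  rw [integral_add h3 (h1.const_mul _), integral_const_mul, h2, h4]

theorem re_pos_ne_zero {z : ℂ} (hz : 0 < z.re) : z ≠ 0 := fun h => by simp [h] at hz

/-- The bound on `α θ` keeps `α arg z` strictly inside `(-π/2, π/2)`, so the argument is multiplied
by `α` without wrapping around. -/
theorem re_cpow_pos {α θ : ℝ} (hα : 0 < α) (hαθ : α * θ ≤ Real.pi / 2) {z : ℂ}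
    (hz : z ∈ sector θ) : 0 < (z ^ (α : ℂ)).re ∧ (z ^ (α : ℂ)).arg = α * z.arg := by
  have h1 := abs_lt.1 hz.2
  have h2 : |z.arg * α| < Real.pi / 2 := by
    rw [abs_mul, abs_of_pos hα, mul_comm]
    exact (mul_lt_mul_of_pos_left hz.2 hα).trans_le hαθ
  have h3 : 0 < ‖z‖ ^ α := Real.rpow_pos_of_pos (norm_pos_iff.2 hz.1) _
  have h4 := abs_lt.1 h2
  have harg : (z ^ (α : ℂ)).arg = α * z.arg := by
    rw [Complex.cpow_ofReal, Complex.ofReal_cos, Complex.ofReal_sin, mul_comm α]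
    exact Complex.arg_mul_cos_add_sin_mul_I h3 (θ := z.arg * α)
      ⟨by linarith [Real.pi_pos], by linarith [Real.pi_pos]⟩
  refine ⟨?_, harg⟩
  rw [mul_comm, ← harg] at h2
  rcases Complex.abs_arg_lt_pi_div_two_iff.1 h2 with h5 | h5
  · exact h5
  · exact absurd h5 (Complex.cpow_ne_zero_iff.2 (Or.inl hz.1))

/-- Adding `1` turns a number with positive real part towards the positive axis: the imaginary part
stays, the modulus does not decrease, and in the right half plane the argument is the arcsine of
their quotient. -/
theorem arg_one_add {w : ℂ} (hw : 0 < w.re) :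
    (0 ≤ w.arg → 0 ≤ (1 + w).arg ∧ (1 + w).arg ≤ w.arg) ∧
    (w.arg ≤ 0 → (1 + w).arg ≤ 0 ∧ w.arg ≤ (1 + w).arg) := by
  have h1 : 0 < (1 + w).re := by
    rw [Complex.add_re, Complex.one_re]
    linarith
  have him : (1 + w).im = w.im := by simp
  have hw0 : 0 < ‖w‖ := norm_pos_iff.2 (re_pos_ne_zero hw)
  have hn : ‖w‖ ≤ ‖1 + w‖ := by
    refine le_of_sq_le_sq ?_ (norm_nonneg _)
    rw [Complex.sq_norm, Complex.sq_norm, Complex.normSq_apply, Complex.normSq_apply, him,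
      Complex.add_re, Complex.one_re]
    nlinarith
  constructor
  · intro h
    have h2 : 0 ≤ w.im := Complex.arg_nonneg_iff.1 h
    refine ⟨Complex.arg_nonneg_iff.2 (by rwa [him]), ?_⟩
    rw [Complex.arg_of_re_nonneg h1.le, Complex.arg_of_re_nonneg hw.le, him]
    exact Real.monotone_arcsin (div_le_div_of_nonneg_left h2 hw0 hn)
  · intro h
    have h2 : w.im ≤ 0 := by
      rcases h.lt_or_eq with h3 | h3
      · exact (Complex.arg_neg_iff.1 h3).le
      · rw [Complex.arg_eq_zero_iff] at h3
        exact h3.2.le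
    rw [Complex.arg_of_re_nonneg h1.le, Complex.arg_of_re_nonneg hw.le, him]
    refine ⟨Real.arcsin_nonpos.2 (div_nonpos_of_nonpos_of_nonneg h2 (norm_nonneg _)), ?_⟩
    refine Real.monotone_arcsin ?_
    rw [← neg_le_neg_iff, ← neg_div, ← neg_div]
    exact div_le_div_of_nonneg_left (neg_nonneg.2 h2) hw0 hn

theorem arg_inv_one_add {w : ℂ} (hw : 0 < w.re) : (1 + w)⁻¹.arg = -(1 + w).arg := by
  have h1 : 0 < (1 + w).re := by
    rw [Complex.add_re, Complex.one_re]
    linarith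
  have h2 := Complex.abs_arg_lt_pi_div_two_iff.2 (Or.inl h1)
  rw [Complex.arg_inv, if_neg]
  intro h
  rw [h, abs_of_pos Real.pi_pos] at h2
  linarith [Real.pi_pos]

theorem mul_mem_sector {x y : ℂ} {θ : ℝ} (hθ : θ ≤ Real.pi) (hx : x ≠ 0) (hy : y ≠ 0)
    (h : |x.arg + y.arg| < θ) : x * y ∈ sector θ ∧ (x * y).arg = x.arg + y.arg := by
  have h1 := abs_lt.1 (h.trans_le hθ)
  have h2 := (Complex.arg_mul_eq_add_arg_iff hx hy).2 ⟨h1.1, h1.2.le⟩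
  exact ⟨⟨mul_ne_zero hx hy, by rwa [h2]⟩, h2⟩

theorem one_le_norm_one_add {w : ℂ} (hw : 0 < w.re) : 1 ≤ ‖1 + w‖ ∧ ‖w‖ ≤ ‖1 + w‖ := by
  constructor
  · refine le_trans ?_ (Complex.re_le_norm _)
    rw [Complex.add_re, Complex.one_re]
    linarith
  · refine le_of_sq_le_sq ?_ (norm_nonneg _)
    rw [Complex.sq_norm, Complex.sq_norm, Complex.normSq_apply, Complex.normSq_apply]
    simp only [Complex.add_re, Complex.one_re, Complex.add_im, Complex.one_im]
    nlinarith

theorem one_add_ne_zero_of_re_pos {w : ℂ} (hw : 0 < w.re) : 1 + w ≠ 0 :=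
  norm_pos_iff.1 (zero_lt_one.trans_le (one_le_norm_one_add hw).1)

theorem cpow_differentiableOn_sector {α θ : ℝ} (hθ : θ ≤ Real.pi) :
    DifferentiableOn ℂ (fun z : ℂ => z ^ (α : ℂ)) (sector θ) := by
  intro z hz
  refine (DifferentiableAt.cpow_const differentiableAt_id ?_).differentiableWithinAt
  rw [id, Complex.mem_slitPlane_iff_arg]
  refine ⟨fun h => ?_, hz.1⟩
  have := hz.2
  rw [h, abs_of_pos Real.pi_pos] at this
  linarith

/-- An angle for which all example kernels are sectorial. -/
theorem exists_example_angle {α : ℝ} (hα : 0 < α) (hα1 : α < 1) :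
    ∃ θ ∈ Ioo (Real.pi / 2) Real.pi, (1 + α) * θ ∈ Ioo (Real.pi / 2) Real.pi ∧
      α * θ ≤ Real.pi / 2 := by
  have hpi := Real.pi_pos
  -- Any angle between `π/2` and `π/(1 + α)` works: `(1 + α) θ < π`, and subtracting `θ > π/2`
  -- leaves `α θ < π/2`.
  obtain ⟨θ, h1, h2⟩ := exists_between (show Real.pi / 2 < Real.pi / (1 + α) by
    rw [div_lt_div_iff₀ two_pos (by linarith)]
    nlinarith)
  rw [lt_div_iff₀ (by linarith)] at h2
  have h3 : 0 < α * θ := mul_pos hα (by linarith)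
  exact ⟨θ, ⟨h1, by nlinarith⟩, ⟨by nlinarith, by nlinarith⟩, by nlinarith⟩

theorem hasSymbol_diffusionWave {α : ℝ} (hα : 0 < α) :
    HasSymbol (fun t => omega (1 + α) t) (fun z => z ^ (α : ℂ)) := by
  refine ⟨1, one_pos, fun z hz => ?_⟩
  have hz0 : 0 < z.re := one_pos.trans hz
  have h1 := laplace_omega (a := 1 + α) (by linarith) hz0
  refine ⟨h1.1, h1.2.trans ?_⟩
  push_cast
  rw [Complex.cpow_add _ _ (re_pos_ne_zero hz0), Complex.cpow_one]

theorem isSectorialKernel_diffusionWave {α θ : ℝ} (hα : 0 < α)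
    (hθ : θ ∈ Ioo (Real.pi / 2) Real.pi) (hθ' : (1 + α) * θ ∈ Ioo (Real.pi / 2) Real.pi)
    (hαθ : α * θ ≤ Real.pi / 2) :
    IsSectorialKernel θ ((1 + α) * θ) (fun z => z ^ (α : ℂ)) := by
  refine ⟨hθ, hθ', cpow_differentiableOn_sector hθ.2.le, fun z hz => ?_⟩
  obtain ⟨h1, h2⟩ := re_cpow_pos hα hαθ hz
  refine (mul_mem_sector hθ'.2.le hz.1 (re_pos_ne_zero h1) ?_).1
  have h4 : 0 < 1 + α := by linarith
  rw [h2, show z.arg + α * z.arg = (1 + α) * z.arg by ring, abs_mul, abs_of_pos h4]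
  exact mul_lt_mul_of_pos_left hz.2 h4

theorem hasPowerBound_diffusionWave (α θ : ℝ) : HasPowerBound θ (fun z => z ^ (α : ℂ)) 1 α := by
  intro z _
  rw [one_mul, Complex.norm_cpow_real]

theorem hasSymbol_singularKernel {α : ℝ} (hα : 0 < α) :
    HasSymbol (fun t => 1 + omega (1 + α) t) (fun z => z ^ (α : ℂ) / (1 + z ^ (α : ℂ))) := by
  refine ⟨1, one_pos, fun z hz => ?_⟩
  have hz0 : 0 < z.re := one_pos.trans hz
  have hne := re_pos_ne_zero hz0
  have hne' : z ^ (α : ℂ) ≠ 0 := Complex.cpow_ne_zero_iff.2 (Or.inl hne)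
  have h1 := laplace_one_add (a := 1 + α) (c := 1) (by linarith) hz0
  simp only [one_mul] at h1
  refine ⟨h1.1, h1.2.trans ?_⟩
  push_cast
  rw [Complex.cpow_add _ _ hne, Complex.cpow_one]
  field_simp
  ring

/-- By `arg_one_add`, the argument of `z^α / (1 + z^α)` lies between `0` and `α arg z`.
Multiplication by `z` therefore gives an argument of modulus at most `(1 + α) |arg z|`, as for the
pure power. -/
theorem isSectorialKernel_singularKernel {α θ : ℝ} (hα : 0 < α)
    (hθ : θ ∈ Ioo (Real.pi / 2) Real.pi) (hθ' : (1 + α) * θ ∈ Ioo (Real.pi / 2) Real.pi)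
    (hαθ : α * θ ≤ Real.pi / 2) :
    IsSectorialKernel θ ((1 + α) * θ) (fun z => z ^ (α : ℂ) / (1 + z ^ (α : ℂ))) := by
  have hd := cpow_differentiableOn_sector (α := α) hθ.2.le
  refine ⟨hθ, hθ', hd.div (hd.const_add 1) fun z hz =>
    one_add_ne_zero_of_re_pos (re_cpow_pos hα hαθ hz).1, fun z hz => ?_⟩
  obtain ⟨h1, h2⟩ := re_cpow_pos hα hαθ hz
  set w := z ^ (α : ℂ) with hw
  have h3 := arg_inv_one_add h1
  have h5 : |z.arg| * (1 + α) < (1 + α) * θ := by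
    rw [mul_comm]
    exact mul_lt_mul_of_pos_left hz.2 (by linarith)
  have hkey : |w.arg + (1 + w)⁻¹.arg| ≤ α * |z.arg| ∧
      |z.arg + (w.arg + (1 + w)⁻¹.arg)| ≤ |z.arg| * (1 + α) := by
    rw [h3]
    rcases le_total 0 z.arg with h | h
    · have h6 := (arg_one_add h1).1 (by rw [h2]; positivity)
      rw [abs_of_nonneg h, abs_le, abs_le]
      have := mul_nonneg hα.le h
      exact ⟨⟨by linarith, by linarith⟩, by linarith, by linarith⟩
    · have h6 := (arg_one_add h1).2 (by rw [h2]; exact mul_nonpos_of_nonneg_of_nonpos hα.le h)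
      rw [abs_of_nonpos h, abs_le, abs_le]
      have := mul_nonpos_of_nonneg_of_nonpos hα.le h
      exact ⟨⟨by linarith, by linarith⟩, by linarith, by linarith⟩
  have h7 : α * |z.arg| < Real.pi := by
    have := mul_lt_mul_of_pos_left hz.2 hα
    linarith [Real.pi_pos]
  have h8 := mul_mem_sector le_rfl (re_pos_ne_zero h1)
    (inv_ne_zero (one_add_ne_zero_of_re_pos h1)) (hkey.1.trans_lt h7)
  have h9 := mul_mem_sector (x := z) hθ'.2.le hz.1 h8.1.1
    (by rw [h8.2]; exact hkey.2.trans_lt h5)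
  rw [div_eq_mul_inv]
  exact h9.1

theorem hasPowerBound_singularKernel {α θ : ℝ} (hα : 0 < α) (hαθ : α * θ ≤ Real.pi / 2) :
    HasPowerBound θ (fun z => z ^ (α : ℂ) / (1 + z ^ (α : ℂ))) 1 α := by
  intro z hz
  have h1 := (one_le_norm_one_add (re_cpow_pos hα hαθ hz).1).1
  rw [one_mul, norm_div, Complex.norm_cpow_real]
  exact div_le_self (by positivity) h1

theorem hasSymbol_rayleighStokes {α : ℝ} (hα1 : α < 1) (γ : ℝ) :
    HasSymbol (fun t => 1 + γ * omega (1 - α) t)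
      (fun z => 1 / (1 + (γ : ℂ) * z ^ (α : ℂ))) := by
  refine ⟨1, one_pos, fun z hz => ?_⟩
  have hz0 : 0 < z.re := one_pos.trans hz
  have hne := re_pos_ne_zero hz0
  have hne' : z ^ (α : ℂ) ≠ 0 := Complex.cpow_ne_zero_iff.2 (Or.inl hne)
  have h1 := laplace_one_add (a := 1 - α) (c := γ) (by linarith) hz0
  refine ⟨h1.1, h1.2.trans ?_⟩
  push_cast
  rw [Complex.cpow_sub _ _ hne, Complex.cpow_one, mul_one_div, inv_div, inv_div]
  field_simp

/-- The argument of `1 / (1 + γ z^α)` is opposite in sign to that of `z`, or zero, and is no larger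
in modulus. Multiplication by it can only reduce `|arg z|`, so the same angle serves for both
sectors. -/
theorem isSectorialKernel_rayleighStokes {α θ γ : ℝ} (hα : 0 < α) (hα1 : α < 1) (hγ : 0 < γ)
    (hθ : θ ∈ Ioo (Real.pi / 2) Real.pi) (hαθ : α * θ ≤ Real.pi / 2) :
    IsSectorialKernel θ θ (fun z => 1 / (1 + (γ : ℂ) * z ^ (α : ℂ))) := by
  have hd := cpow_differentiableOn_sector (α := α) hθ.2.le
  have hpos : ∀ z ∈ sector θ, 0 < ((γ : ℂ) * z ^ (α : ℂ)).re := fun z hz => by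
    rw [Complex.re_ofReal_mul]
    exact mul_pos hγ (re_cpow_pos hα hαθ hz).1
  refine ⟨hθ, hθ, (differentiableOn_const 1).div ((hd.const_mul _).const_add 1) fun z hz =>
    one_add_ne_zero_of_re_pos (hpos z hz), fun z hz => ?_⟩
  have h1 := hpos z hz
  have h2 : ((γ : ℂ) * z ^ (α : ℂ)).arg = α * z.arg := by
    rw [Complex.arg_real_mul _ hγ, (re_cpow_pos hα hαθ hz).2]
  set w := (γ : ℂ) * z ^ (α : ℂ) with hw
  rw [one_div]
  refine (mul_mem_sector hθ.2.le hz.1 (inv_ne_zero (one_add_ne_zero_of_re_pos h1)) ?_).1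
  refine lt_of_le_of_lt ?_ hz.2
  rw [arg_inv_one_add h1]
  rcases le_total 0 z.arg with h | h
  · have h6 := (arg_one_add h1).1 (by rw [h2]; positivity)
    rw [abs_of_nonneg h, abs_le]
    have h7 : α * z.arg ≤ z.arg := mul_le_of_le_one_left h hα1.le
    exact ⟨by linarith, by linarith⟩
  · have h6 := (arg_one_add h1).2 (by rw [h2]; exact mul_nonpos_of_nonneg_of_nonpos hα.le h)
    rw [abs_of_nonpos h, abs_le]
    have h7 : z.arg ≤ α * z.arg := by nlinarith
    exact ⟨by linarith, by linarith⟩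

/-- Since `γ z^α` has positive real part, adding `1` does not reduce its modulus. -/
theorem hasPowerBound_rayleighStokes {α θ γ : ℝ} (hα : 0 < α) (hγ : 0 < γ)
    (hαθ : α * θ ≤ Real.pi / 2) :
    HasPowerBound θ (fun z => 1 / (1 + (γ : ℂ) * z ^ (α : ℂ))) γ⁻¹ (-α) := by
  intro z hz
  have hpos : 0 < ((γ : ℂ) * z ^ (α : ℂ)).re := by
    rw [Complex.re_ofReal_mul]
    exact mul_pos hγ (re_cpow_pos hα hαθ hz).1
  have h1 := (one_le_norm_one_add hpos).2
  have hz0 : 0 < ‖z‖ := norm_pos_iff.2 hz.1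
  rw [norm_mul, Complex.norm_real, Real.norm_of_nonneg hγ.le, Complex.norm_cpow_real] at h1
  rw [norm_div, norm_one, Real.rpow_neg hz0.le, ← mul_inv, one_div]
  gcongr

end ExampleKernels

/-! ### Inner products, eigenbases and form operators on a vector space -/

/-- Inner products on a complex vector space, linear in the first argument. -/
structure IsInnerForm {V : Type*} [AddCommGroup V] [Module ℂ V] (m : V → V → ℂ) : Prop where
  add_left : ∀ x y z, m (x + y) z = m x z + m y z
  smul_left : ∀ (c : ℂ) x y, m (c • x) y = c * m x y
  symm : ∀ x y, star (m y x) = m x y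
  pos : ∀ x, x ≠ 0 → 0 < (m x x).re

/-- The norm of an inner product. -/
noncomputable def formNorm {V : Type*} (m : V → V → ℂ) (x : V) : ℝ := Real.sqrt (m x x).re

namespace IsInnerForm

variable {V : Type*} [AddCommGroup V] [Module ℂ V] {m : V → V → ℂ} (hm : IsInnerForm m)
include hm

theorem zero_left (x : V) : m 0 x = 0 := by
  have := hm.smul_left 0 0 x
  rwa [zero_smul, zero_mul] at this

theorem re_self_nonneg (x : V) : 0 ≤ (m x x).re := by
  by_cases hx : x = 0
  · rw [hx, hm.zero_left, Complex.zero_re]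
  · exact (hm.pos x hx).le

theorem add_right (x y z : V) : m x (y + z) = m x y + m x z := by
  rw [← hm.symm x (y + z), hm.add_left, star_add, hm.symm, hm.symm]

theorem smul_right (c : ℂ) (x y : V) : m x (c • y) = star c * m x y := by
  rw [← hm.symm x (c • y), hm.smul_left, star_mul', hm.symm]

theorem neg_left (x y : V) : m (-x) y = -m x y := by
  rw [← neg_one_smul ℂ, hm.smul_left, neg_one_mul]

theorem sub_left (x y z : V) : m (x - y) z = m x z - m y z := by
  rw [sub_eq_add_neg, hm.add_left, hm.neg_left, sub_eq_add_neg]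

theorem self_eq (x : V) : m x x = ((formNorm m x ^ 2 : ℝ) : ℂ) := by
  rw [formNorm, Real.sq_sqrt (hm.re_self_nonneg x)]
  exact (Complex.conj_eq_iff_re.1 (hm.symm x x)).symm

theorem formNorm_pos {x : V} (hx : x ≠ 0) : 0 < formNorm m x := Real.sqrt_pos.2 (hm.pos x hx)

theorem ext_left {x y : V} (h : ∀ z, m x z = m y z) : x = y := by
  by_contra hne
  have h1 := hm.pos _ (sub_ne_zero.2 hne)
  rw [hm.sub_left, h, sub_self, Complex.zero_re] at h1
  exact lt_irrefl _ h1

theorem formNorm_smul (c : ℂ) (x : V) : formNorm m (c • x) = ‖c‖ * formNorm m x := by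
  have h1 : (m (c • x) (c • x)).re = ‖c‖ ^ 2 * (m x x).re := by
    rw [hm.smul_left, hm.smul_right, ← mul_assoc, Complex.star_def, Complex.mul_conj,
      Complex.re_ofReal_mul, Complex.normSq_eq_norm_sq]
  rw [formNorm, h1, Real.sqrt_mul (by positivity), Real.sqrt_sq (norm_nonneg _), formNorm]

/-- The same inner product in the convention of Mathlib. -/
@[reducible]
noncomputable def core : InnerProductSpace.Core ℂ V where
  inner x y := m y x
  conj_inner_symm x y := hm.symm y x
  re_inner_nonneg x := hm.re_self_nonneg x
  add_left x y z := hm.add_right z x y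
  smul_left x y c := hm.smul_right c y x
  definite x h := by
    by_contra hx
    have := hm.pos x hx
    have h' : m x x = 0 := h
    rw [h', Complex.zero_re] at this
    exact lt_irrefl _ this

theorem norm_le (x y : V) : ‖m x y‖ ≤ formNorm m x * formNorm m y := by
  let _ := hm.core
  have h := InnerProductSpace.Core.norm_inner_le_norm (𝕜 := ℂ) y x
  rw [mul_comm]
  exact h

theorem formNorm_sub_le (x y : V) : formNorm m (x - y) ≤ formNorm m x + formNorm m y := by
  let _ := hm.core.toNormedAddCommGroup
  exact norm_sub_le x y

/-- The spectral theorem for the norm that `m` induces. Several inner products live on the same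
space, so that structure is introduced only locally. -/
theorem exists_orthonormal_eigenbasis [FiniteDimensional ℂ V] {B : Module.End ℂ V}
    (hB : ∀ x y, m (B x) y = m x (B y)) :
    ∃ (b : Module.Basis (Fin (Module.finrank ℂ V)) ℂ V) (l : Fin (Module.finrank ℂ V) → ℝ),
      (∀ i j, m (b i) (b j) = if i = j then 1 else 0) ∧ ∀ i, B (b i) = (l i : ℂ) • b i := by
  let _ := hm.core.toNormedAddCommGroup
  let _ : InnerProductSpace ℂ V := InnerProductSpace.ofCore hm.core.toCore
  have hS : B.IsSymmetric := fun x y => (hB y x).symm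
  refine ⟨(hS.eigenvectorBasis rfl).toBasis, hS.eigenvalues rfl, fun i j => ?_, fun i => ?_⟩
  · have h := orthonormal_iff_ite.1 (hS.eigenvectorBasis rfl).orthonormal j i
    rw [OrthonormalBasis.coe_toBasis]
    refine Eq.trans h ?_
    simp only [eq_comm]
  · rw [OrthonormalBasis.coe_toBasis]
    exact hS.apply_eigenvectorBasis rfl i

/-- Forms are represented by operators. -/
theorem exists_operator [FiniteDimensional ℂ V] {a : V → V → ℂ}
    (a_add : ∀ x y z, a (x + y) z = a x z + a y z) (a_smul : ∀ (c : ℂ) x y, a (c • x) y = c * a x y)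
    (a_add' : ∀ x y z, a x (y + z) = a x y + a x z)
    (a_smul' : ∀ (c : ℂ) x y, a x (c • y) = star c * a x y) :
    ∃ B : Module.End ℂ V, ∀ x y, m (B x) y = a x y := by
  -- Only an orthonormal basis is wanted, so the zero operator suffices.
  obtain ⟨b, -, hb, -⟩ := hm.exists_orthonormal_eigenbasis (B := 0)
    (fun x y => by rw [LinearMap.zero_apply, LinearMap.zero_apply, ← hm.symm x 0, hm.zero_left,
      hm.zero_left, star_zero])
  let B : Module.End ℂ V :=
    { toFun := fun x => ∑ i, a x (b i) • b i
      map_add' := fun x y => by simp only [a_add, add_smul, Finset.sum_add_distrib]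
      map_smul' := fun c x => by
        simp only [a_smul, mul_smul, Finset.smul_sum, RingHom.id_apply] }
  refine ⟨B, fun x y => ?_⟩
  -- Both sides are conjugate linear in `y`.
  have hl : ∀ j, m (B x) (b j) = a x (b j) := by
    intro j
    let f : V →ₗ[ℂ] ℂ :=
      { toFun := fun z => m z (b j)
        map_add' := fun z w => hm.add_left z w _
        map_smul' := fun c z => hm.smul_left c z _ }
    change f (∑ i, a x (b i) • b i) = _
    rw [map_sum]
    simp only [map_smul, smul_eq_mul]
    change ∑ i, a x (b i) * m (b i) (b j) = _
    simp [hb]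
  let F : V →ₗ[ℂ] ℂ :=
    { toFun := fun z => star (m (B x) z)
      map_add' := fun z w => by rw [hm.add_right, star_add]
      map_smul' := fun c z => by
        rw [hm.smul_right, star_mul', star_star, RingHom.id_apply, smul_eq_mul] }
  let G : V →ₗ[ℂ] ℂ :=
    { toFun := fun z => star (a x z)
      map_add' := fun z w => by rw [a_add', star_add]
      map_smul' := fun c z => by rw [a_smul', star_mul', star_star, RingHom.id_apply, smul_eq_mul] }
  have hFG : F = G := b.ext fun j => congrArg star (hl j)
  exact star_injective (LinearMap.congr_fun hFG y)

end IsInnerForm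

/-! ### Resolvent estimates for form operators -/

theorem one_le_sectorConst {θ : ℝ} (hθ : θ ∈ Set.Ioo (Real.pi / 2) Real.pi) :
    1 ≤ sectorConst θ := by
  rw [sectorConst, Real.one_le_sqrt, one_le_div (one_add_cos_pos hθ)]
  linarith [Real.cos_le_one θ]

/-- For `p > 0` the product `ζ p` is again in the sector. At `p = 0` it leaves the sector, and the
bound holds because the constant is at least `1`. -/
theorem sector_coercive_mul {θ : ℝ} (hθ : θ ∈ Set.Ioo (Real.pi / 2) Real.pi) {ζ : ℂ}
    (hζ : ζ ∈ sector θ) {p s : ℝ} (hp : 0 ≤ p) (hs : 0 ≤ s) :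
    ‖ζ‖ * p + s ≤ sectorConst θ * ‖ζ * p + s‖ := by
  rcases hp.eq_or_lt with rfl | hp
  · rw [mul_zero, zero_add, Complex.ofReal_zero, mul_zero, zero_add, Complex.norm_real,
      Real.norm_of_nonneg hs]
    exact le_mul_of_one_le_left hs (one_le_sectorConst hθ)
  · have h1 : ζ * p ∈ sector θ := by
      refine ⟨mul_ne_zero hζ.1 (by exact_mod_cast hp.ne'), ?_⟩
      rw [mul_comm, Complex.arg_real_mul _ hp]
      exact hζ.2
    have h2 := sector_coercive hθ h1 hs
    rwa [norm_mul, Complex.norm_real, Real.norm_of_nonneg hp.le] at h2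

section Resolvent

variable {V : Type*} [AddCommGroup V] [Module ℂ V] {m a : V → V → ℂ} (hm : IsInnerForm m)
  (ha : IsInnerForm a) {B : Module.End ℂ V} (hB : ∀ x y, m (B x) y = a x y) {θ : ℝ}
  (hθ : θ ∈ Set.Ioo (Real.pi / 2) Real.pi) {ζ : ℂ} (hζ : ζ ∈ sector θ)
include hm ha hB hθ hζ

/-- Pairing the equation with `y` gives `m f y = ζ ‖y‖² + a y y`, a point of the sector plus a
nonnegative number. Coercivity controls both terms at once, even where `Re ζ < 0`. All resolvent
bounds below come from this. -/
theorem resolvent_energy {y f : V} (h : ζ • y + B y = f) :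
    ‖ζ‖ * formNorm m y ^ 2 + formNorm a y ^ 2 ≤ sectorConst θ * ‖m f y‖ := by
  have h1 : m f y = ζ * (formNorm m y ^ 2 : ℝ) + (formNorm a y ^ 2 : ℝ) := by
    rw [← h, hm.add_left, hm.smul_left, hB, ← hm.self_eq, ← ha.self_eq]
  rw [h1]
  exact sector_coercive_mul hθ hζ (sq_nonneg _) (sq_nonneg _)

theorem isUnit_smul_add [FiniteDimensional ℂ V] : IsUnit (ζ • (1 : Module.End ℂ V) + B) := by
  rw [LinearMap.isUnit_iff_ker_eq_bot, LinearMap.ker_eq_bot']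
  intro y hy
  have h := resolvent_energy hm ha hB hθ hζ (y := y) (f := 0) hy
  rw [hm.zero_left, norm_zero, mul_zero] at h
  by_contra hne
  have h1 := ha.formNorm_pos hne
  have : 0 < formNorm a y ^ 2 := by positivity
  nlinarith [norm_nonneg ζ, sq_nonneg (formNorm m y), mul_nonneg (norm_nonneg ζ)
    (sq_nonneg (formNorm m y))]

theorem resolvent_spec [FiniteDimensional ℂ V] (f : V) :
    ζ • Ring.inverse (ζ • (1 : Module.End ℂ V) + B) f
      + B (Ring.inverse (ζ • (1 : Module.End ℂ V) + B) f) = f := by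
  have h := Ring.mul_inverse_cancel _ (isUnit_smul_add hm ha hB hθ hζ)
  exact LinearMap.congr_fun h f

theorem resolvent_unique [FiniteDimensional ℂ V] {y f : V} (h : ζ • y + B y = f) :
    Ring.inverse (ζ • (1 : Module.End ℂ V) + B) f = y := by
  have h1 := Ring.inverse_mul_cancel _ (isUnit_smul_add hm ha hB hθ hζ)
  have h2 := LinearMap.congr_fun h1 y
  rw [← h]
  exact h2

theorem resolvent_norm_le {y f : V} (h : ζ • y + B y = f) :
    ‖ζ‖ * formNorm m y ≤ sectorConst θ * formNorm m f := by
  have h1 := resolvent_energy hm ha hB hθ hζ h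
  have h2 := hm.norm_le f y
  have hC := sectorConst_pos hθ
  rcases (Real.sqrt_nonneg (m y y).re).eq_or_lt with h0 | h0
  · rw [formNorm, ← h0, mul_zero]
    exact mul_nonneg hC.le (Real.sqrt_nonneg _)
  · have h3 := mul_le_mul_of_nonneg_left h2 hC.le
    have h4 : 0 < formNorm m y := h0
    refine le_of_mul_le_mul_right ?_ h4
    nlinarith [sq_nonneg (formNorm a y)]

/-- The energy estimate is multiplied by `|ζ|`, and the remaining `|ζ| ‖y‖` is bounded by
`resolvent_norm_le`. -/
theorem resolvent_energyNorm_le {y f : V} (h : ζ • y + B y = f) :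
    Real.sqrt ‖ζ‖ * formNorm a y ≤ sectorConst θ * formNorm m f := by
  have h1 := resolvent_energy hm ha hB hθ hζ h
  have h2 := hm.norm_le f y
  have h3 := resolvent_norm_le hm ha hB hθ hζ h
  have hC := sectorConst_pos hθ
  have hf : 0 ≤ formNorm m f := Real.sqrt_nonneg _
  refine le_of_sq_le_sq ?_ (by positivity)
  rw [mul_pow, Real.sq_sqrt (norm_nonneg _)]
  have h4 : formNorm a y ^ 2 ≤ sectorConst θ * (formNorm m f * formNorm m y) := by
    have := mul_le_mul_of_nonneg_left h2 hC.le
    have h5 : 0 ≤ ‖ζ‖ * formNorm m y ^ 2 := by positivity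
    linarith
  calc ‖ζ‖ * formNorm a y ^ 2 ≤ ‖ζ‖ * (sectorConst θ * (formNorm m f * formNorm m y)) := by gcongr
    _ = sectorConst θ * formNorm m f * (‖ζ‖ * formNorm m y) := by ring
    _ ≤ sectorConst θ * formNorm m f * (sectorConst θ * formNorm m f) := by gcongr
    _ = _ := by ring

/-- For right-hand sides in the range of `B`, pairing with `y` gives `a g y`. Only the energy norm
of `g` enters, so no norm of `B`, which would depend on the mesh, is needed. -/
theorem resolvent_energy' {y g : V} (h : ζ • y + B y = B g) :
    ‖ζ‖ * formNorm m y ^ 2 + formNorm a y ^ 2 ≤ sectorConst θ * (formNorm a g * formNorm a y) := by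
  have h1 := resolvent_energy hm ha hB hθ hζ h
  rw [hB] at h1
  exact h1.trans (mul_le_mul_of_nonneg_left (ha.norm_le g y) (sectorConst_pos hθ).le)

theorem resolvent_energyNorm_le' {y g : V} (h : ζ • y + B y = B g) :
    formNorm a y ≤ sectorConst θ * formNorm a g := by
  have h1 := resolvent_energy' hm ha hB hθ hζ h
  have hC := sectorConst_pos hθ
  have h5 : 0 ≤ ‖ζ‖ * formNorm m y ^ 2 := by positivity
  have hg : 0 ≤ formNorm a g := Real.sqrt_nonneg _
  rcases (Real.sqrt_nonneg (a y y).re).eq_or_lt with h0 | h0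
  · rw [show formNorm a y = 0 from h0.symm]
    positivity
  · have h4 : 0 < formNorm a y := h0
    refine le_of_mul_le_mul_right ?_ h4
    nlinarith

theorem resolvent_norm_le' {y g : V} (h : ζ • y + B y = B g) :
    Real.sqrt ‖ζ‖ * formNorm m y ≤ sectorConst θ * formNorm a g := by
  have h1 := resolvent_energy' hm ha hB hθ hζ h
  have h2 := resolvent_energyNorm_le' hm ha hB hθ hζ h
  have hC := sectorConst_pos hθ
  have hg : 0 ≤ formNorm a g := Real.sqrt_nonneg _
  refine le_of_sq_le_sq ?_ (by positivity)
  rw [mul_pow, Real.sq_sqrt (norm_nonneg _)]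
  have h3 : sectorConst θ * (formNorm a g * formNorm a y)
      ≤ sectorConst θ * (formNorm a g * (sectorConst θ * formNorm a g)) := by gcongr
  nlinarith [sq_nonneg (formNorm a y)]

/-- The difference `g - y` solves the resolvent equation with right-hand side `ζ g`, where the
factor `|ζ|` cancels. -/
theorem resolvent_norm_le'' {y g : V} (h : ζ • y + B y = B g) :
    formNorm m y ≤ (1 + sectorConst θ) * formNorm m g := by
  have h1 : ζ • (g - y) + B (g - y) = ζ • g := by
    rw [smul_sub, map_sub, ← h]
    abel
  have h2 := resolvent_norm_le hm ha hB hθ hζ h1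
  rw [hm.formNorm_smul, mul_left_comm] at h2
  have h3 := le_of_mul_le_mul_left h2 (norm_pos_iff.2 hζ.1)
  have h4 := hm.formNorm_sub_le g (g - y)
  rw [sub_sub_cancel] at h4
  linarith

omit hθ hζ in
/-- Partial fractions for resolvents. -/
theorem exists_resolvent_expansion [FiniteDimensional ℂ V] :
    ∃ (b : Module.Basis (Fin (Module.finrank ℂ V)) ℂ V) (l : Fin (Module.finrank ℂ V) → ℝ),
      (∀ i, 0 ≤ l i) ∧ (∀ i, B (b i) = (l i : ℂ) • b i) ∧
      ∀ θ ∈ Set.Ioo (Real.pi / 2) Real.pi, ∀ ζ ∈ sector θ, ∀ v : V,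
        Ring.inverse (ζ • (1 : Module.End ℂ V) + B) v
          = ∑ i, (ζ + l i)⁻¹ • (b.repr v i • b i) := by
  obtain ⟨b, l, hb, hl⟩ := hm.exists_orthonormal_eigenbasis (B := B) (fun x y => by
    rw [hB, ← hm.symm, hB, ha.symm])
  have hl0 : ∀ i, 0 ≤ l i := fun i => by
    have h1 := hB (b i) (b i)
    rw [hl, hm.smul_left, hb, if_pos rfl, mul_one] at h1
    have h2 := ha.re_self_nonneg (b i)
    rwa [← h1, Complex.ofReal_re] at h2
  refine ⟨b, l, hl0, hl, fun θ hθ ζ hζ v => ?_⟩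
  refine resolvent_unique hm ha hB hθ hζ ?_
  rw [map_sum, Finset.smul_sum, ← Finset.sum_add_distrib]
  nth_rewrite 3 [← b.sum_repr v]
  refine Finset.sum_congr rfl fun i _ => ?_
  have hne := sector_add_ne_zero hθ hζ (hl0 i)
  rw [map_smul, map_smul, hl]
  simp only [smul_smul, ← add_smul]
  congr 1
  field_simp

end Resolvent

/-! ### Abstract error analysis of the transform -/

theorem IsInnerForm.formNorm_neg {V : Type*} [AddCommGroup V] [Module ℂ V] {m : V → V → ℂ}
    (hm : IsInnerForm m) (x : V) : formNorm m (-x) = formNorm m x := by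
  rw [← neg_one_smul ℂ, hm.formNorm_smul, norm_neg, norm_one, one_mul]

/-- The algebraic setting of the error analysis: two inner products `m` and `mh`, the energy
inner product `a`, their operators, and bounds for the quadrature error. -/
structure QuadratureSetting {V : Type*} [AddCommGroup V] [Module ℂ V] (m mh a : V → V → ℂ)
    (A Ab Q : Module.End ℂ V) (h K : ℝ) : Prop where
  inner : IsInnerForm m
  innerh : IsInnerForm mh
  energy : IsInnerForm a
  A_spec : ∀ x y, m (A x) y = a x y
  Ab_spec : ∀ x y, mh (Ab x) y = a x y
  Q_spec : ∀ x y, a (Q x) y = mh x y - m x y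
  h_nonneg : 0 ≤ h
  K_nonneg : 0 ≤ K
  normh_le : ∀ x, formNorm mh x ≤ K * formNorm m x
  norm_le : ∀ x, formNorm m x ≤ K * formNorm mh x
  quad_le : ∀ x y, ‖mh x y - m x y‖ ≤ K * h ^ 2 * formNorm a x * formNorm a y
  quad_le_left : ∀ x y, ‖mh x y - m x y‖ ≤ K * h * formNorm m x * formNorm a y

/-- The integrand of the contour integral for the error. -/
noncomputable def errorTransform {V : Type*} [AddCommGroup V] [Module ℂ V]
    (A Ab Q : Module.End ℂ V) (β : ℂ → ℂ) (v : V) (z : ℂ) : V :=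
  (β z • Ring.inverse ((z * β z) • (1 : Module.End ℂ V) + Ab))
    (Ab (Q (z • (β z • Ring.inverse ((z * β z) • (1 : Module.End ℂ V) + A)) v - v)))

theorem le_of_sq_le_mul {x y : ℝ} (hx : 0 ≤ x) (hy : 0 ≤ y) (h : x ^ 2 ≤ y * x) : x ≤ y := by
  rcases hx.eq_or_lt with rfl | hx
  · exact hy
  · exact le_of_mul_le_mul_right (by rwa [sq] at h) hx

namespace QuadratureSetting

variable {V : Type*} [AddCommGroup V] [Module ℂ V] {m mh a : V → V → ℂ}
  {A Ab Q : Module.End ℂ V} {h K : ℝ} (S : QuadratureSetting m mh a A Ab Q h K)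
include S

theorem quad_le_right (x y : V) :
    ‖mh x y - m x y‖ ≤ K * h * formNorm a x * formNorm m y := by
  rw [← S.innerh.symm, ← S.inner.symm, ← star_sub, norm_star]
  refine (S.quad_le_left y x).trans_eq ?_
  ring

/-- The definition of `Q x` is tested with `Q x` itself. -/
theorem energyNorm_Q_le (x : V) : formNorm a (Q x) ≤ K * h ^ 2 * formNorm a x := by
  have h1 := S.quad_le x (Q x)
  rw [← S.Q_spec, S.energy.self_eq, Complex.norm_real, Real.norm_of_nonneg (sq_nonneg _)] at h1
  have := S.K_nonneg
  exact le_of_sq_le_mul (Real.sqrt_nonneg _)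
    (mul_nonneg (by positivity) (Real.sqrt_nonneg _)) h1

theorem energyNorm_Q_le' (x : V) : formNorm a (Q x) ≤ K * h * formNorm m x := by
  have h1 := S.quad_le_left x (Q x)
  rw [← S.Q_spec, S.energy.self_eq, Complex.norm_real, Real.norm_of_nonneg (sq_nonneg _)] at h1
  exact le_of_sq_le_mul (Real.sqrt_nonneg _)
    (mul_nonneg (mul_nonneg S.K_nonneg S.h_nonneg) (Real.sqrt_nonneg _)) h1

/-- Testing with `Ab (Q x)` gives `‖Ab (Q x)‖²` in the norm of `mh` as the quadrature error of `x`
and `Ab (Q x)`. Its bound with the energy norm on `x` costs one power of `h` but needs no inverse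
inequality. -/
theorem normh_Ab_Q_le (x : V) : formNorm mh (Ab (Q x)) ≤ K ^ 2 * h * formNorm a x := by
  have h1 := S.quad_le_right x (Ab (Q x))
  rw [← S.Q_spec, ← S.Ab_spec, S.innerh.self_eq, Complex.norm_real,
    Real.norm_of_nonneg (sq_nonneg _)] at h1
  have hK := S.K_nonneg
  have hh := S.h_nonneg
  have hx : 0 ≤ formNorm a x := Real.sqrt_nonneg _
  refine le_of_sq_le_mul (Real.sqrt_nonneg _) (by positivity) (h1.trans ?_)
  calc _ ≤ K * h * formNorm a x * (K * formNorm mh (Ab (Q x))) := by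
        gcongr
        exact S.norm_le _
    _ = _ := by ring

/-- Both operators represent `a`, so `m (A x) (A x) = a x (A x) = mh (Ab x) (A x)`; then
Cauchy-Schwarz and the equivalence of norms apply. -/
theorem norm_A_le (x : V) : formNorm m (A x) ≤ K ^ 2 * formNorm m (Ab x) := by
  have h1 := S.innerh.norm_le (Ab x) (A x)
  rw [S.Ab_spec, ← S.A_spec, S.inner.self_eq, Complex.norm_real,
    Real.norm_of_nonneg (sq_nonneg _)] at h1
  have hK := S.K_nonneg
  have hx : 0 ≤ formNorm m (Ab x) := Real.sqrt_nonneg _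
  have hy : 0 ≤ formNorm mh (A x) := Real.sqrt_nonneg _
  refine le_of_sq_le_mul (Real.sqrt_nonneg _) (by positivity) (h1.trans ?_)
  calc _ ≤ (K * formNorm m (Ab x)) * (K * formNorm m (A x)) := by
        gcongr <;> exact S.normh_le _
    _ = _ := by ring

/-- Paired with `y` in `mh`, the left-hand side is `mh (A x) y - m (A x) y`, and the last term is `a
x y = mh (Ab x) y`. This identity is what makes `ξ` the difference of the two methods. -/
theorem Ab_Q_A (x : V) : Ab (Q (A x)) = A x - Ab x := by
  refine S.innerh.ext_left fun y => ?_
  rw [S.Ab_spec, S.Q_spec, S.A_spec, S.innerh.sub_left, S.Ab_spec]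

/-- Bounds for `β(z) (z β(z) I + Ā)⁻¹ Ā Q w` in terms of the energy norm of `w`. -/
theorem solution_le {θ θ' : ℝ} {β : ℂ → ℂ} (hβ : IsSectorialKernel θ θ' β) {z : ℂ}
    (hz : z ∈ sector θ) (w : V) {u : V} (hu : (z * β z) • u + Ab u = Ab (Q w)) :
    Real.sqrt ‖z * β z‖ * (formNorm m u + h * formNorm a u)
      ≤ 2 * sectorConst θ' * K ^ 2 * h ^ 2 * formNorm a w := by
  have hζ := hβ.mapsTo z hz
  have h1 := resolvent_norm_le' S.innerh S.energy S.Ab_spec hβ.angle' hζ hu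
  have h2 := resolvent_energyNorm_le S.innerh S.energy S.Ab_spec hβ.angle' hζ hu
  have hK := S.K_nonneg
  have hh := S.h_nonneg
  have hC := sectorConst_pos hβ.angle'
  have hw : 0 ≤ formNorm a w := Real.sqrt_nonneg _
  have h3 : Real.sqrt ‖z * β z‖ * formNorm m u
      ≤ sectorConst θ' * K ^ 2 * h ^ 2 * formNorm a w := by
    calc _ ≤ Real.sqrt ‖z * β z‖ * (K * formNorm mh u) := by
          gcongr
          exact S.norm_le u
      _ = K * (Real.sqrt ‖z * β z‖ * formNorm mh u) := by ring
      _ ≤ K * (sectorConst θ' * (K * h ^ 2 * formNorm a w)) := by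
          exact mul_le_mul_of_nonneg_left
            (h1.trans (mul_le_mul_of_nonneg_left (S.energyNorm_Q_le w) hC.le)) hK
      _ = _ := by ring
  have h4 : Real.sqrt ‖z * β z‖ * (h * formNorm a u)
      ≤ sectorConst θ' * K ^ 2 * h ^ 2 * formNorm a w := by
    calc _ = h * (Real.sqrt ‖z * β z‖ * formNorm a u) := by ring
      _ ≤ h * (sectorConst θ' * (K ^ 2 * h * formNorm a w)) := by
          exact mul_le_mul_of_nonneg_left
            (h2.trans (mul_le_mul_of_nonneg_left (S.normh_Ab_Q_le w) hC.le)) hh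
      _ = _ := by ring
  rw [mul_add]
  linarith

section Resolvent

variable [FiniteDimensional ℂ V] {θ θ' : ℝ} {β : ℂ → ℂ} (hβ : IsSectorialKernel θ θ' β) {z : ℂ}
  (hz : z ∈ sector θ) (v : V)
include hβ hz

omit S hz in
-- With `f = (zβ + A)⁻¹ v` the vector is `zβ f - v = -A f`. It therefore solves the resolvent
-- equation with right-hand side `A (-v)`, to which each of the resolvent bounds applies, according
-- to the regularity of `v`.
theorem derivTransform_spec (S : QuadratureSetting m mh a A Ab Q h K) (hz : z ∈ sector θ) :
    (z * β z) • (z • (β z • Ring.inverse ((z * β z) • (1 : Module.End ℂ V) + A)) v - v)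
      + A (z • (β z • Ring.inverse ((z * β z) • (1 : Module.End ℂ V) + A)) v - v) = A (-v) := by
  have h1 := resolvent_spec S.inner S.energy S.A_spec hβ.angle' (hβ.mapsTo z hz) v
  rw [LinearMap.smul_apply, smul_smul]
  set f := Ring.inverse ((z * β z) • (1 : Module.End ℂ V) + A) v
  rw [eq_sub_of_add_eq h1, sub_sub_cancel_left, smul_neg, map_neg, ← map_smul, ← neg_add,
    ← map_add, h1, map_neg]

theorem exists_errorTransform_eq :
    ∃ w u : V, (z * β z) • w + A w = A (-v) ∧ (z * β z) • u + Ab u = Ab (Q w) ∧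
      errorTransform A Ab Q β v z = β z • u :=
  ⟨_, _, derivTransform_spec hβ v S hz,
    resolvent_spec S.innerh S.energy S.Ab_spec hβ.angle' (hβ.mapsTo z hz) _, rfl⟩

/-- Write `f` and `e` for the resolvents of `A` and `Ab` at `v`. Since `w = -A f`, `Ab_Q_A` gives
`Ab (Q w) = Ab f - A f`, and subtracting the two resolvent equations shows that `f - e` solves the
equation with this right-hand side. -/
theorem errorTransform_eq :
    errorTransform A Ab Q β v z
      = β z • Ring.inverse ((z * β z) • (1 : Module.End ℂ V) + A) v
        - β z • Ring.inverse ((z * β z) • (1 : Module.End ℂ V) + Ab) v := by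
  have hζ := hβ.mapsTo z hz
  obtain ⟨w, hw⟩ : ∃ w, w = z • (β z • Ring.inverse ((z * β z) • (1 : Module.End ℂ V) + A)) v - v :=
    ⟨_, rfl⟩
  have h1 := resolvent_spec S.inner S.energy S.A_spec hβ.angle' hζ v
  have h2 := resolvent_spec S.innerh S.energy S.Ab_spec hβ.angle' hζ v
  set f := Ring.inverse ((z * β z) • (1 : Module.End ℂ V) + A) v with hf
  set e := Ring.inverse ((z * β z) • (1 : Module.End ℂ V) + Ab) v with he
  have hw' : w = A (-f) := by
    rw [hw, LinearMap.smul_apply, smul_smul, map_neg, ← hf]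
    rw [eq_sub_of_add_eq h1, sub_sub_cancel_left]
  have h3 : Ring.inverse ((z * β z) • (1 : Module.End ℂ V) + Ab) (Ab (Q w)) = f - e := by
    refine resolvent_unique S.innerh S.energy S.Ab_spec hβ.angle' hζ ?_
    rw [hw', S.Ab_Q_A, map_sub, smul_sub, map_neg, map_neg]
    have h4 : (z * β z) • f = v - A f := eq_sub_of_add_eq h1
    have h5 : (z * β z) • e = v - Ab e := eq_sub_of_add_eq h2
    rw [h4, h5]
    abel
  rw [errorTransform, ← hw, LinearMap.smul_apply, h3, smul_sub]

/-- Both resolvents contribute a factor `|zβ|^(-1/2)`, one through `solution_le` and one through the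
energy norm of `w`. Together they cancel the numerator of `|β| = |zβ| / |z|` and leave `1/|z|`,
without any growth bound on `β`. -/
theorem errorTransform_le_smooth :
    formNorm m (errorTransform A Ab Q β v z) + h * formNorm a (errorTransform A Ab Q β v z)
      ≤ 2 * sectorConst θ' ^ 2 * K ^ 4 * h ^ 2 * formNorm m (Ab v) * ‖z‖ ^ (-1 : ℝ) := by
  obtain ⟨w, u, hw, hu, he⟩ := S.exists_errorTransform_eq hβ hz v
  have hζ := hβ.mapsTo z hz
  have hz0 : 0 < ‖z‖ := norm_pos_iff.2 hz.1
  have hζ0 : 0 < ‖z * β z‖ := norm_pos_iff.2 hζ.1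
  have hK := S.K_nonneg
  have hh := S.h_nonneg
  have hC := sectorConst_pos hβ.angle'
  have h1 := S.solution_le hβ hz w hu
  have h2 := resolvent_energyNorm_le S.inner S.energy S.A_spec hβ.angle' hζ hw
  rw [map_neg, S.inner.formNorm_neg] at h2
  have h3 : Real.sqrt ‖z * β z‖ * formNorm a w ≤ sectorConst θ' * (K ^ 2 * formNorm m (Ab v)) := by
    refine h2.trans ?_
    gcongr
    exact S.norm_A_le v
  have h4 : ‖z * β z‖ * (formNorm m u + h * formNorm a u)
      ≤ 2 * sectorConst θ' ^ 2 * K ^ 4 * h ^ 2 * formNorm m (Ab v) := by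
    calc _ = Real.sqrt ‖z * β z‖ *
          (Real.sqrt ‖z * β z‖ * (formNorm m u + h * formNorm a u)) := by
          rw [← mul_assoc, Real.mul_self_sqrt hζ0.le]
      _ ≤ Real.sqrt ‖z * β z‖ * (2 * sectorConst θ' * K ^ 2 * h ^ 2 * formNorm a w) := by gcongr
      _ = 2 * sectorConst θ' * K ^ 2 * h ^ 2 * (Real.sqrt ‖z * β z‖ * formNorm a w) := by ring
      _ ≤ 2 * sectorConst θ' * K ^ 2 * h ^ 2 *
          (sectorConst θ' * (K ^ 2 * formNorm m (Ab v))) := by gcongr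
      _ = _ := by ring
  rw [he, S.inner.formNorm_smul, S.energy.formNorm_smul, mul_norm_rpow_neg_one,
    norm_eq_norm_mul_div hz.1 (β z)]
  rw [le_div_iff₀ hz0]
  refine le_trans (le_of_eq ?_) h4
  field_simp

/-- Here `w` is bounded only by the energy norm of `v`, so a single factor `|zβ|^(-1/2)` is
available. The remaining `|β| / |zβ|^(1/2) = (|β| / |z|)^(1/2)` is estimated by the power bound. -/
theorem errorTransform_le_energy {c μ : ℝ} (hc : 0 ≤ c) (hp : HasPowerBound θ β c μ) :
    formNorm m (errorTransform A Ab Q β v z) + h * formNorm a (errorTransform A Ab Q β v z)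
      ≤ 2 * sectorConst θ' ^ 2 * K ^ 2 * Real.sqrt c * h ^ 2 * formNorm a v *
        ‖z‖ ^ ((μ - 1) / 2) := by
  obtain ⟨w, u, hw, hu, he⟩ := S.exists_errorTransform_eq hβ hz v
  have hζ := hβ.mapsTo z hz
  have hz0 : 0 < ‖z‖ := norm_pos_iff.2 hz.1
  have hζ0 : 0 < ‖z * β z‖ := norm_pos_iff.2 hζ.1
  have hs0 : 0 < Real.sqrt ‖z * β z‖ := Real.sqrt_pos.2 hζ0
  have hK := S.K_nonneg
  have hh := S.h_nonneg
  have hC := sectorConst_pos hβ.angle'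
  have hv : 0 ≤ formNorm a v := Real.sqrt_nonneg _
  have h1 := S.solution_le hβ hz w hu
  have h2 := resolvent_energyNorm_le' S.inner S.energy S.A_spec hβ.angle' hζ hw
  rw [S.energy.formNorm_neg] at h2
  have h3 : Real.sqrt ‖z * β z‖ * (formNorm m u + h * formNorm a u)
      ≤ 2 * sectorConst θ' ^ 2 * K ^ 2 * h ^ 2 * formNorm a v := by
    refine h1.trans ?_
    calc _ ≤ 2 * sectorConst θ' * K ^ 2 * h ^ 2 * (sectorConst θ' * formNorm a v) := by gcongr
      _ = _ := by ring
  have h4 : ‖β z‖ ≤ Real.sqrt c * ‖z‖ ^ ((μ - 1) / 2) * Real.sqrt ‖z * β z‖ := by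
    have h5 : Real.sqrt ‖z * β z‖ ^ 2 = ‖z‖ * ‖β z‖ := by
      rw [Real.sq_sqrt hζ0.le, norm_mul]
    refine le_of_sq_le_sq ?_ (by positivity)
    rw [mul_pow, mul_pow, h5, Real.sq_sqrt hc, ← Real.rpow_natCast (‖z‖ ^ _), ← Real.rpow_mul hz0.le]
    have h6 : ‖z‖ ^ μ = ‖z‖ ^ ((μ - 1) / 2 * ((2 : ℕ) : ℝ)) * ‖z‖ := by
      rw [← Real.rpow_add_one hz0.ne']
      congr 1
      push_cast
      ring
    calc ‖β z‖ ^ 2 = ‖β z‖ * ‖β z‖ := sq _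
      _ ≤ (c * ‖z‖ ^ μ) * ‖β z‖ := by
          gcongr
          exact hp z hz
      _ = _ := by rw [h6]; ring
  have h7 : 0 ≤ formNorm m u + h * formNorm a u :=
    add_nonneg (Real.sqrt_nonneg _) (mul_nonneg hh (Real.sqrt_nonneg _))
  rw [he, S.inner.formNorm_smul, S.energy.formNorm_smul]
  calc _ = ‖β z‖ * (formNorm m u + h * formNorm a u) := by ring
    _ ≤ (Real.sqrt c * ‖z‖ ^ ((μ - 1) / 2) * Real.sqrt ‖z * β z‖) *
        (formNorm m u + h * formNorm a u) := by gcongr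
    _ = Real.sqrt c * ‖z‖ ^ ((μ - 1) / 2) *
        (Real.sqrt ‖z * β z‖ * (formNorm m u + h * formNorm a u)) := by ring
    _ ≤ Real.sqrt c * ‖z‖ ^ ((μ - 1) / 2) *
        (2 * sectorConst θ' ^ 2 * K ^ 2 * h ^ 2 * formNorm a v) := by gcongr
    _ = _ := by ring

/-- No negative power of `|zβ|` is gained, so `|β| ≤ c |z|^μ` enters directly. The order `h²` comes
from the assumption on `Q` for the `m`-norm, and from `energyNorm_Q_le'` times the weight `h` for
the energy norm. -/
theorem errorTransform_le_nonsmooth {c μ q : ℝ} (hq0 : 0 ≤ q) (hp : HasPowerBound θ β c μ)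
    (hq : ∀ x, formNorm m (Q x) ≤ q * h ^ 2 * formNorm m x) :
    formNorm m (errorTransform A Ab Q β v z) + h * formNorm a (errorTransform A Ab Q β v z)
      ≤ (K ^ 2 * (1 + sectorConst θ') * q + sectorConst θ' * K) * (1 + sectorConst θ') * c * h ^ 2 *
        formNorm m v * ‖z‖ ^ μ := by
  obtain ⟨w, u, hw, hu, he⟩ := S.exists_errorTransform_eq hβ hz v
  have hζ := hβ.mapsTo z hz
  have hK := S.K_nonneg
  have hh := S.h_nonneg
  have hC := sectorConst_pos hβ.angle'
  have hv : 0 ≤ formNorm m v := Real.sqrt_nonneg _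
  have h1 := resolvent_norm_le'' S.inner S.energy S.A_spec hβ.angle' hζ hw
  rw [S.inner.formNorm_neg] at h1
  have h2 := resolvent_norm_le'' S.innerh S.energy S.Ab_spec hβ.angle' hζ hu
  have h3 := resolvent_energyNorm_le' S.innerh S.energy S.Ab_spec hβ.angle' hζ hu
  have h4 : formNorm m u ≤ K ^ 2 * (1 + sectorConst θ') * q * h ^ 2 * formNorm m w := by
    calc _ ≤ K * ((1 + sectorConst θ') * (K * formNorm m (Q w))) := by
          refine (S.norm_le u).trans ?_
          gcongr
          refine h2.trans ?_
          gcongr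
          exact S.normh_le _
      _ ≤ K * ((1 + sectorConst θ') * (K * (q * h ^ 2 * formNorm m w))) := by
          gcongr
          exact hq w
      _ = _ := by ring
  have h5 : h * formNorm a u ≤ sectorConst θ' * K * h ^ 2 * formNorm m w := by
    calc _ ≤ h * (sectorConst θ' * (K * h * formNorm m w)) := by
          gcongr
          refine h3.trans ?_
          gcongr
          exact S.energyNorm_Q_le' w
      _ = _ := by ring
  have h6 : formNorm m u + h * formNorm a u
      ≤ (K ^ 2 * (1 + sectorConst θ') * q + sectorConst θ' * K) * h ^ 2 *
        ((1 + sectorConst θ') * formNorm m v) := by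
    calc _ ≤ (K ^ 2 * (1 + sectorConst θ') * q + sectorConst θ' * K) * h ^ 2 * formNorm m w := by
          linarith
      _ ≤ _ := by gcongr
  have h7 : 0 ≤ formNorm m u + h * formNorm a u :=
    add_nonneg (Real.sqrt_nonneg _) (mul_nonneg hh (Real.sqrt_nonneg _))
  rw [he, S.inner.formNorm_smul, S.energy.formNorm_smul]
  calc _ = ‖β z‖ * (formNorm m u + h * formNorm a u) := by ring
    _ ≤ (c * ‖z‖ ^ μ) * ((K ^ 2 * (1 + sectorConst θ') * q + sectorConst θ' * K) * h ^ 2 *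
        ((1 + sectorConst θ') * formNorm m v)) :=
        mul_le_mul (hp z hz) h6 h7 ((norm_nonneg _).trans (hp z hz))
    _ = _ := by ring

end Resolvent

end QuadratureSetting

/-- A vector-valued contour integral is bounded in the norm of an inner product. -/
theorem formNorm_contourIntegral_le {V : Type*} [AddCommGroup V] [Module ℂ V] {p : V → V → ℂ}
    (hp : IsInnerForm p) {φ θ : ℝ} (hφ : ContourAngles φ θ) {W : ℂ → V} {X : V} {t M s : ℝ}
    (ht : 0 < t)
    (hX : ∀ ℓ : V →ₗ[ℂ] ℂ, ℓ X = -(2 * Real.pi * Complex.I)⁻¹ *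
      contourIntegral φ (1 / t) (fun z => Complex.exp (z * t) * ℓ (W z)))
    (hM : ∀ z ∈ sector θ, formNorm p (W z) ≤ M * ‖z‖ ^ s) :
    formNorm p X ≤ M * t ^ (-s - 1) * contourConst φ s := by
  -- Duality: testing with `X` itself gives `‖X‖²` as a scalar contour integral bounded by a
  -- constant times `‖X‖`.
  let ℓ : V →ₗ[ℂ] ℂ :=
    { toFun := fun x => p x X
      map_add' := fun x y => hp.add_left x y X
      map_smul' := fun c x => hp.smul_left c x X }
  have hX0 : 0 ≤ formNorm p X := Real.sqrt_nonneg _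
  have h1 := norm_contourIntegral_le hφ ht (f := fun z => ℓ (W z)) (M := M * formNorm p X) (s := s)
    (fun z hz => (hp.norm_le (W z) X).trans ((mul_le_mul_of_nonneg_right (hM z hz) hX0).trans_eq
      (by ring)))
  have h2 : ‖ℓ X‖ = formNorm p X ^ 2 := by
    change ‖p X X‖ = _
    rw [hp.self_eq, Complex.norm_real, Real.norm_of_nonneg (sq_nonneg _)]
  have h3 : ‖-(2 * Real.pi * Complex.I : ℂ)⁻¹‖ ≤ 1 := by
    rw [norm_neg, norm_inv, norm_mul, norm_mul, Complex.norm_I, Complex.norm_real, mul_one,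
      Complex.norm_ofNat, Real.norm_of_nonneg Real.pi_pos.le]
    exact inv_le_one_of_one_le₀ (by linarith [Real.pi_gt_three])
  have h4 : 0 ≤ M * t ^ (-s - 1) * contourConst φ s := by
    have h5 := (Real.sqrt_nonneg _).trans (hM _ (hφ.ray_mem one_pos hφ.mem))
    rw [norm_mul_exp one_pos, Real.one_rpow, mul_one] at h5
    have := contourConst_pos hφ.pos s
    positivity
  refine le_of_sq_le_mul hX0 h4 ?_
  rw [← h2, hX ℓ, norm_mul]
  calc _ ≤ 1 * (M * formNorm p X * t ^ (-s - 1) * contourConst φ s) := by gcongr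
    _ = _ := by ring

/-! ### The reference triangle -/

/-- The barycentric coordinates of the reference triangle. -/
def refCoord (i : Fin 3) (y : Plane) : ℝ := ![1 - y 0 - y 1, y 0, y 1] i

/-- The affine map with prescribed values at the vertices of the reference triangle. -/
noncomputable def triMap {E : Type*} [AddCommGroup E] [Module ℝ E] (P : Fin 3 → E) :
    Plane →ᵃ[ℝ] E where
  toFun y := ∑ i, refCoord i y • P i
  linear :=
    { toFun := fun y => y 0 • (P 1 - P 0) + y 1 • (P 2 - P 0)
      map_add' := fun x y => by
        simp only [PiLp.add_apply, add_smul]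
        abel
      map_smul' := fun c x => by
        simp only [PiLp.smul_apply, smul_eq_mul, mul_smul, smul_add, RingHom.id_apply] }
  map_vadd' y v := by
    simp only [Fin.sum_univ_three, refCoord, vadd_eq_add, PiLp.add_apply, LinearMap.coe_mk,
      AddHom.coe_mk, Matrix.cons_val_zero, Matrix.cons_val_one, Matrix.cons_val]
    module

theorem triMap_apply {E : Type*} [AddCommGroup E] [Module ℝ E] (P : Fin 3 → E) (y : Plane) :
    triMap P y = ∑ i, refCoord i y • P i := rfl

theorem sum_refCoord (y : Plane) : ∑ i, refCoord i y = 1 := by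
  simp only [Fin.sum_univ_three, refCoord, Matrix.cons_val_zero, Matrix.cons_val_one,
    Matrix.cons_val]
  ring

/-- The vertices of the reference triangle. -/
noncomputable def refVertex (i : Fin 3) : Plane :=
  ![0, EuclideanSpace.single 0 1, EuclideanSpace.single 1 1] i

theorem refCoord_refVertex (i j : Fin 3) : refCoord i (refVertex j) = if i = j then 1 else 0 := by
  fin_cases i <;> fin_cases j <;> simp [refCoord, refVertex]

theorem ext_refCoord {x y : Plane} (h : ∀ i, refCoord i x = refCoord i y) : x = y := by
  ext i
  fin_cases i
  · exact h 1
  · exact h 2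

theorem refCoord_affine (i : Fin 3) (s : Finset (Fin 3)) (w : Fin 3 → ℝ) (p : Fin 3 → Plane)
    (hw : ∑ j ∈ s, w j = 1) :
    refCoord i (∑ j ∈ s, w j • p j) = ∑ j ∈ s, w j * refCoord i (p j) := by
  have hs : ∀ k : Fin 2, (∑ j ∈ s, w j • p j) k = ∑ j ∈ s, w j * p j k := fun k => by
    rw [WithLp.ofLp_sum, Finset.sum_apply]
    rfl
  fin_cases i
  · simp only [refCoord, hs, Fin.zero_eta, Matrix.cons_val_zero, mul_sub, mul_one,
      Finset.sum_sub_distrib, hw]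
  · exact hs 0
  · exact hs 1

theorem triMap_refVertex {E : Type*} [AddCommGroup E] [Module ℝ E] (P : Fin 3 → E) (i : Fin 3) : triMap P (refVertex i) = P i := by
  rw [triMap_apply]
  simp [refCoord_refVertex]

theorem refCoord_triMap_perm (σ : Equiv.Perm (Fin 3)) (i : Fin 3) (y : Plane) :
    refCoord (σ i) (triMap (fun j => refVertex (σ j)) y) = refCoord i y := by
  rw [triMap_apply, refCoord_affine _ _ _ _ (sum_refCoord y)]
  simp [refCoord_refVertex]

theorem affineMap_triMap {E : Type*} [AddCommGroup E] [Module ℝ E] (g : Plane →ᵃ[ℝ] E)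
    (P : Fin 3 → Plane) (y : Plane) : g (triMap P y) = triMap (fun i => g (P i)) y := by
  have h1 : ∀ x, g x = g.linear x + g 0 := fun x => by
    have := g.map_vadd 0 x
    simpa using this
  rw [triMap_apply, triMap_apply, h1, map_sum]
  have h2 : g 0 = ∑ i, refCoord i y • g 0 := by
    rw [← Finset.sum_smul, sum_refCoord, one_smul]
  rw [h2, ← Finset.sum_add_distrib]
  refine Finset.sum_congr rfl fun i _ => ?_
  rw [map_smul, ← smul_add, ← h1]

theorem continuous_refCoord (i : Fin 3) : Continuous (refCoord i) := by
  fin_cases i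
  · exact (by fun_prop : Continuous fun y : Plane => 1 - y 0 - y 1)
  · exact (by fun_prop : Continuous fun y : Plane => y 0)
  · exact (by fun_prop : Continuous fun y : Plane => y 1)

theorem continuous_triMap {E : Type*} [NormedAddCommGroup E] [NormedSpace ℝ E] (P : Fin 3 → E) : Continuous (triMap P) :=
  (triMap P).continuous_of_finiteDimensional

/-- The reference triangle. -/
def refTri : Set Plane := {y | ∀ i, 0 ≤ refCoord i y}

/-- The part of the reference triangle in the control volume of a vertex. -/
def refPiece (i : Fin 3) : Set Plane := {y | ∀ j, 0 ≤ refCoord j y ∧ refCoord j y ≤ refCoord i y}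

theorem isClosed_refTri : IsClosed refTri := by
  simp only [refTri, Set.ofPred_forall]
  exact isClosed_iInter fun i => isClosed_le continuous_const (continuous_refCoord i)

theorem isClosed_refPiece (i : Fin 3) : IsClosed (refPiece i) := by
  simp only [refPiece, Set.ofPred_forall, Set.ofPred_and]
  exact isClosed_iInter fun j => (isClosed_le continuous_const (continuous_refCoord j)).inter
    (isClosed_le (continuous_refCoord j) (continuous_refCoord i))

theorem refPiece_subset (i : Fin 3) : refPiece i ⊆ refTri := fun _ hy j => (hy j).1

theorem refCoord_combo (i : Fin 3) {a b : ℝ} (hab : a + b = 1) (x y : Plane) :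
    refCoord i (a • x + b • y) = a * refCoord i x + b * refCoord i y := by
  fin_cases i
  · simp only [refCoord, PiLp.add_apply, PiLp.smul_apply, smul_eq_mul, Fin.zero_eta,
      Matrix.cons_val_zero]
    linear_combination -hab
  · rfl
  · rfl

theorem convex_refTri : Convex ℝ refTri := by
  intro x hx y hy a b ha hb hab i
  rw [refCoord_combo i hab]
  exact add_nonneg (mul_nonneg ha (hx i)) (mul_nonneg hb (hy i))

theorem convex_refPiece (i : Fin 3) : Convex ℝ (refPiece i) := by
  intro x hx y hy a b ha hb hab j
  rw [refCoord_combo j hab, refCoord_combo i hab]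
  exact ⟨add_nonneg (mul_nonneg ha (hx j).1) (mul_nonneg hb (hy j).1),
    add_le_add (mul_le_mul_of_nonneg_left (hx j).2 ha) (mul_le_mul_of_nonneg_left (hy j).2 hb)⟩

theorem refVertex_mem (i : Fin 3) : refVertex i ∈ refTri := by
  intro j
  rw [refCoord_refVertex]
  split_ifs <;> norm_num

theorem image_refTri (P : Fin 3 → Plane) : triMap P '' refTri = convexHull ℝ (Set.range P) := by
  apply subset_antisymm
  · rintro _ ⟨y, hy, rfl⟩
    exact (convex_convexHull ℝ _).sum_mem (fun i _ => hy i) (sum_refCoord y)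
      fun i _ => subset_convexHull ℝ _ ⟨i, rfl⟩
  · refine convexHull_min ?_ (convex_refTri.affine_image (triMap P))
    rintro _ ⟨i, rfl⟩
    exact ⟨refVertex i, refVertex_mem i, triMap_refVertex P i⟩

theorem isCompact_refTri : IsCompact refTri := by
  have h1 : triMap refVertex '' refTri = refTri := by
    have : ∀ y, triMap refVertex y = y := fun y =>
      ext_refCoord fun i => refCoord_triMap_perm (Equiv.refl _) i y
    simp [this]
  rw [← h1, image_refTri]
  exact (Set.finite_range _).isCompact_convexHull (𝕜 := ℝ)

theorem isCompact_refPiece (i : Fin 3) : IsCompact (refPiece i) :=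
  isCompact_refTri.of_isClosed_subset (isClosed_refPiece i) (refPiece_subset i)

/-- The control volume of a vertex in a triangle consists of the points at which the
barycentric coordinate of the vertex is maximal. -/
theorem image_refPiece (P : Fin 3 → Plane) (i : Fin 3) :
    triMap P '' refPiece i = convexHull ℝ (insert ((3 : ℝ)⁻¹ • ∑ j, P j)
      ((fun R => midpoint ℝ (P i) R) '' Set.range P)) := by
  apply subset_antisymm
  · rintro _ ⟨y, hy, rfl⟩
    -- The coordinate of `i` is maximal; the other two vertices are numbered so that their
    -- coordinates decrease as well.
    obtain ⟨σ, hσ, hle⟩ : ∃ σ : Equiv.Perm (Fin 3), σ 0 = i ∧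
        refCoord (σ 2) y ≤ refCoord (σ 1) y := by
      have h1 : ∀ i : Fin 3, ∃ σ τ : Equiv.Perm (Fin 3), σ 0 = i ∧ τ 0 = i ∧ σ 1 = τ 2 ∧
          σ 2 = τ 1 := by decide
      obtain ⟨σ, τ, h2, h3, h4, h5⟩ := h1 i
      rcases le_total (refCoord (σ 2) y) (refCoord (σ 1) y) with h | h
      · exact ⟨σ, h2, h⟩
      · exact ⟨τ, h3, by rwa [← h4, ← h5]⟩
    set C := convexHull ℝ (insert ((3 : ℝ)⁻¹ • ∑ j, P j)
      ((fun R => midpoint ℝ (P i) R) '' Set.range P)) with hC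
    have m0 : (3 : ℝ)⁻¹ • ∑ j, P j ∈ C := subset_convexHull ℝ _ (Set.mem_insert _ _)
    have m1 : ∀ j, midpoint ℝ (P i) (P j) ∈ C := fun j =>
      subset_convexHull ℝ _ (Set.mem_insert_of_mem _ ⟨P j, ⟨j, rfl⟩, rfl⟩)
    have hsum : refCoord (σ 0) y + refCoord (σ 1) y + refCoord (σ 2) y = 1 := by
      have := sum_refCoord y
      rwa [← Equiv.sum_comp σ, Fin.sum_univ_three] at this
    -- For ordered coordinates `λ₀ ≥ λ₁ ≥ λ₂` the point is `3λ₂` times the barycenter plus `2(λ₁ -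
    -- λ₂)` times the midpoint of the edge to vertex `1` plus `λ₀ - λ₁` times vertex `0`, a convex
    -- combination.
    have key := (convex_convexHull ℝ _ : Convex ℝ C).sum_mem (t := Finset.univ)
      (w := ![3 * refCoord (σ 2) y, 2 * (refCoord (σ 1) y - refCoord (σ 2) y),
        refCoord (σ 0) y - refCoord (σ 1) y])
      (z := ![(3 : ℝ)⁻¹ • ∑ j, P j, midpoint ℝ (P i) (P (σ 1)), midpoint ℝ (P i) (P i)])
      (by
        intro j _
        fin_cases j
        · exact mul_nonneg (by norm_num) (hy _).1
        · exact mul_nonneg (by norm_num) (sub_nonneg.2 hle)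
        · exact sub_nonneg.2 (hσ ▸ (hy (σ 1)).2))
      (by
        rw [Fin.sum_univ_three]
        simp only [Matrix.cons_val_zero, Matrix.cons_val_one, Matrix.cons_val]
        linear_combination hsum)
      (by
        intro j _
        fin_cases j
        · exact m0
        · exact m1 _
        · exact m1 _)
    convert key using 1
    rw [triMap_apply, ← Equiv.sum_comp σ, ← Equiv.sum_comp σ (fun j => P j)]
    simp only [Fin.sum_univ_three, Matrix.cons_val_zero, Matrix.cons_val_one, Matrix.cons_val,
      midpoint_self, midpoint_eq_smul_add, ← hσ, invOf_eq_inv]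
    module
  · refine convexHull_min ?_ ((convex_refPiece i).affine_image (triMap P))
    rintro x (rfl | ⟨_, ⟨j, rfl⟩, rfl⟩)
    · refine ⟨∑ j, (3 : ℝ)⁻¹ • refVertex j, fun k => ?_, ?_⟩
      · have h3 : ∀ k, refCoord k (∑ j, (3 : ℝ)⁻¹ • refVertex j) = 3⁻¹ := fun k => by
          rw [refCoord_affine k Finset.univ (fun _ => (3 : ℝ)⁻¹) _ (by simp)]
          simp [refCoord_refVertex]
        rw [h3, h3]
        norm_num
      · have h3 : ∀ k, refCoord k (∑ j, (3 : ℝ)⁻¹ • refVertex j) = 3⁻¹ := fun k => by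
          rw [refCoord_affine k Finset.univ (fun _ => (3 : ℝ)⁻¹) _ (by simp)]
          simp [refCoord_refVertex]
        rw [triMap_apply, Finset.smul_sum]
        simp only [h3]
    · refine ⟨midpoint ℝ (refVertex i) (refVertex j), fun k => ?_, ?_⟩
      · have h3 : ∀ k, refCoord k (midpoint ℝ (refVertex i) (refVertex j))
            = 2⁻¹ * refCoord k (refVertex i) + 2⁻¹ * refCoord k (refVertex j) := fun k => by
          rw [midpoint_eq_smul_add, invOf_eq_inv, smul_add, refCoord_combo k (by norm_num)]
        rw [h3, h3]
        simp only [refCoord_refVertex]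
        constructor
        · positivity
        · split_ifs <;> simp_all
      · rw [AffineMap.map_midpoint, triMap_refVertex, triMap_refVertex]

/-! ### Integrals over the reference triangle -/

section Transformation

variable {P : Fin 3 → Plane} {S : Set Plane} {F : Type*} [NormedAddCommGroup F] [NormedSpace ℝ F]

/-- The ratio of the areas of a triangle and of the reference triangle. -/
noncomputable def areaFactor (P : Fin 3 → Plane) : ℝ :=
  |(LinearMap.toContinuousLinearMap (triMap P).linear).det|

theorem hasFDerivAt_affineMap (g : Plane →ᵃ[ℝ] F) (x : Plane) :
    HasFDerivAt g (LinearMap.toContinuousLinearMap g.linear) x := by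
  have h1 : (g : Plane → F) = fun x => LinearMap.toContinuousLinearMap g.linear x + g 0 := by
    funext x
    simpa using g.map_vadd 0 x
  rw [h1]
  exact (ContinuousLinearMap.hasFDerivAt _).add_const _

theorem setIntegral_image_triMap (hP : Function.Injective (triMap P)) (hS : MeasurableSet S)
    (f : Plane → F) :
    ∫ x in triMap P '' S, f x = areaFactor P • ∫ y in S, f (triMap P y) := by
  rw [integral_image_eq_integral_abs_det_fderiv_smul volume hS
    (fun x _ => (hasFDerivAt_affineMap (triMap P) x).hasFDerivWithinAt) hP.injOn,
    integral_smul]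
  rfl

theorem integrableOn_image_triMap (hP : Function.Injective (triMap P)) (hS : MeasurableSet S)
    {f : Plane → F} (hf : IntegrableOn (fun y => f (triMap P y)) S) :
    IntegrableOn f (triMap P '' S) := by
  rw [integrableOn_image_iff_integrableOn_abs_det_fderiv_smul volume hS
    (fun x _ => (hasFDerivAt_affineMap (triMap P) x).hasFDerivWithinAt) hP.injOn]
  exact hf.smul _

theorem areaFactor_pos (hP : Function.Injective (triMap P)) : 0 < areaFactor P := by
  have h1 : Function.Injective (triMap P).linear := (triMap P).linear_injective_iff.2 hP
  have h2 := (LinearEquiv.ofInjectiveEndo _ h1).isUnit_det'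
  exact abs_pos.2 h2.ne_zero

end Transformation

theorem injective_triMap_perm (σ : Equiv.Perm (Fin 3)) :
    Function.Injective (triMap fun j => refVertex (σ j)) := fun x y h =>
  ext_refCoord fun i => by rw [← refCoord_triMap_perm σ, h, refCoord_triMap_perm]

theorem triMap_perm_image {σ : Equiv.Perm (Fin 3)} {S T : Set Plane}
    (h : ∀ y, triMap (fun j => refVertex (σ j)) y ∈ T ↔ y ∈ S) :
    triMap (fun j => refVertex (σ j)) '' S = T := by
  have h1 : ∀ x, triMap (fun j => refVertex (σ j)) (triMap (fun j => refVertex (σ.symm j)) x) = x :=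
    fun x => ext_refCoord fun i => by
      have h2 := refCoord_triMap_perm σ (σ.symm i) (triMap (fun j => refVertex (σ.symm j)) x)
      have h3 := refCoord_triMap_perm σ.symm i x
      rw [Equiv.apply_symm_apply] at h2
      rw [h2, h3]
  ext x
  constructor
  · rintro ⟨y, hy, rfl⟩
    exact (h y).2 hy
  · intro hx
    exact ⟨_, (h _).1 (by rwa [h1]), h1 x⟩

theorem image_refTri_perm (σ : Equiv.Perm (Fin 3)) :
    triMap (fun j => refVertex (σ j)) '' refTri = refTri :=
  triMap_perm_image fun y => by
    simp only [refTri, Set.mem_ofPred_eq]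
    rw [← σ.forall_congr_right]
    simp only [refCoord_triMap_perm]

theorem image_refPiece_perm (σ : Equiv.Perm (Fin 3)) (i : Fin 3) :
    triMap (fun j => refVertex (σ j)) '' refPiece i = refPiece (σ i) :=
  triMap_perm_image fun y => by
    simp only [refPiece, Set.mem_ofPred_eq]
    rw [← σ.forall_congr_right]
    simp only [refCoord_triMap_perm]

/-- The area of the reference triangle. -/
noncomputable def refArea : ℝ := ∫ _ in refTri, (1 : ℝ)

theorem integrableOn_refTri {F : Type*} [NormedAddCommGroup F] {f : Plane → F}
    (hf : Continuous f) : IntegrableOn f refTri :=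
  hf.continuousOn.integrableOn_compact isCompact_refTri

theorem setIntegral_refPiece_pos {S : Set Plane} (hS : IsCompact S) (h0 : refPiece 0 ⊆ S)
    {f : Plane → ℝ} (hf : Continuous f) (hf0 : ∀ y ∈ S, 0 ≤ f y)
    (hf1 : ∀ y, refCoord 1 y < refCoord 0 y → 0 < f y) : 0 < ∫ y in S, f y := by
  rw [setIntegral_pos_iff_support_of_nonneg_ae
    ((ae_restrict_iff' hS.measurableSet).2 (.of_forall hf0))
    (hf.continuousOn.integrableOn_compact hS)]
  -- The support of `f` in `S` contains this open set, which is nonempty, as the point with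
  -- barycentric coordinates `1/2, 1/4, 1/4` shows.
  set U : Set Plane := {y | 0 < refCoord 1 y ∧ 0 < refCoord 2 y ∧ refCoord 1 y < refCoord 0 y ∧
    refCoord 2 y < refCoord 0 y} with hU
  have hUo : IsOpen U := (isOpen_lt continuous_const (continuous_refCoord 1)).inter
    ((isOpen_lt continuous_const (continuous_refCoord 2)).inter
      ((isOpen_lt (continuous_refCoord 1) (continuous_refCoord 0)).inter
        (isOpen_lt (continuous_refCoord 2) (continuous_refCoord 0))))
  have hUn : U.Nonempty := by
    refine ⟨!₂[4⁻¹, 4⁻¹], ?_⟩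
    simp [hU, refCoord]
    norm_num
  refine (hUo.measure_pos volume hUn).trans_le (measure_mono fun y hy => ⟨(hf1 y hy.2.2.1).ne', ?_⟩)
  refine h0 fun j => ?_
  obtain ⟨h1, h2, h3, h4⟩ := hy
  fin_cases j
  · exact ⟨(h1.trans h3).le, le_rfl⟩
  · exact ⟨h1.le, h3.le⟩
  · exact ⟨h2.le, h4.le⟩

theorem refArea_pos : 0 < refArea :=
  setIntegral_refPiece_pos isCompact_refTri (refPiece_subset 0) continuous_const
    (fun _ _ => zero_le_one) fun _ _ => zero_lt_one

/-- A permutation of the vertices maps the triangle onto itself, and its area is positive; no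
determinant has to be computed. -/
theorem areaFactor_perm (σ : Equiv.Perm (Fin 3)) : areaFactor (fun j => refVertex (σ j)) = 1 := by
  have h1 := setIntegral_image_triMap (injective_triMap_perm σ) isClosed_refTri.measurableSet
    fun _ => (1 : ℝ)
  rw [image_refTri_perm] at h1
  change refArea = _ * refArea at h1
  have := refArea_pos
  field_simp at h1
  exact h1.symm

theorem setIntegral_refTri_perm (σ : Equiv.Perm (Fin 3)) (f : Plane → ℝ) :
    ∫ y in refTri, f y = ∫ y in refTri, f (triMap (fun j => refVertex (σ j)) y) := by
  have h1 := setIntegral_image_triMap (injective_triMap_perm σ) isClosed_refTri.measurableSet f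
  rwa [image_refTri_perm, areaFactor_perm, one_smul] at h1

theorem setIntegral_refPiece_perm (σ : Equiv.Perm (Fin 3)) (i : Fin 3) (f : Plane → ℝ) :
    ∫ y in refPiece (σ i), f y
      = ∫ y in refPiece i, f (triMap (fun j => refVertex (σ j)) y) := by
  have h1 := setIntegral_image_triMap (injective_triMap_perm σ)
    (isClosed_refPiece i).measurableSet f
  rwa [image_refPiece_perm, areaFactor_perm, one_smul] at h1

theorem volume_affineMap_eq_zero (g : Plane →ᵃ[ℝ] ℝ) {x : Plane} (hx : g x ≠ 0) :
    volume {y | g y = 0} = 0 := by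
  refine measure_mono_null (fun y (hy : g y = 0) => ?_)
    (Measure.addHaar_affineSubspace volume ((AffineSubspace.mk' (0 : ℝ) ⊥).comap g) ?_)
  · simp [hy]
  · intro h
    have : x ∈ (AffineSubspace.mk' (0 : ℝ) ⊥).comap g := by
      rw [h]
      trivial
    simp [hx] at this

theorem volume_refPiece_inter {i j : Fin 3} (hij : i ≠ j) :
    volume (refPiece i ∩ refPiece j) = 0 := by
  have h1 := volume_affineMap_eq_zero
    (triMap fun k => (if k = i then (1 : ℝ) else 0) - if k = j then 1 else 0)
    (x := refVertex i) (by rw [triMap_refVertex]; simp [hij])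
  refine measure_mono_null (fun y hy => ?_) h1
  have h2 := (hy.1 j).2
  have h3 := (hy.2 i).2
  simp only [Set.mem_ofPred_eq, triMap_apply, smul_eq_mul, mul_sub, Finset.sum_sub_distrib,
    mul_ite, mul_one, mul_zero, Finset.sum_ite_eq', Finset.mem_univ, if_true]
  linarith

theorem iUnion_refPiece : ⋃ i, refPiece i = refTri := by
  apply subset_antisymm (Set.iUnion_subset refPiece_subset)
  intro y hy
  obtain ⟨i, hi⟩ := Finite.exists_max fun i => refCoord i y
  exact Set.mem_iUnion.2 ⟨i, fun j => ⟨hy j, hi j⟩⟩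

theorem sum_setIntegral_refPiece {f : Plane → ℝ} (hf : Continuous f) :
    ∑ i, ∫ y in refPiece i, f y = ∫ y in refTri, f y := by
  rw [← iUnion_refPiece, integral_iUnion_ae
    (fun i => (isClosed_refPiece i).measurableSet.nullMeasurableSet)
    (fun i j hij => volume_refPiece_inter hij)
    (by rw [iUnion_refPiece]; exact integrableOn_refTri hf), tsum_fintype]

/-- The moments of the barycentric coordinates that enter into the two mass forms. -/
theorem exists_moments : ∃ s r p q : ℝ, 0 ≤ r ∧ r < s ∧ 0 ≤ q ∧ q < p ∧ p + 2 * q = s + 2 * r ∧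
    (∀ i j, ∫ y in refTri, refCoord i y * refCoord j y = if i = j then s else r) ∧
    ∀ i j, ∫ y in refPiece i, refCoord j y = if i = j then p else q := by
  -- By symmetry under permutations of the vertices, the moments depend only on whether the two
  -- indices agree.
  have hperm : ∀ i j : Fin 3, ∃ σ : Equiv.Perm (Fin 3), σ 0 = i ∧ σ (if i = j then 0 else 1) = j := by
    decide
  have hc : ∀ i j, Continuous fun y => refCoord i y * refCoord j y := fun i j =>
    (continuous_refCoord i).mul (continuous_refCoord j)
  have hR : ∀ i j, ∫ y in refTri, refCoord i y * refCoord j y =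
      if i = j then ∫ y in refTri, refCoord 0 y * refCoord 0 y
      else ∫ y in refTri, refCoord 0 y * refCoord 1 y := by
    intro i j
    obtain ⟨σ, h0, h1⟩ := hperm i j
    rw [setIntegral_refTri_perm σ]
    conv_lhs => rw [← h1, ← h0]
    simp only [refCoord_triMap_perm]
    split_ifs <;> simp_all
  have hD : ∀ i j, ∫ y in refPiece i, refCoord j y =
      if i = j then ∫ y in refPiece 0, refCoord 0 y else ∫ y in refPiece 0, refCoord 1 y := by
    intro i j
    obtain ⟨σ, h0, h1⟩ := hperm i j
    conv_lhs => rw [← h1, ← h0]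
    rw [setIntegral_refPiece_perm σ]
    simp only [refCoord_triMap_perm]
    split_ifs <;> simp_all
  have hp : ∀ j, IntegrableOn (refCoord j) (refPiece 0) := fun j =>
    (continuous_refCoord j).continuousOn.integrableOn_compact (isCompact_refPiece 0)
  refine ⟨_, _, _, _, ?_, ?_, ?_, ?_, ?_, hR, hD⟩
  · exact setIntegral_nonneg isClosed_refTri.measurableSet fun y hy => mul_nonneg (hy 0) (hy 1)
  -- Expanding the square turns this positive integral into `2s - 2r`.
  · have h1 : 0 < ∫ y in refTri, (refCoord 0 y - refCoord 1 y) ^ 2 :=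
      setIntegral_refPiece_pos isCompact_refTri (refPiece_subset 0)
        (((continuous_refCoord 0).sub (continuous_refCoord 1)).pow 2) (fun y _ => sq_nonneg _)
        fun y hy => pow_pos (sub_pos.2 hy) 2
    have h2 : ∫ y in refTri, (refCoord 0 y - refCoord 1 y) ^ 2
        = (∫ y in refTri, refCoord 0 y * refCoord 0 y)
          - 2 * (∫ y in refTri, refCoord 0 y * refCoord 1 y)
          + ∫ y in refTri, refCoord 1 y * refCoord 1 y := by
      have h3 : Integrable (fun y => refCoord 0 y * refCoord 0 y
          - 2 * (refCoord 0 y * refCoord 1 y)) (volume.restrict refTri) :=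
        (integrableOn_refTri (hc 0 0)).sub ((integrableOn_refTri (hc 0 1)).const_mul 2)
      rw [← integral_const_mul, ← integral_sub (integrableOn_refTri (hc 0 0))
        ((integrableOn_refTri (hc 0 1)).const_mul 2), ← integral_add h3
        (integrableOn_refTri (hc 1 1))]
      congr 1 with y
      ring
    rw [h2, hR 1 1, if_pos rfl] at h1
    linarith
  · exact setIntegral_nonneg (isClosed_refPiece 0).measurableSet fun y hy => (hy 1).1
  · have h1 : 0 < ∫ y in refPiece 0, refCoord 0 y - refCoord 1 y :=
      setIntegral_refPiece_pos (isCompact_refPiece 0) subset_rfl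
        ((continuous_refCoord 0).sub (continuous_refCoord 1))
        (fun y hy => sub_nonneg.2 (hy 1).2) fun y hy => sub_pos.2 hy
    rw [integral_sub (hp 0) (hp 1)] at h1
    linarith
  -- The integral of one coordinate is computed twice: over the three pieces it is `p + 2q`, and
  -- after multiplication by `∑ λⱼ = 1` it is `s + 2r`.
  · have h1 := sum_setIntegral_refPiece (continuous_refCoord 0)
    have h2 : ∫ y in refTri, refCoord 0 y = ∑ j, ∫ y in refTri, refCoord 0 y * refCoord j y := by
      rw [← integral_finsetSum _ fun j _ => integrableOn_refTri (hc 0 j)]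
      congr 1 with y
      rw [← Finset.mul_sum, sum_refCoord, mul_one]
    rw [h2] at h1
    rw [Fin.sum_univ_three, Fin.sum_univ_three, hD 1 0, hD 2 0, hR 0 2,
      if_neg (by decide : (1 : Fin 3) ≠ 0), if_neg (by decide : (2 : Fin 3) ≠ 0),
      if_neg (by decide : (0 : Fin 3) ≠ 2)] at h1
    linarith

/-! ### Nodal forms on a triangle -/

/-- The sesquilinear form `α ∑ uᵢ w̄ᵢ + γ ∑ uᵢ ∑ w̄ⱼ`. -/
noncomputable def nodalForm (α γ : ℝ) (u w : Fin 3 → ℂ) : ℂ :=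
  α * ∑ i, u i * star (w i) + γ * ((∑ i, u i) * ∑ j, star (w j))

theorem nodalForm_eq_sum (α γ : ℝ) (u w : Fin 3 → ℂ) :
    nodalForm α γ u w = ∑ i, ∑ j, u i * star (w j) * ((if i = j then α + γ else γ : ℝ) : ℂ) := by
  have h1 : ∀ i j : Fin 3, ((if i = j then α + γ else γ : ℝ) : ℂ)
      = (if i = j then (α : ℂ) else 0) + γ := fun i j => by
    split_ifs <;> simp
  simp only [h1, mul_add, Finset.sum_add_distrib, mul_ite, mul_zero, Finset.sum_ite_eq,
    Finset.mem_univ, if_true, ← Finset.sum_mul, ← Finset.mul_sum]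
  rw [nodalForm]
  ring

theorem triMap_complex (u : Fin 3 → ℂ) (y : Plane) : triMap u y = ∑ i, (refCoord i y : ℂ) * u i := by
  simp [triMap_apply]

theorem setIntegral_triMap_mul_star {s r : ℝ}
    (h : ∀ i j, ∫ y in refTri, refCoord i y * refCoord j y = if i = j then s else r)
    (u w : Fin 3 → ℂ) :
    ∫ y in refTri, triMap u y * star (triMap w y) = nodalForm (s - r) r u w := by
  have h1 : ∀ y, triMap u y * star (triMap w y)
      = ∑ i, ∑ j, u i * star (w j) * ((refCoord i y * refCoord j y : ℝ) : ℂ) := fun y => by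
    rw [triMap_complex, triMap_complex, star_sum, Finset.sum_mul_sum]
    refine Finset.sum_congr rfl fun i _ => Finset.sum_congr rfl fun j _ => ?_
    simp only [star_mul', Complex.star_def, Complex.conj_ofReal, Complex.ofReal_mul]
    ring
  have hc : ∀ i j, IntegrableOn (fun y => u i * star (w j) * ((refCoord i y * refCoord j y : ℝ) : ℂ))
      refTri := fun i j => integrableOn_refTri (continuous_const.mul
    (Complex.continuous_ofReal.comp ((continuous_refCoord i).mul (continuous_refCoord j))))
  simp only [h1]
  rw [integral_finsetSum _ fun i _ => integrable_finsetSum _ fun j _ => hc i j, nodalForm_eq_sum]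
  refine Finset.sum_congr rfl fun i _ => ?_
  rw [integral_finsetSum _ fun j _ => hc i j]
  refine Finset.sum_congr rfl fun j _ => ?_
  rw [integral_const_mul, integral_complex_ofReal, h, sub_add_cancel]

theorem integrableOn_triMap_mul_star (u w : Fin 3 → ℂ) :
    IntegrableOn (fun y => triMap u y * star (triMap w y)) refTri :=
  integrableOn_refTri ((continuous_triMap u).mul (continuous_star.comp (continuous_triMap w)))

/-- The piecewise constant interpolation on the reference triangle. -/
noncomputable def refInterp (w : Fin 3 → ℂ) (y : Plane) : ℂ :=
  ∑ i, w i * (refPiece i).indicator (fun _ => (1 : ℂ)) y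

theorem triMap_mul_star_refInterp (u w : Fin 3 → ℂ) (y : Plane) :
    triMap u y * star (refInterp w y)
      = ∑ i, (refPiece i).indicator (fun y => star (w i) * triMap u y) y := by
  rw [refInterp, star_sum, Finset.mul_sum]
  refine Finset.sum_congr rfl fun i _ => ?_
  by_cases hy : y ∈ refPiece i
  · simp [hy, mul_comm]
  · simp [hy]

theorem integrableOn_indicator_refPiece (u : Fin 3 → ℂ) (c : ℂ) (i : Fin 3) :
    IntegrableOn ((refPiece i).indicator (fun y => c * triMap u y)) refTri :=
  (integrableOn_refTri (continuous_const.mul (continuous_triMap u))).indicator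
    (isClosed_refPiece i).measurableSet

theorem integrableOn_triMap_mul_star_refInterp (u w : Fin 3 → ℂ) :
    IntegrableOn (fun y => triMap u y * star (refInterp w y)) refTri := by
  simp only [triMap_mul_star_refInterp]
  exact integrable_finsetSum _ fun i _ => integrableOn_indicator_refPiece u _ i

theorem setIntegral_triMap_mul_star_refInterp {p q : ℝ}
    (h : ∀ i j, ∫ y in refPiece i, refCoord j y = if i = j then p else q) (u w : Fin 3 → ℂ) :
    ∫ y in refTri, triMap u y * star (refInterp w y) = nodalForm (p - q) q u w := by
  simp only [triMap_mul_star_refInterp]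
  rw [integral_finsetSum _ fun i _ => integrableOn_indicator_refPiece u _ i, nodalForm_eq_sum,
    Finset.sum_comm]
  refine Finset.sum_congr rfl fun i _ => ?_
  rw [setIntegral_indicator (isClosed_refPiece i).measurableSet,
    Set.inter_eq_right.2 (refPiece_subset i), integral_const_mul]
  simp only [triMap_complex]
  have hc : ∀ j, IntegrableOn (fun y => (refCoord j y : ℂ) * u j) (refPiece i) := fun j =>
    ((Complex.continuous_ofReal.comp (continuous_refCoord j)).mul
      continuous_const).continuousOn.integrableOn_compact (isCompact_refPiece i)
  rw [integral_finsetSum _ fun j _ => hc j, Finset.mul_sum]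
  refine Finset.sum_congr rfl fun j _ => ?_
  rw [integral_mul_const, integral_complex_ofReal, h, sub_add_cancel,
    if_congr (eq_comm (a := j) (b := i)) rfl rfl]
  ring

theorem nodalForm_add_left (α γ : ℝ) (u u' w : Fin 3 → ℂ) :
    nodalForm α γ (u + u') w = nodalForm α γ u w + nodalForm α γ u' w := by
  simp only [nodalForm, Pi.add_apply, add_mul, Finset.sum_add_distrib]
  ring

theorem nodalForm_smul_left (α γ : ℝ) (c : ℂ) (u w : Fin 3 → ℂ) :
    nodalForm α γ (c • u) w = c * nodalForm α γ u w := by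
  simp only [nodalForm, Pi.smul_apply, smul_eq_mul, mul_assoc, ← Finset.mul_sum]
  ring

theorem star_nodalForm (α γ : ℝ) (u w : Fin 3 → ℂ) :
    star (nodalForm α γ u w) = nodalForm α γ w u := by
  simp only [nodalForm, star_add, star_mul', star_sum, Complex.star_def,
    Complex.conj_ofReal]
  simp only [Complex.conj_conj]
  rw [mul_comm (∑ i, (starRingEnd ℂ) (u i))]
  congr 2
  exact Finset.sum_congr rfl fun i _ => mul_comm _ _

theorem nodalForm_self_re (α γ : ℝ) (u : Fin 3 → ℂ) :
    (nodalForm α γ u u).re = α * ∑ i, ‖u i‖ ^ 2 + γ * ‖∑ i, u i‖ ^ 2 := by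
  have h1 : ∀ z : ℂ, z * star z = ((‖z‖ ^ 2 : ℝ) : ℂ) := fun z => by
    rw [Complex.star_def, Complex.mul_conj, Complex.normSq_eq_norm_sq]
  rw [nodalForm, ← star_sum]
  simp only [h1, ← Complex.ofReal_sum, ← Complex.ofReal_mul, ← Complex.ofReal_add,
    Complex.ofReal_re]

theorem le_nodalForm_self_re (α : ℝ) {γ : ℝ} (hγ : 0 ≤ γ) (u : Fin 3 → ℂ) :
    α * ∑ i, ‖u i‖ ^ 2 ≤ (nodalForm α γ u u).re := by
  rw [nodalForm_self_re]
  exact le_add_of_nonneg_right (by positivity)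

theorem nodalForm_self_re_le (α : ℝ) {γ : ℝ} (hγ : 0 ≤ γ) (u : Fin 3 → ℂ) :
    (nodalForm α γ u u).re ≤ (α + 3 * γ) * ∑ i, ‖u i‖ ^ 2 := by
  have h1 : ‖∑ i, u i‖ ^ 2 ≤ 3 * ∑ i, ‖u i‖ ^ 2 := by
    have h2 := sq_sum_le_card_mul_sum_sq (s := Finset.univ) (f := fun i => ‖u i‖)
    rw [Finset.card_univ, Fintype.card_fin] at h2
    exact (pow_le_pow_left₀ (norm_nonneg _) (norm_sum_le _ _) 2).trans (by exact_mod_cast h2)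
  rw [nodalForm_self_re, add_mul, mul_comm 3 γ, mul_assoc]
  gcongr

theorem sum_norm_sub_sq_le (u : Fin 3 → ℂ) :
    ∑ i, ∑ j, ‖u i - u j‖ ^ 2 ≤ 12 * ∑ i, ‖u i‖ ^ 2 := by
  have h1 : ∀ i j, ‖u i - u j‖ ^ 2 ≤ 2 * ‖u i‖ ^ 2 + 2 * ‖u j‖ ^ 2 := fun i j => by
    have h2 := norm_sub_le (u i) (u j)
    nlinarith [sq_nonneg (‖u i‖ - ‖u j‖), norm_nonneg (u i - u j)]
  refine (Finset.sum_le_sum fun i _ => Finset.sum_le_sum fun j _ => h1 i j).trans_eq ?_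
  simp only [Fin.sum_univ_three]
  ring

/-- The form `∑ᵢⱼ (uᵢ - uⱼ)(w̄ᵢ - w̄ⱼ)`. -/
noncomputable def jumpForm (u w : Fin 3 → ℂ) : ℂ :=
  ∑ i, ∑ j, (u i - u j) * star (w i - w j)

theorem jumpForm_eq (u w : Fin 3 → ℂ) :
    jumpForm u w = 2 * nodalForm 3 (-1) u w := by
  simp only [jumpForm, nodalForm, Fin.sum_univ_three, star_sub]
  push_cast
  ring

/-- Equal row sums make the difference of the two mass matrices annihilate constants. A matrix of
this shape that does so is a multiple of the jump form, and a jump of nodal values costs a gradient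
times the mesh size; this is the source of the powers of `h`. -/
theorem nodalForm_sub_nodalForm {s r p q : ℝ} (h : p + 2 * q = s + 2 * r) (u w : Fin 3 → ℂ) :
    nodalForm (p - q) q u w - nodalForm (s - r) r u w = ((r - q) / 2 : ℝ) * jumpForm u w := by
  have h1 : (p : ℂ) = s + 2 * r - 2 * q := by
    have : p = s + 2 * r - 2 * q := by linarith
    rw [this]
    push_cast
    ring
  rw [jumpForm_eq]
  simp only [nodalForm]
  push_cast
  rw [h1]
  ring

/-! ### Integration over a triangulation -/

namespace IsConvexPolygonalDomain

variable {Ω : Set Plane} (hΩ : IsConvexPolygonalDomain Ω)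
include hΩ

theorem isOpen : IsOpen Ω := by
  obtain ⟨S, rfl⟩ := hΩ.2
  exact isOpen_interior

theorem convex : Convex ℝ Ω := by
  obtain ⟨S, rfl⟩ := hΩ.2
  exact (convex_convexHull ℝ _).interior

theorem ae_eq_closure : Ω =ᵐ[volume] closure Ω :=
  (ae_eq_set.2 ⟨by rw [Set.sdiff_eq_empty.2 subset_closure]; exact measure_empty, by
    rw [← hΩ.isOpen.frontier_eq]; exact hΩ.convex.addHaar_frontier volume⟩)

theorem isBounded : Bornology.IsBounded Ω := by
  obtain ⟨S, rfl⟩ := hΩ.2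
  exact ((S.finite_toSet.isCompact_convexHull ℝ).isBounded).subset interior_subset

/-- Otherwise `Ω` would be open, closed and nonempty, hence the whole plane, which is not bounded.
Such a point supplies the boundary value in `eq_zero_of_stiffForm`. -/
theorem exists_mem_closure_notMem : ∃ x ∈ closure Ω, x ∉ Ω := by
  by_contra! h
  have h1 : IsClosed Ω := closure_subset_iff_isClosed.1 h
  have h2 : Ω = Set.univ := IsClopen.eq_univ ⟨h1, hΩ.isOpen⟩ hΩ.1
  have h3 := hΩ.isBounded
  rw [h2] at h3
  exact NoncompactSpace.noncompact_univ (X := Plane)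
    (Metric.isCompact_of_isClosed_isBounded isClosed_univ h3)

end IsConvexPolygonalDomain

namespace Triangulation

variable {Ω : Set Plane} (T : Triangulation Ω)

/-- The closed triangle of a cell. -/
def cell (K : T.cells) : Set Plane := convexHull ℝ ((K : Finset Plane) : Set Plane)

/-- An enumeration of the vertices of a triangle. -/
noncomputable def vertex (K : T.cells) (i : Fin 3) : Plane :=
  ((Finset.equivFinOfCardEq (T.card_eq K K.2)).symm i : (K : Finset Plane))

theorem vertex_mem (K : T.cells) (i : Fin 3) : T.vertex K i ∈ (K : Finset Plane) :=
  Subtype.prop _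

theorem exists_vertex_eq {K : T.cells} {P : Plane} (hP : P ∈ (K : Finset Plane)) :
    ∃ i, T.vertex K i = P :=
  ⟨Finset.equivFinOfCardEq (T.card_eq K K.2) ⟨P, hP⟩, by rw [vertex, Equiv.symm_apply_apply]⟩

theorem range_vertex (K : T.cells) : Set.range (T.vertex K) = ((K : Finset Plane) : Set Plane) := by
  ext P
  exact ⟨fun ⟨i, hi⟩ => hi ▸ T.vertex_mem K i, fun h => T.exists_vertex_eq h⟩

theorem sum_vertex (K : T.cells) {E : Type*} [AddCommMonoid E] (f : Plane → E) :
    ∑ R ∈ (K : Finset Plane), f R = ∑ i, f (T.vertex K i) := by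
  rw [← Finset.sum_coe_sort, ← Equiv.sum_comp (Finset.equivFinOfCardEq (T.card_eq K K.2)).symm]
  rfl

theorem affineIndependent_vertex (K : T.cells) : AffineIndependent ℝ (T.vertex K) :=
  (T.indep K K.2).comp_embedding (Finset.equivFinOfCardEq (T.card_eq K K.2)).symm.toEmbedding

theorem injective_triMap_vertex (K : T.cells) : Function.Injective (triMap (T.vertex K)) := by
  intro x y hxy
  refine ext_refCoord fun i => sub_eq_zero.1 ?_
  refine (affineIndependent_iff.1 (T.affineIndependent_vertex K)) Finset.univ
    (fun i => refCoord i x - refCoord i y) ?_ ?_ i (Finset.mem_univ i)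
  · rw [Finset.sum_sub_distrib, sum_refCoord, sum_refCoord, sub_self]
  · simp only [sub_smul, Finset.sum_sub_distrib]
    exact sub_eq_zero.2 hxy

theorem image_refTri_vertex (K : T.cells) : triMap (T.vertex K) '' refTri = T.cell K := by
  rw [image_refTri, range_vertex, cell]

theorem image_refPiece_vertex (K : T.cells) (i : Fin 3) :
    triMap (T.vertex K) '' refPiece i = controlPiece K (T.vertex K i) := by
  rw [image_refPiece, range_vertex, controlPiece, T.sum_vertex K fun R => R]

theorem controlPiece_subset {K : T.cells} {P : Plane} (hP : P ∈ (K : Finset Plane)) :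
    controlPiece K P ⊆ T.cell K := by
  obtain ⟨i, rfl⟩ := T.exists_vertex_eq hP
  rw [← image_refPiece_vertex, ← image_refTri_vertex]
  exact Set.image_mono (refPiece_subset i)

theorem isCompact_cell (K : T.cells) : IsCompact (T.cell K) :=
  (K : Finset Plane).finite_toSet.isCompact_convexHull ℝ

theorem vertex_mem_cell (K : T.cells) (i : Fin 3) : T.vertex K i ∈ T.cell K :=
  subset_convexHull ℝ _ (T.vertex_mem K i)

theorem iUnion_cell : ⋃ K, T.cell K = closure Ω := by
  rw [← T.cover]
  ext x
  simp [cell]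

/-- Some vertex of `K` is not one of `L`. By conformity the intersection lies in the affine span of
the other vertices of `K`, a proper subspace by affine independence. -/
theorem volume_cell_inter {K L : T.cells} (hKL : K ≠ L) : volume (T.cell K ∩ T.cell L) = 0 := by
  obtain ⟨P, hPK, hPL⟩ : ∃ P ∈ (K : Finset Plane), P ∉ (L : Finset Plane) := by
    by_contra! h
    exact hKL (Subtype.ext (Finset.eq_of_subset_of_card_le h
      (by rw [T.card_eq K K.2, T.card_eq L L.2])))
  obtain ⟨i, rfl⟩ := T.exists_vertex_eq hPK
  have h1 := (T.affineIndependent_vertex K).notMem_affineSpan_sdiff i Set.univ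
  rw [cell, cell, T.conforming K K.2 L L.2]
  refine measure_mono_null ?_ (Measure.addHaar_affineSubspace volume
    (affineSpan ℝ (T.vertex K '' (Set.univ \ {i}))) fun h => h1 (h ▸ AffineSubspace.mem_top ℝ _ _))
  refine (convexHull_mono ?_).trans (convexHull_subset_affineSpan _)
  rintro Q ⟨hQ, hQL⟩
  obtain ⟨j, rfl⟩ := T.exists_vertex_eq hQ
  exact ⟨j, ⟨trivial, fun h => hPL (by rw [← Set.mem_singleton_iff.1 h]; exact hQL)⟩, rfl⟩

theorem setIntegral_eq_sum (hΩ : IsConvexPolygonalDomain Ω) {F : Type*} [NormedAddCommGroup F]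
    [NormedSpace ℝ F] {f : Plane → F} (hf : ∀ K, IntegrableOn f (T.cell K)) :
    ∫ x in Ω, f x = ∑ K, ∫ x in T.cell K, f x := by
  rw [setIntegral_congr_set hΩ.ae_eq_closure, ← T.iUnion_cell, integral_iUnion_ae
    (fun K => (T.isCompact_cell K).measurableSet.nullMeasurableSet)
    (fun K L hKL => T.volume_cell_inter hKL) (integrableOn_finite_iUnion.2 hf), tsum_fintype]

/-- The ratio of the areas of a triangle and of the reference triangle. -/
noncomputable def jac (K : T.cells) : ℝ := areaFactor (T.vertex K)

theorem jac_pos (K : T.cells) : 0 < T.jac K := areaFactor_pos (T.injective_triMap_vertex K)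

theorem setIntegral_cell (K : T.cells) {F : Type*} [NormedAddCommGroup F] [NormedSpace ℝ F]
    (f : Plane → F) :
    ∫ x in T.cell K, f x = T.jac K • ∫ y in refTri, f (triMap (T.vertex K) y) := by
  rw [← image_refTri_vertex,
    setIntegral_image_triMap (T.injective_triMap_vertex K) isClosed_refTri.measurableSet]
  rfl

theorem integrableOn_cell (K : T.cells) {F : Type*} [NormedAddCommGroup F] [NormedSpace ℝ F]
    {f : Plane → F} (hf : IntegrableOn (fun y => f (triMap (T.vertex K) y)) refTri) :
    IntegrableOn f (T.cell K) := by
  rw [← image_refTri_vertex]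
  exact integrableOn_image_triMap (T.injective_triMap_vertex K) isClosed_refTri.measurableSet hf

/-- Integration over `Ω`, with almost everywhere equal integrands on the triangles. -/
theorem setIntegral_eq_sum_of_ae (hΩ : IsConvexPolygonalDomain Ω) {F : Type*}
    [NormedAddCommGroup F] [NormedSpace ℝ F] {f : Plane → F} {g : T.cells → Plane → F}
    (hg : ∀ K, IntegrableOn (fun y => g K (triMap (T.vertex K) y)) refTri)
    (hfg : ∀ K, ∀ᵐ x, x ∈ T.cell K → f x = g K x) :
    ∫ x in Ω, f x = ∑ K, T.jac K • ∫ y in refTri, g K (triMap (T.vertex K) y) := by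
  have h1 : ∀ K, f =ᵐ[volume.restrict (T.cell K)] g K := fun K =>
    (ae_restrict_iff' (T.isCompact_cell K).measurableSet).2 (hfg K)
  rw [T.setIntegral_eq_sum hΩ fun K => (T.integrableOn_cell K (hg K)).congr (h1 K).symm]
  refine Finset.sum_congr rfl fun K _ => ?_
  rw [integral_congr_ae (h1 K), setIntegral_cell]

theorem ae_notMem_other_cell (K : T.cells) :
    ∀ᵐ x, x ∈ T.cell K → ∀ L : T.cells, x ∈ T.cell L → L = K := by
  have h1 : ∀ L : T.cells, ∀ᵐ x, x ∈ T.cell K → x ∈ T.cell L → L = K := fun L => by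
    by_cases h : L = K
    · exact .of_forall fun _ _ _ => h
    · have h2 := T.volume_cell_inter (Ne.symm h)
      filter_upwards [measure_eq_zero_iff_ae_notMem.1 h2] with x hx hK hL
      exact absurd ⟨hK, hL⟩ hx
  filter_upwards [ae_all_iff.2 h1] with x hx hK L
  exact hx L hK

theorem ae_mem_interior_cell (K : T.cells) : ∀ᵐ x, x ∈ T.cell K → x ∈ interior (T.cell K) := by
  have h2 : volume (frontier (T.cell K)) = 0 := (convex_convexHull ℝ _).addHaar_frontier volume
  filter_upwards [measure_eq_zero_iff_ae_notMem.1 h2] with x hx hK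
  by_contra h
  exact hx ⟨subset_closure hK, h⟩

/-- Almost every point of a triangle is interior, and the area of the triangle is positive. -/
theorem interior_cell_nonempty (K : T.cells) : (interior (T.cell K)).Nonempty := by
  by_contra h
  rw [Set.not_nonempty_iff_eq_empty] at h
  have h1 := T.setIntegral_cell K fun _ => (1 : ℝ)
  have h2 : ∀ᵐ x ∂(volume.restrict (T.cell K)), (1 : ℝ) = 0 := by
    rw [ae_restrict_iff' (T.isCompact_cell K).measurableSet]
    filter_upwards [T.ae_mem_interior_cell K] with x hx hK
    rw [h] at hx
    exact absurd (hx hK) (Set.notMem_empty x)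
  rw [integral_congr_ae h2, integral_zero] at h1
  exact (mul_pos (T.jac_pos K) refArea_pos).ne h1

/-! ### Finite element functions on a triangle -/

/-- The nodal values of a finite element function on a triangle. -/
noncomputable def nodal (χ : T.femSpace) (K : T.cells) (i : Fin 3) : ℂ := (χ : Plane → ℂ) (T.vertex K i)

theorem nodal_add (χ ψ : T.femSpace) (K : T.cells) :
    T.nodal (χ + ψ) K = T.nodal χ K + T.nodal ψ K := rfl

theorem nodal_smul (c : ℂ) (χ : T.femSpace) (K : T.cells) :
    T.nodal (c • χ) K = c • T.nodal χ K := rfl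

theorem exists_affine (χ : T.femSpace) (K : T.cells) :
    ∃ g : Plane →ᵃ[ℝ] ℂ, Set.EqOn χ g (T.cell K) := χ.2.2.1 K K.2

theorem apply_triMap (χ : T.femSpace) (K : T.cells) {y : Plane} (hy : y ∈ refTri) :
    (χ : Plane → ℂ) (triMap (T.vertex K) y) = triMap (T.nodal χ K) y := by
  obtain ⟨g, hg⟩ := T.exists_affine χ K
  rw [hg (T.image_refTri_vertex K ▸ ⟨y, hy, rfl⟩), affineMap_triMap]
  congr 2
  funext i
  exact (hg (T.vertex_mem_cell K i)).symm

theorem eq_zero_of_nodal {χ : T.femSpace} (h : ∀ K, T.nodal χ K = 0) : χ = 0 := by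
  refine Subtype.ext (funext fun x => ?_)
  by_cases hx : x ∈ Ω
  · have h1 := subset_closure hx
    rw [← T.iUnion_cell] at h1
    obtain ⟨K, hK⟩ := Set.mem_iUnion.1 h1
    rw [← T.image_refTri_vertex] at hK
    obtain ⟨y, hy, rfl⟩ := hK
    rw [T.apply_triMap χ K hy, h K, triMap_apply]
    simp
  · exact χ.2.2.2 x hx

instance finiteDimensional_femSpace : FiniteDimensional ℂ T.femSpace := by
  let f : T.femSpace →ₗ[ℂ] (T.cells → Fin 3 → ℂ) :=
    { toFun := T.nodal
      map_add' := fun _ _ => rfl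
      map_smul' := fun _ _ => rfl }
  refine FiniteDimensional.of_injective f ((injective_iff_map_eq_zero f).2 fun χ hχ => ?_)
  exact T.eq_zero_of_nodal fun K => congrFun hχ K

/-- A point of the interior of a triangle. -/
noncomputable def interiorPoint (K : T.cells) : Plane := (T.interior_cell_nonempty K).choose

/-- The gradient of a finite element function on a triangle. -/
noncomputable def cellGrad (χ : T.femSpace) (K : T.cells) (c : Fin 2) : ℂ :=
  partialDeriv χ c (T.interiorPoint K)

theorem hasFDerivAt_of_eqOn {χ : Plane → ℂ} {g : Plane →ᵃ[ℝ] ℂ} {K : T.cells}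
    (hg : Set.EqOn χ g (T.cell K)) {x : Plane} (hx : x ∈ interior (T.cell K)) :
    HasFDerivAt χ (LinearMap.toContinuousLinearMap g.linear) x :=
  (hasFDerivAt_affineMap g x).congr_of_eventuallyEq
    (Filter.mem_of_superset (mem_interior_iff_mem_nhds.1 hx) hg)

theorem partialDeriv_eq {χ : Plane → ℂ} {g : Plane →ᵃ[ℝ] ℂ} {K : T.cells}
    (hg : Set.EqOn χ g (T.cell K)) {x : Plane} (hx : x ∈ interior (T.cell K)) (c : Fin 2) :
    partialDeriv χ c x = g.linear (EuclideanSpace.single c 1) := by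
  rw [partialDeriv, (T.hasFDerivAt_of_eqOn hg hx).fderiv]
  rfl

theorem cellGrad_eq {χ : T.femSpace} {g : Plane →ᵃ[ℝ] ℂ} {K : T.cells}
    (hg : Set.EqOn χ g (T.cell K)) (c : Fin 2) :
    T.cellGrad χ K c = g.linear (EuclideanSpace.single c 1) :=
  T.partialDeriv_eq hg (T.interior_cell_nonempty K).choose_spec c

theorem partialDeriv_eq_cellGrad (χ : T.femSpace) {K : T.cells} {x : Plane}
    (hx : x ∈ interior (T.cell K)) (c : Fin 2) : partialDeriv χ c x = T.cellGrad χ K c := by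
  obtain ⟨g, hg⟩ := T.exists_affine χ K
  rw [T.partialDeriv_eq hg hx, T.cellGrad_eq hg]

theorem cellGrad_add (χ ψ : T.femSpace) (K : T.cells) (c : Fin 2) :
    T.cellGrad (χ + ψ) K c = T.cellGrad χ K c + T.cellGrad ψ K c := by
  obtain ⟨g, hg⟩ := T.exists_affine χ K
  obtain ⟨k, hk⟩ := T.exists_affine ψ K
  have h : Set.EqOn (χ + ψ : T.femSpace) (g + k : Plane →ᵃ[ℝ] ℂ) (T.cell K) := fun x hx =>
    congrArg₂ (· + ·) (hg hx) (hk hx)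
  rw [T.cellGrad_eq hg, T.cellGrad_eq hk, T.cellGrad_eq h]
  rfl

theorem cellGrad_smul (a : ℂ) (χ : T.femSpace) (K : T.cells) (c : Fin 2) :
    T.cellGrad (a • χ) K c = a * T.cellGrad χ K c := by
  obtain ⟨g, hg⟩ := T.exists_affine χ K
  have h : Set.EqOn (a • χ : T.femSpace) (a • g : Plane →ᵃ[ℝ] ℂ) (T.cell K) := fun x hx =>
    congrArg (a * ·) (hg hx)
  rw [T.cellGrad_eq hg, T.cellGrad_eq h]
  rfl

theorem sub_eq_sum_cellGrad (χ : T.femSpace) {K : T.cells} {x y : Plane} (hx : x ∈ T.cell K)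
    (hy : y ∈ T.cell K) :
    (χ : Plane → ℂ) x - (χ : Plane → ℂ) y = ∑ c, ((x - y) c : ℂ) * T.cellGrad χ K c := by
  obtain ⟨g, hg⟩ := T.exists_affine χ K
  have h1 : x - y = ∑ c, (x - y) c • EuclideanSpace.single c (1 : ℝ) := by
    ext c
    fin_cases c <;> simp
  have h2 : g x - g y = g.linear (x - y) := (g.linearMap_vsub x y).symm
  rw [hg hx, hg hy, h2]
  conv_lhs => rw [h1]
  rw [map_sum]
  refine Finset.sum_congr rfl fun c _ => ?_
  rw [map_smul, T.cellGrad_eq hg, Complex.real_smul]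

theorem meshSize_nonneg : 0 ≤ T.meshSize := Real.iSup_nonneg fun _ => Metric.diam_nonneg

theorem norm_sub_le_meshSize {K : T.cells} {x y : Plane} (hx : x ∈ T.cell K)
    (hy : y ∈ T.cell K) : ‖x - y‖ ≤ T.meshSize := by
  rw [← dist_eq_norm]
  exact (Metric.dist_le_diam_of_mem (T.isCompact_cell K).isBounded hx hy).trans
    (le_ciSup (f := fun K : T.cells => Metric.diam (T.cell K)) (Set.finite_range _).bddAbove K)

theorem norm_sub_sq_le (χ : T.femSpace) {K : T.cells} {x y : Plane} (hx : x ∈ T.cell K)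
    (hy : y ∈ T.cell K) :
    ‖(χ : Plane → ℂ) x - (χ : Plane → ℂ) y‖ ^ 2
      ≤ T.meshSize ^ 2 * ∑ c, ‖T.cellGrad χ K c‖ ^ 2 := by
  rw [T.sub_eq_sum_cellGrad χ hx hy]
  have h1 : ‖∑ c, ((x - y) c : ℂ) * T.cellGrad χ K c‖
      ≤ ∑ c, ‖(x - y) c‖ * ‖T.cellGrad χ K c‖ := by
    refine (norm_sum_le _ _).trans_eq (Finset.sum_congr rfl fun c _ => ?_)
    rw [norm_mul, Complex.norm_real]
  calc _ ≤ (∑ c, ‖(x - y) c‖ * ‖T.cellGrad χ K c‖) ^ 2 := by gcongr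
    _ ≤ (∑ c, ‖(x - y) c‖ ^ 2) * ∑ c, ‖T.cellGrad χ K c‖ ^ 2 :=
        Finset.sum_mul_sq_le_sq_mul_sq _ _ _
    _ ≤ _ := by
        rw [← EuclideanSpace.norm_sq_eq]
        gcongr
        exact T.norm_sub_le_meshSize hx hy

/-! ### The forms in terms of nodal values and gradients -/

/-- The sum of the nodal forms of the triangles. -/
noncomputable def nodalSum (α γ : ℝ) (ψ χ : T.femSpace) : ℂ :=
  ∑ K, T.jac K * nodalForm α γ (T.nodal ψ K) (T.nodal χ K)

open Classical in
-- At a point of no cell other than `K`, only control volumes of vertices of `K` count. The sum may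
-- include vertices that are not interior nodes, because `χ` vanishes there.
theorem dualInterp_eq (χ : T.femSpace) {K : T.cells} {x : Plane}
    (hx : ∀ L : T.cells, x ∈ T.cell L → L = K) :
    T.dualInterp χ x
      = ∑ i, T.nodal χ K i * (controlPiece K (T.vertex K i)).indicator (fun _ => (1 : ℂ)) x := by
  have h1 : ∀ P, (χ : Plane → ℂ) P * (T.controlVolume P).indicator (fun _ => (1 : ℂ)) x
      = if P ∈ (K : Finset Plane) then
          (χ : Plane → ℂ) P * (controlPiece K P).indicator (fun _ => (1 : ℂ)) x else 0 := by
    intro P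
    have h2 : x ∈ T.controlVolume P ↔ P ∈ (K : Finset Plane) ∧ x ∈ controlPiece K P := by
      simp only [controlVolume, Set.mem_iUnion]
      constructor
      · rintro ⟨L, hL, hP, hxL⟩
        have h3 := hx ⟨L, hL⟩ (T.controlPiece_subset (K := ⟨L, hL⟩) hP hxL)
        subst h3
        exact ⟨hP, hxL⟩
      · rintro ⟨hP, hxK⟩
        exact ⟨K, K.2, hP, hxK⟩
    split_ifs with hP
    · congr 1
      simp [Set.indicator_apply, h2, hP]
    · rw [Set.indicator_of_notMem (fun h => hP (h2.1 h).1), mul_zero]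
  simp only [nodal]
  rw [dualInterp, ← T.sum_vertex K fun P =>
    (χ : Plane → ℂ) P * (controlPiece K P).indicator (fun _ => (1 : ℂ)) x]
  simp only [h1]
  rw [interiorNodes, Finset.sum_filter, ← Finset.sum_filter_add_sum_filter_not _
    (fun P => P ∈ (K : Finset Plane))]
  have h4 : (T.cells.biUnion id).filter (fun P => P ∈ (K : Finset Plane)) = (K : Finset Plane) := by
    ext P
    simp only [Finset.mem_filter, Finset.mem_biUnion, id]
    exact ⟨fun h => h.2, fun h => ⟨⟨K, K.2, h⟩, h⟩⟩
  rw [h4, Finset.sum_eq_zero (s := Finset.filter _ _) fun P hP => ?_, add_zero]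
  · refine Finset.sum_congr rfl fun P hP => ?_
    rw [if_pos hP]
    split_ifs with h
    · rfl
    · rw [χ.2.2.2 P h, zero_mul]
  · rw [if_neg (Finset.mem_filter.1 hP).2, ite_self]

section Forms

variable (hΩ : IsConvexPolygonalDomain Ω)
include hΩ

theorem massForm_eq {s r : ℝ}
    (h : ∀ i j, ∫ y in refTri, refCoord i y * refCoord j y = if i = j then s else r)
    (ψ χ : T.femSpace) : T.massForm ψ χ = T.nodalSum (s - r) r ψ χ := by
  have h1 : ∀ K, Set.EqOn (fun y => triMap (T.nodal ψ K) y * star (triMap (T.nodal χ K) y))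
      (fun y => (ψ : Plane → ℂ) (triMap (T.vertex K) y)
        * star ((χ : Plane → ℂ) (triMap (T.vertex K) y))) refTri := fun K y hy => by
    simp only [T.apply_triMap _ K hy]
  rw [massForm, l2Inner, T.setIntegral_eq_sum_of_ae hΩ
    (g := fun _ x => (ψ : Plane → ℂ) x * star ((χ : Plane → ℂ) x))
    (fun K => (integrableOn_triMap_mul_star _ _).congr_fun (h1 K) isClosed_refTri.measurableSet)
    fun K => .of_forall fun x _ => rfl, nodalSum]
  refine Finset.sum_congr rfl fun K _ => ?_
  rw [← setIntegral_congr_fun isClosed_refTri.measurableSet (h1 K),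
    setIntegral_triMap_mul_star h, Complex.real_smul]

theorem dualMassForm_eq {p q : ℝ}
    (h : ∀ i j, ∫ y in refPiece i, refCoord j y = if i = j then p else q)
    (ψ χ : T.femSpace) : T.dualMassForm ψ χ = T.nodalSum (p - q) q ψ χ := by
  have h1 : ∀ K, Set.EqOn (fun y => triMap (T.nodal ψ K) y * star (refInterp (T.nodal χ K) y))
      (fun y => (ψ : Plane → ℂ) (triMap (T.vertex K) y) * star (∑ i, T.nodal χ K i *
        (controlPiece K (T.vertex K i)).indicator (fun _ => (1 : ℂ)) (triMap (T.vertex K) y)))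
      refTri := fun K y hy => by
    have h2 : ∀ i, (controlPiece K (T.vertex K i)).indicator (fun _ => (1 : ℂ))
        (triMap (T.vertex K) y) = (refPiece i).indicator (fun _ => (1 : ℂ)) y := fun i => by
      rw [← T.image_refPiece_vertex, ← Set.indicator_comp_right,
        Set.preimage_image_eq _ (T.injective_triMap_vertex K)]
      rfl
    simp only [T.apply_triMap _ K hy, refInterp, h2]
  rw [dualMassForm, l2Inner, T.setIntegral_eq_sum_of_ae hΩ
    (g := fun K x => (ψ : Plane → ℂ) x * star (∑ i, T.nodal χ K i *
        (controlPiece K (T.vertex K i)).indicator (fun _ => (1 : ℂ)) x))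
    (fun K => (integrableOn_triMap_mul_star_refInterp _ _).congr_fun (h1 K)
      isClosed_refTri.measurableSet) fun K => ?_, nodalSum]
  · refine Finset.sum_congr rfl fun K _ => ?_
    rw [← setIntegral_congr_fun isClosed_refTri.measurableSet (h1 K),
      setIntegral_triMap_mul_star_refInterp h, Complex.real_smul]
  · filter_upwards [T.ae_notMem_other_cell K] with x hx hK
    rw [T.dualInterp_eq χ (hx hK)]

theorem stiffForm_eq (ψ χ : T.femSpace) : T.stiffForm ψ χ
    = ∑ K, ((T.jac K * refArea : ℝ) : ℂ) * ∑ c, T.cellGrad ψ K c * star (T.cellGrad χ K c) := by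
  rw [stiffForm, gradInner, T.setIntegral_eq_sum_of_ae hΩ
    (g := fun K _ => ∑ c, T.cellGrad ψ K c * star (T.cellGrad χ K c))
    (fun K => integrableOn_refTri continuous_const) fun K => ?_]
  · refine Finset.sum_congr rfl fun K _ => ?_
    rw [setIntegral_const, smul_smul, Complex.real_smul, refArea, setIntegral_const, smul_eq_mul,
      mul_one]
  · filter_upwards [T.ae_mem_interior_cell K] with x hx hK
    simp only [T.partialDeriv_eq_cellGrad _ (hx hK)]

end Forms

end Triangulation

/-! ### Norm equivalence, positivity and the bounds for the quadrature error -/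

theorem formNorm_le_of_re_le {V : Type*} [AddCommGroup V] [Module ℂ V] {m n : V → V → ℂ} {x : V}
    {C : ℝ} (hC : 0 ≤ C) (h : (m x x).re ≤ C * (n x x).re) :
    formNorm m x ≤ Real.sqrt C * formNorm n x := by
  rw [formNorm, formNorm, ← Real.sqrt_mul hC]
  exact Real.sqrt_le_sqrt h

theorem mul_star_self (z : ℂ) : z * star z = ((‖z‖ ^ 2 : ℝ) : ℂ) := by
  rw [Complex.star_def, Complex.mul_conj, Complex.normSq_eq_norm_sq]

namespace Triangulation

variable {Ω : Set Plane} (T : Triangulation Ω)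

theorem l2Norm_eq_formNorm (χ : T.femSpace) : l2Norm Ω χ = formNorm T.massForm χ := by
  rw [l2Norm, formNorm, massForm, l2Inner]
  simp only [mul_star_self]
  rw [integral_complex_ofReal, Complex.ofReal_re]

theorem gradNorm_eq_formNorm (χ : T.femSpace) : gradNorm Ω χ = formNorm T.stiffForm χ := by
  rw [gradNorm, formNorm, stiffForm, gradInner]
  simp only [mul_star_self, ← Complex.ofReal_sum]
  rw [integral_complex_ofReal, Complex.ofReal_re]

/-- The weighted sum of the squares of the nodal values. -/
noncomputable def nodalSq (χ : T.femSpace) : ℝ := ∑ K, T.jac K * ∑ i, ‖T.nodal χ K i‖ ^ 2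

theorem nodalSq_pos {χ : T.femSpace} (hχ : χ ≠ 0) : 0 < T.nodalSq χ := by
  obtain ⟨K, hK⟩ : ∃ K, T.nodal χ K ≠ 0 := by
    by_contra! h
    exact hχ (T.eq_zero_of_nodal h)
  obtain ⟨i, hi⟩ := Function.ne_iff.1 hK
  refine Finset.sum_pos' (fun L _ => mul_nonneg (T.jac_pos L).le
    (Finset.sum_nonneg fun i _ => sq_nonneg _)) ⟨K, Finset.mem_univ K, mul_pos (T.jac_pos K) ?_⟩
  exact Finset.sum_pos' (fun i _ => sq_nonneg _)
    ⟨i, Finset.mem_univ i, pow_pos (norm_pos_iff.2 hi) 2⟩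

theorem nodalSum_self_re (α γ : ℝ) (χ : T.femSpace) : (T.nodalSum α γ χ χ).re
    = ∑ K, T.jac K * (nodalForm α γ (T.nodal χ K) (T.nodal χ K)).re := by
  simp only [nodalSum, Complex.re_sum, Complex.re_ofReal_mul]

theorem le_nodalSum_self_re (α : ℝ) {γ : ℝ} (hγ : 0 ≤ γ) (χ : T.femSpace) :
    α * T.nodalSq χ ≤ (T.nodalSum α γ χ χ).re := by
  rw [nodalSum_self_re, nodalSq, Finset.mul_sum]
  refine Finset.sum_le_sum fun K _ => ?_
  rw [mul_left_comm]
  exact mul_le_mul_of_nonneg_left (le_nodalForm_self_re α hγ _) (T.jac_pos K).le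

theorem nodalSum_self_re_le (α : ℝ) {γ : ℝ} (hγ : 0 ≤ γ) (χ : T.femSpace) :
    (T.nodalSum α γ χ χ).re ≤ (α + 3 * γ) * T.nodalSq χ := by
  rw [nodalSum_self_re, nodalSq, Finset.mul_sum]
  refine Finset.sum_le_sum fun K _ => ?_
  rw [mul_left_comm]
  exact mul_le_mul_of_nonneg_left (nodalForm_self_re_le α hγ _) (T.jac_pos K).le

theorem isInnerForm_nodalSum {α γ : ℝ} (hα : 0 < α) (hγ : 0 ≤ γ) :
    IsInnerForm (T.nodalSum α γ) where
  add_left x y z := by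
    simp only [nodalSum, nodal_add, nodalForm_add_left, mul_add, Finset.sum_add_distrib]
  smul_left c x y := by
    simp only [nodalSum, nodal_smul, nodalForm_smul_left, Finset.mul_sum]
    exact Finset.sum_congr rfl fun K _ => mul_left_comm _ _ _
  symm x y := by
    simp only [nodalSum, star_sum, star_mul', star_nodalForm, Complex.star_def, Complex.conj_ofReal]
  pos x hx := (mul_pos hα (T.nodalSq_pos hx)).trans_le (T.le_nodalSum_self_re α hγ x)

/-- The weighted sum of the squares of the differences of the nodal values. -/
noncomputable def jumpSq (χ : T.femSpace) : ℝ :=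
  ∑ K, T.jac K * ∑ i, ∑ j, ‖T.nodal χ K i - T.nodal χ K j‖ ^ 2

theorem jumpSq_le_nodalSq (χ : T.femSpace) : T.jumpSq χ ≤ 12 * T.nodalSq χ := by
  rw [jumpSq, nodalSq, Finset.mul_sum]
  refine Finset.sum_le_sum fun K _ => ?_
  rw [mul_left_comm]
  exact mul_le_mul_of_nonneg_left (sum_norm_sub_sq_le _) (T.jac_pos K).le

/-- Cauchy-Schwarz over all triples of a triangle and two vertices, with each Jacobian split into
two square roots. -/
theorem norm_sum_jumpForm_le (ψ χ : T.femSpace) :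
    ‖∑ K, T.jac K * jumpForm (T.nodal ψ K) (T.nodal χ K)‖
      ≤ Real.sqrt (T.jumpSq ψ) * Real.sqrt (T.jumpSq χ) := by
  let f : T.femSpace → T.cells × Fin 3 × Fin 3 → ℝ := fun χ x =>
    Real.sqrt (T.jac x.1) * ‖T.nodal χ x.1 x.2.1 - T.nodal χ x.1 x.2.2‖
  have h1 : ∀ χ, T.jumpSq χ = ∑ x, f χ x ^ 2 := fun χ => by
    simp only [f, Fintype.sum_prod_type, jumpSq, Finset.mul_sum, mul_pow,
      Real.sq_sqrt (T.jac_pos _).le]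
  rw [h1, h1]
  refine le_trans ?_ (Real.sum_mul_le_sqrt_mul_sqrt _ _ _)
  simp only [f, Fintype.sum_prod_type]
  refine (norm_sum_le _ _).trans (Finset.sum_le_sum fun K _ => ?_)
  rw [jumpForm, Finset.mul_sum]
  refine (norm_sum_le _ _).trans (Finset.sum_le_sum fun i _ => ?_)
  rw [Finset.mul_sum]
  refine (norm_sum_le _ _).trans (Finset.sum_le_sum fun j _ => le_of_eq ?_)
  rw [norm_mul, norm_mul, norm_star, Complex.norm_real, Real.norm_of_nonneg (T.jac_pos K).le]
  nth_rw 1 [← Real.mul_self_sqrt (T.jac_pos K).le]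
  ring

section Forms

variable (hΩ : IsConvexPolygonalDomain Ω)
include hΩ

theorem stiffForm_self_re (χ : T.femSpace) : (T.stiffForm χ χ).re
    = ∑ K, T.jac K * refArea * ∑ c, ‖T.cellGrad χ K c‖ ^ 2 := by
  rw [T.stiffForm_eq hΩ]
  simp only [mul_star_self, ← Complex.ofReal_sum, ← Complex.ofReal_mul, Complex.ofReal_re]

/-- On a triangle the gradient is constant, so each of the nine pairs of vertices contributes at
most `h²` times its square; `refArea` converts the Jacobian into the area. -/
theorem jumpSq_le_stiffForm (χ : T.femSpace) :
    T.jumpSq χ ≤ 9 / refArea * T.meshSize ^ 2 * (T.stiffForm χ χ).re := by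
  have hA := refArea_pos
  rw [T.stiffForm_self_re hΩ, jumpSq, Finset.mul_sum]
  refine Finset.sum_le_sum fun K _ => ?_
  have h1 : ∑ i, ∑ j, ‖T.nodal χ K i - T.nodal χ K j‖ ^ 2
      ≤ 9 * (T.meshSize ^ 2 * ∑ c, ‖T.cellGrad χ K c‖ ^ 2) := by
    refine (Finset.sum_le_sum fun i _ => Finset.sum_le_sum fun j _ =>
      T.norm_sub_sq_le χ (T.vertex_mem_cell K i) (T.vertex_mem_cell K j)).trans_eq ?_
    simp only [Finset.sum_const, Finset.card_univ, Fintype.card_fin, nsmul_eq_mul]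
    ring
  refine (mul_le_mul_of_nonneg_left h1 (T.jac_pos K).le).trans_eq ?_
  field_simp

/-- If all gradients vanish, `χ` is constant on each triangle and takes finitely many values on the
connected set `closure Ω`. A connected finite set of values is a single one, namely the value zero
at a boundary point. -/
theorem eq_zero_of_stiffForm {χ : T.femSpace} (h : (T.stiffForm χ χ).re ≤ 0) : χ = 0 := by
  have hG : ∀ K c, T.cellGrad χ K c = 0 := by
    by_contra! h1
    obtain ⟨K, c, hc⟩ := h1
    rw [T.stiffForm_self_re hΩ] at h
    refine h.not_gt (Finset.sum_pos' (fun L _ => mul_nonneg (mul_pos (T.jac_pos L) refArea_pos).le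
      (Finset.sum_nonneg fun i _ => sq_nonneg _)) ⟨K, Finset.mem_univ K,
        mul_pos (mul_pos (T.jac_pos K) refArea_pos) ?_⟩)
    exact Finset.sum_pos' (fun i _ => sq_nonneg _)
      ⟨c, Finset.mem_univ c, pow_pos (norm_pos_iff.2 hc) 2⟩
  have hfin : ((χ : Plane → ℂ) '' closure Ω).Finite := by
    refine (Set.finite_range fun K => T.nodal χ K 0).subset ?_
    rintro _ ⟨x, hx, rfl⟩
    rw [← T.iUnion_cell] at hx
    obtain ⟨K, hK⟩ := Set.mem_iUnion.1 hx
    refine ⟨K, (sub_eq_zero.1 ?_).symm⟩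
    change (χ : Plane → ℂ) x - (χ : Plane → ℂ) (T.vertex K 0) = 0
    rw [T.sub_eq_sum_cellGrad χ hK (T.vertex_mem_cell K 0)]
    simp [hG]
  have hconn : IsPreconnected ((χ : Plane → ℂ) '' closure Ω) :=
    hΩ.convex.closure.isPreconnected.image _ χ.2.1
  have hsub : ((χ : Plane → ℂ) '' closure Ω).Subsingleton := by
    by_contra h1
    exact hconn.infinite_of_nontrivial (Set.not_subsingleton_iff.1 h1) hfin
  obtain ⟨x₀, hx₀, hx₀'⟩ := hΩ.exists_mem_closure_notMem
  refine Subtype.ext (funext fun x => ?_)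
  by_cases hx : x ∈ Ω
  · rw [hsub ⟨x, subset_closure hx, rfl⟩ ⟨x₀, hx₀, rfl⟩]
    exact χ.2.2.2 x₀ hx₀'
  · exact χ.2.2.2 x hx

theorem isInnerForm_stiffForm : IsInnerForm T.stiffForm where
  add_left x y z := by
    simp only [T.stiffForm_eq hΩ, cellGrad_add, add_mul, mul_add, Finset.sum_add_distrib]
  smul_left c x y := by
    simp only [T.stiffForm_eq hΩ, cellGrad_smul, mul_assoc, Finset.mul_sum]
    exact Finset.sum_congr rfl fun K _ => Finset.sum_congr rfl fun i _ => by ring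
  symm x y := by
    simp only [T.stiffForm_eq hΩ, star_sum, star_mul', Complex.star_def,
      Complex.conj_ofReal, Complex.conj_conj, mul_comm]
  pos x hx := by
    by_contra h
    exact hx (T.eq_zero_of_stiffForm hΩ (not_lt.1 h))

end Forms

theorem formOperator_spec {m a : T.femSpace → T.femSpace → ℂ} (hm : IsInnerForm m)
    (a_add : ∀ x y z, a (x + y) z = a x z + a y z) (a_smul : ∀ (c : ℂ) x y, a (c • x) y = c * a x y)
    (a_add' : ∀ x y z, a x (y + z) = a x y + a x z)
    (a_smul' : ∀ (c : ℂ) x y, a x (c • y) = star c * a x y) (ψ χ : T.femSpace) :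
    m (T.formOperator m a ψ) χ = a ψ χ := by
  have h := hm.exists_operator a_add a_smul a_add' a_smul'
  rw [formOperator, dif_pos h]
  exact h.choose_spec ψ χ

end Triangulation

/-- The discretizations form a `QuadratureSetting`, with a universal constant. -/
theorem exists_quadratureSetting : ∃ K : ℝ, ∀ Ω : Set Plane, IsConvexPolygonalDomain Ω →
    ∀ T : Triangulation Ω, QuadratureSetting T.massForm T.dualMassForm T.stiffForm
      T.feLaplacian T.fveLaplacian T.quadError T.meshSize K := by
  obtain ⟨s, r, p, q, hr, hrs, hq, hqp, hsum, hR, hD⟩ := exists_moments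
  have hA := refArea_pos
  have hsr := sub_pos.2 hrs
  have hpq := sub_pos.2 hqp
  obtain ⟨d, hd, hd0⟩ : ∃ d, d = |(r - q) / 2| ∧ 0 ≤ d := ⟨_, rfl, abs_nonneg _⟩
  obtain ⟨k₁, hk₁, hk₁0⟩ : ∃ k, k = Real.sqrt (12 / (s - r)) ∧ 0 ≤ k :=
    ⟨_, rfl, Real.sqrt_nonneg _⟩
  obtain ⟨k₂, hk₂, hk₂0⟩ : ∃ k, k = Real.sqrt (9 / refArea) ∧ 0 ≤ k := ⟨_, rfl, Real.sqrt_nonneg _⟩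
  obtain ⟨k₃, hk₃, hk₃0⟩ : ∃ k, k = Real.sqrt ((p - q + 3 * q) / (s - r)) ∧ 0 ≤ k :=
    ⟨_, rfl, Real.sqrt_nonneg _⟩
  obtain ⟨k₄, hk₄, hk₄0⟩ : ∃ k, k = Real.sqrt ((s - r + 3 * r) / (p - q)) ∧ 0 ≤ k :=
    ⟨_, rfl, Real.sqrt_nonneg _⟩
  -- Each of the four bounds needs one of the summands; all depend only on the moments and the area
  -- of the reference triangle.
  refine ⟨k₃ + k₄ + d * (k₂ * k₂) + d * (k₁ * k₂), fun Ω hΩ T => ?_⟩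
  have h1 : 0 ≤ d * (k₂ * k₂) := by positivity
  have h2 : 0 ≤ d * (k₁ * k₂) := by positivity
  have hh := T.meshSize_nonneg
  have em : T.massForm = T.nodalSum (s - r) r := funext₂ (T.massForm_eq hΩ hR)
  have emh : T.dualMassForm = T.nodalSum (p - q) q := funext₂ (T.dualMassForm_eq hΩ hD)
  have hm : IsInnerForm T.massForm := em ▸ T.isInnerForm_nodalSum hsr hr
  have hmh : IsInnerForm T.dualMassForm := emh ▸ T.isInnerForm_nodalSum hpq hq
  have ha := T.isInnerForm_stiffForm hΩ
  -- The common source of both quadrature bounds: each jump factor can be estimated by the `L²` norm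
  -- (`hj₁`) or by `h` times the gradient norm (`hj₂`).
  have hquad : ∀ x y, ‖T.dualMassForm x y - T.massForm x y‖
      ≤ d * (Real.sqrt (T.jumpSq x) * Real.sqrt (T.jumpSq y)) := fun x y => by
    have : T.dualMassForm x y - T.massForm x y = ((r - q) / 2 : ℝ) *
        ∑ K, T.jac K * jumpForm (T.nodal x K) (T.nodal y K) := by
      rw [em, emh, Triangulation.nodalSum, Triangulation.nodalSum, ← Finset.sum_sub_distrib,
        Finset.mul_sum]
      refine Finset.sum_congr rfl fun K _ => ?_
      rw [← mul_sub, nodalForm_sub_nodalForm hsum]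
      ring
    rw [this, norm_mul, Complex.norm_real, hd]
    exact mul_le_mul_of_nonneg_left (T.norm_sum_jumpForm_le x y) (abs_nonneg _)
  have hj₁ : ∀ x, Real.sqrt (T.jumpSq x) ≤ k₁ * formNorm T.massForm x := fun x => by
    rw [hk₁, formNorm, ← Real.sqrt_mul (by positivity)]
    refine Real.sqrt_le_sqrt ((T.jumpSq_le_nodalSq x).trans ?_)
    have := T.le_nodalSum_self_re (s - r) hr x
    rw [em, div_mul_eq_mul_div, le_div_iff₀ hsr]
    linarith
  have hj₂ : ∀ x, Real.sqrt (T.jumpSq x) ≤ k₂ * T.meshSize * formNorm T.stiffForm x := fun x => by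
    rw [hk₂, formNorm]
    nth_rw 1 [← Real.sqrt_sq hh]
    rw [← Real.sqrt_mul (by positivity), ← Real.sqrt_mul (by positivity)]
    exact Real.sqrt_le_sqrt (T.jumpSq_le_stiffForm hΩ x)
  have hna : ∀ x, 0 ≤ formNorm T.stiffForm x := fun x => Real.sqrt_nonneg _
  have hnm : ∀ x, 0 ≤ formNorm T.massForm x := fun x => Real.sqrt_nonneg _
  exact
    { inner := hm
      innerh := hmh
      energy := ha
      A_spec := T.formOperator_spec hm ha.add_left ha.smul_left ha.add_right ha.smul_right
      Ab_spec := T.formOperator_spec hmh ha.add_left ha.smul_left ha.add_right ha.smul_right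
      Q_spec := T.formOperator_spec (a := T.quadForm) ha
        (fun x y z => by
          simp only [Triangulation.quadForm, hm.add_left, hmh.add_left]
          ring)
        (fun c x y => by
          simp only [Triangulation.quadForm, hm.smul_left, hmh.smul_left]
          ring)
        (fun x y z => by
          simp only [Triangulation.quadForm, hm.add_right, hmh.add_right]
          ring)
        (fun c x y => by
          simp only [Triangulation.quadForm, hm.smul_right, hmh.smul_right]
          ring)
      h_nonneg := hh
      K_nonneg := by positivity
      normh_le := fun x => by
        have h3 : formNorm T.dualMassForm x ≤ k₃ * formNorm T.massForm x := by
          rw [hk₃]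
          refine formNorm_le_of_re_le (by positivity) ?_
          have h4 := T.nodalSum_self_re_le (p - q) hq x
          have h5 := T.le_nodalSum_self_re (s - r) hr x
          rw [em, emh, div_mul_eq_mul_div, le_div_iff₀ hsr]
          nlinarith [mul_le_mul_of_nonneg_left h4 hsr.le,
            mul_le_mul_of_nonneg_left h5 (by positivity : 0 ≤ p - q + 3 * q)]
        exact h3.trans (mul_le_mul_of_nonneg_right (by linarith) (hnm x))
      norm_le := fun x => by
        have h3 : formNorm T.massForm x ≤ k₄ * formNorm T.dualMassForm x := by
          rw [hk₄]
          refine formNorm_le_of_re_le (by positivity) ?_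
          have h4 := T.nodalSum_self_re_le (s - r) hr x
          have h5 := T.le_nodalSum_self_re (p - q) hq x
          rw [em, emh, div_mul_eq_mul_div, le_div_iff₀ hpq]
          nlinarith [mul_le_mul_of_nonneg_left h4 hpq.le,
            mul_le_mul_of_nonneg_left h5 (by positivity : 0 ≤ s - r + 3 * r)]
        exact h3.trans (mul_le_mul_of_nonneg_right (by linarith) (Real.sqrt_nonneg _))
      quad_le := fun x y => by
        have hx := hna x
        have hy := hna y
        calc _ ≤ d * ((k₂ * T.meshSize * formNorm T.stiffForm x) *
              (k₂ * T.meshSize * formNorm T.stiffForm y)) :=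
              (hquad x y).trans (by gcongr; exacts [hj₂ x, hj₂ y])
          _ = d * (k₂ * k₂) * (T.meshSize ^ 2 * formNorm T.stiffForm x * formNorm T.stiffForm y) := by
              ring
          _ ≤ (k₃ + k₄ + d * (k₂ * k₂) + d * (k₁ * k₂)) *
              (T.meshSize ^ 2 * formNorm T.stiffForm x * formNorm T.stiffForm y) :=
              mul_le_mul_of_nonneg_right (by linarith) (by positivity)
          _ = _ := by ring
      quad_le_left := fun x y => by
        have hx := hnm x
        have hy := hna y
        calc _ ≤ d * ((k₁ * formNorm T.massForm x) *
              (k₂ * T.meshSize * formNorm T.stiffForm y)) :=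
              (hquad x y).trans (by gcongr; exacts [hj₁ x, hj₂ y])
          _ = d * (k₁ * k₂) * (T.meshSize * formNorm T.massForm x * formNorm T.stiffForm y) := by
              ring
          _ ≤ (k₃ + k₄ + d * (k₂ * k₂) + d * (k₁ * k₂)) *
              (T.meshSize * formNorm T.massForm x * formNorm T.stiffForm y) :=
              mul_le_mul_of_nonneg_right (by linarith) (by positivity)
          _ = _ := by ring }

theorem ContourIntegrable.congr {φ θ δ : ℝ} (h : ContourAngles φ θ) (hδ : 0 < δ) {f g : ℂ → ℂ}
    (hf : ContourIntegrable φ δ f) (hfg : ∀ z ∈ contourSupport θ δ, f z = g z) :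
    ContourIntegrable φ δ g := by
  obtain ⟨h1, h2, h3⟩ := hf
  refine ⟨?_, ?_, ?_⟩
  · rw [exp_neg_mul_I] at h1 ⊢
    refine h1.congr_fun (fun ρ hρ => ?_) measurableSet_Ioi
    simp only [hfg _ (h.lower_mem_support hδ hρ)]
  · refine h2.congr fun ψ hψ => ?_
    rw [Set.uIoc_of_le (by linarith [h.pos])] at hψ
    simp only [hfg _ (h.arc_mem_support hδ (Set.Ioc_subset_Icc_self hψ))]
  · refine h3.congr_fun (fun ρ hρ => ?_) measurableSet_Ioi
    simp only [hfg _ (h.upper_mem_support hδ hρ)]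

/-! ### Contour integrals of resolvents -/

section Resolvent

variable {V : Type*} [AddCommGroup V] [Module ℂ V] {θ θ' φ : ℝ} {β : ℂ → ℂ}
  (hβ : IsSectorialKernel θ θ' β) (hφ : φ ∈ Set.Ioo (Real.pi / 2) θ) {t : ℝ} (ht : 0 < t)
include hβ hφ ht

/-- Partial fractions reduce the operator-valued integrand to the scalar functions `β / (zβ + lᵢ)`,
which are holomorphic and bounded by a multiple of `1/|z|`. -/
theorem contourIntegral_resolvent {B : Module.End ℂ V} {ι : Type*} [Fintype ι]
    {b : Module.Basis ι ℂ V} {l : ι → ℝ} (hl : ∀ i, 0 ≤ l i)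
    (hb : ∀ θ ∈ Set.Ioo (Real.pi / 2) Real.pi, ∀ ζ ∈ sector θ, ∀ v : V,
      Ring.inverse (ζ • (1 : Module.End ℂ V) + B) v = ∑ i, (ζ + l i)⁻¹ • (b.repr v i • b i))
    (ℓ : V →ₗ[ℂ] ℂ) (v : V) :
    ContourIntegrable φ (1 / t) (fun z => Complex.exp (z * t) *
        ℓ (β z • Ring.inverse ((z * β z) • (1 : Module.End ℂ V) + B) v)) ∧
      contourIntegral φ (1 / t) (fun z => Complex.exp (z * t) *
        ℓ (β z • Ring.inverse ((z * β z) • (1 : Module.End ℂ V) + B) v))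
      = ∑ i, ℓ (b.repr v i • b i) * contourIntegral φ (1 / t)
          (fun z => Complex.exp (z * t) * (β z * (z * β z + l i)⁻¹)) := by
  have hφ' := hβ.contourAngles hφ
  have ht' : 0 < 1 / t := one_div_pos.2 ht
  have hint : ∀ i, ContourIntegrable φ (1 / t)
      (fun z => Complex.exp (z * t) * (β z * (z * β z + l i)⁻¹)) := fun i =>
    contourIntegrable_exp_mul hφ' ht ht' (hβ.resolvent_differentiableOn (hl i)).continuousOn
      (M := sectorConst θ') (s := -1) fun z hz =>
        (hβ.norm_resolvent_le (hl i) hz).trans_eq (mul_norm_rpow_neg_one _ z).symm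
  have h1 : ∀ z ∈ contourSupport θ (1 / t),
      ∑ i, ℓ (b.repr v i • b i) * (Complex.exp (z * t) * (β z * (z * β z + l i)⁻¹))
        = Complex.exp (z * t) *
          ℓ (β z • Ring.inverse ((z * β z) • (1 : Module.End ℂ V) + B) v) := fun z hz => by
    rw [hb θ' hβ.angle' _ (hβ.mapsTo z hz.1) v]
    simp only [map_smul, map_sum, smul_eq_mul, Finset.mul_sum]
    exact Finset.sum_congr rfl fun i _ => by ring
  refine ⟨ContourIntegrable.congr hφ' ht' (ContourIntegrable.sum _ _ hint) h1, ?_⟩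
  rw [← contourIntegral_congr hφ' ht' h1, contourIntegral_sum _ _ hint]

/-- The contour integral of the resolvent of a form operator is represented by a vector. -/
theorem exists_resolvent_vector [FiniteDimensional ℂ V] {m a : V → V → ℂ} (hm : IsInnerForm m)
    (ha : IsInnerForm a) {B : Module.End ℂ V} (hB : ∀ x y, m (B x) y = a x y) (v : V) :
    ∃ X : V, ∀ ℓ : V →ₗ[ℂ] ℂ, ContourIntegrable φ (1 / t) (fun z => Complex.exp (z * t) *
        ℓ (β z • Ring.inverse ((z * β z) • (1 : Module.End ℂ V) + B) v)) ∧
      contourIntegral φ (1 / t) (fun z => Complex.exp (z * t) *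
        ℓ (β z • Ring.inverse ((z * β z) • (1 : Module.End ℂ V) + B) v)) = ℓ X := by
  obtain ⟨b, l, hl, -, hb⟩ := exists_resolvent_expansion hm ha hB
  refine ⟨∑ i, contourIntegral φ (1 / t) (fun z => Complex.exp (z * t) *
    (β z * (z * β z + l i)⁻¹)) • (b.repr v i • b i), fun ℓ => ?_⟩
  obtain ⟨h1, h2⟩ := contourIntegral_resolvent hβ hφ ht hl hb ℓ v
  refine ⟨h1, h2.trans ?_⟩
  rw [map_sum]
  exact Finset.sum_congr rfl fun i _ => (mul_comm _ _).trans (map_smul ℓ _ _).symm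

namespace QuadratureSetting

variable [FiniteDimensional ℂ V] {m mh a : V → V → ℂ} {A Ab Q : Module.End ℂ V} {h K : ℝ}
  (S : QuadratureSetting m mh a A Ab Q h K)
include S

theorem contourIntegral_errorTransform (ℓ : V →ₗ[ℂ] ℂ) (v : V) :
    contourIntegral φ (1 / t) (fun z => Complex.exp (z * t) * ℓ (errorTransform A Ab Q β v z))
      = contourIntegral φ (1 / t) (fun z => Complex.exp (z * t) *
          ℓ (β z • Ring.inverse ((z * β z) • (1 : Module.End ℂ V) + A) v))
        - contourIntegral φ (1 / t) (fun z => Complex.exp (z * t) *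
          ℓ (β z • Ring.inverse ((z * β z) • (1 : Module.End ℂ V) + Ab) v)) := by
  obtain ⟨X, hX⟩ := exists_resolvent_vector hβ hφ ht S.inner S.energy S.A_spec v
  obtain ⟨Y, hY⟩ := exists_resolvent_vector hβ hφ ht S.innerh S.energy S.Ab_spec v
  rw [contourIntegral_congr (hβ.contourAngles hφ) (one_div_pos.2 ht) fun z hz => by
    rw [S.errorTransform_eq hβ hz.1, map_sub, mul_sub, sub_eq_add_neg, ← neg_one_mul],
    contourIntegral_add (hX ℓ).1 ((hY ℓ).1.const_mul _), contourIntegral_const_mul]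
  ring

/-- The error is represented by a vector that commutes with linear functionals. -/
theorem exists_error_vector (v : V) :
    ∃ X : V, ∀ ℓ : V →ₗ[ℂ] ℂ, ℓ X = -(2 * Real.pi * Complex.I)⁻¹ *
      contourIntegral φ (1 / t) (fun z =>
        Complex.exp (z * t) * ℓ (errorTransform A Ab Q β v z)) := by
  obtain ⟨X, hX⟩ := exists_resolvent_vector hβ hφ ht S.inner S.energy S.A_spec v
  obtain ⟨Y, hY⟩ := exists_resolvent_vector hβ hφ ht S.innerh S.energy S.Ab_spec v
  refine ⟨-(2 * Real.pi * Complex.I : ℂ)⁻¹ • (X - Y), fun ℓ => ?_⟩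
  rw [S.contourIntegral_errorTransform hβ hφ ht, (hX ℓ).2, (hY ℓ).2, map_smul, map_sub, smul_eq_mul]

end QuadratureSetting

end Resolvent

/-! ### Representation of the semidiscrete solutions -/

namespace Triangulation

variable {Ω : Set Plane} (T : Triangulation Ω)

/-- Linear functionals on the finite element space are combinations of nodal values. -/
theorem exists_eq_sum_nodal (L : T.femSpace →ₗ[ℂ] ℂ) :
    ∃ (n : ℕ) (c : Fin n → ℂ) (x : Fin n → Plane),
      ∀ w : T.femSpace, L w = ∑ k, c k * (w : Plane → ℂ) (x k) := by
  let f : T.femSpace →ₗ[ℂ] (T.cells × Fin 3 → ℂ) :=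
    { toFun := fun w k => T.nodal w k.1 k.2
      map_add' := fun _ _ => rfl
      map_smul' := fun _ _ => rfl }
  have hf : LinearMap.ker f = ⊥ := LinearMap.ker_eq_bot'.2 fun w hw =>
    T.eq_zero_of_nodal fun K => funext fun i => congrFun hw (K, i)
  -- Nodal values determine the function, so any functional factors through them by way of a left
  -- inverse.
  obtain ⟨g, hg⟩ := f.exists_leftInverse_of_injective hf
  let e := (Fintype.equivFin (T.cells × Fin 3)).symm
  classical
  refine ⟨_, fun k => L (g fun j => if e k = j then 1 else 0),
    fun k => T.vertex (e k).1 (e k).2, fun w => ?_⟩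
  have h1 : L w = (L ∘ₗ g) (f w) := congrArg L (LinearMap.congr_fun hg w).symm
  rw [h1, LinearMap.pi_apply_eq_sum_univ (L ∘ₗ g), ← Equiv.sum_comp e]
  exact Finset.sum_congr rfl fun k _ => mul_comm _ _

section Solution

variable {T} {κ : ℝ → ℝ} {B : Module.End ℂ T.femSpace} {v : T.femSpace} {u : ℝ → T.femSpace}
  (hu : T.IsSolution κ B v u)
include hu

theorem IsSolution.continuousOn (L : T.femSpace →ₗ[ℂ] ℂ) :
    ContinuousOn (fun t => L (u t)) (Set.Ici 0) := by
  obtain ⟨n, c, x, hL⟩ := T.exists_eq_sum_nodal L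
  simp only [hL]
  exact continuousOn_finsetSum _ fun k _ => continuousOn_const.mul (hu.cont (x k))

/-- The equation is given pointwise in space, while the scalar theory needs coordinates along
eigenvectors. Every functional is a finite combination of point values, so the equation passes to
`L`; integrability of `κ` near zero allows the sum to enter the integral. -/
theorem IsSolution.hasDerivAt {β : ℂ → ℂ} (hκ : HasSymbol κ β) (L : T.femSpace →ₗ[ℂ] ℂ) {t : ℝ}
    (ht : 0 < t) : ∃ d : ℂ, HasDerivAt (fun τ => L (u τ)) d t ∧
      HasDerivAt (fun τ : ℝ => ∫ s in (0 : ℝ)..τ, (κ (τ - s) : ℂ) * L (B (u s))) (-d) t := by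
  obtain ⟨n, c, x, hL⟩ := T.exists_eq_sum_nodal L
  choose d hd hd' using fun k => hu.eqn t ht (x k)
  obtain ⟨a, -, hLap⟩ := hκ
  refine ⟨∑ k, c k * d k, ?_, ?_⟩
  · simp only [hL]
    exact HasDerivAt.fun_sum fun k _ => (hd k).const_mul (c k)
  · have h1 : HasDerivAt (fun τ : ℝ => ∑ k, c k * ∫ s in (0 : ℝ)..τ,
        (κ (τ - s) : ℂ) * (B (u s) : Plane → ℂ) (x k)) (-∑ k, c k * d k) t := by
      rw [← Finset.sum_neg_distrib]
      simp only [← mul_neg]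
      exact HasDerivAt.fun_sum fun k _ => (hd' k).const_mul (c k)
    refine h1.congr_of_eventuallyEq ?_
    filter_upwards [lt_mem_nhds ht] with τ hτ
    have hi : ∀ k, IntervalIntegrable (fun s => (κ (τ - s) : ℂ) * (B (u s) : Plane → ℂ) (x k))
        volume 0 τ := fun k => by
      refine intervalIntegrable_convolution (fun z hz => (hLap z hz).1) ?_ hτ.le
      exact hu.continuousOn (LinearMap.proj (x k) ∘ₗ T.femSpace.subtype ∘ₗ B)
    simp only [← intervalIntegral.integral_const_mul]
    rw [← intervalIntegral.integral_finsetSum fun k _ => (hi k).const_mul (c k)]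
    refine intervalIntegral.integral_congr fun s _ => ?_
    simp only [hL, Finset.mul_sum]
    exact Finset.sum_congr rfl fun k _ => mul_left_comm _ _ _

/-- Solutions are given by the inverse Laplace transform. -/
theorem IsSolution.apply_eq {θ θ' φ : ℝ} {β : ℂ → ℂ} (hβ : IsSectorialKernel θ θ' β)
    (hφ : φ ∈ Set.Ioo (Real.pi / 2) θ) (hκ : HasSymbol κ β) {m a : T.femSpace → T.femSpace → ℂ}
    (hm : IsInnerForm m) (ha : IsInnerForm a) (hB : ∀ x y, m (B x) y = a x y)
    (ℓ : T.femSpace →ₗ[ℂ] ℂ) {t : ℝ} (ht : 0 < t) :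
    ℓ (u t) = (2 * Real.pi * Complex.I)⁻¹ * contourIntegral φ (1 / t) (fun z =>
      Complex.exp (z * t) *
        ℓ (β z • Ring.inverse ((z * β z) • (1 : Module.End ℂ T.femSpace) + B) v)) := by
  obtain ⟨b, l, hl, hBb, hb⟩ := exists_resolvent_expansion hm ha hB
  -- In the eigenbasis the system decouples, and each coordinate solves a scalar equation with `l i`
  -- in place of `B`.
  have hcoord : ∀ i w, b.coord i (B w) = l i * b.coord i w := fun i w => by
    have h1 : b.coord i ∘ₗ B = (l i : ℂ) • b.coord i := b.ext fun j => by
      simp only [LinearMap.comp_apply, hBb, map_smul, LinearMap.smul_apply, Module.Basis.coord_apply,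
        Module.Basis.repr_self, smul_eq_mul, Finsupp.single_apply]
      split_ifs with h
      · rw [h]
      · rw [mul_zero, mul_zero]
    exact LinearMap.congr_fun h1 w
  have hy : ∀ i, b.coord i (u t) = b.coord i v * ((2 * Real.pi * Complex.I)⁻¹ *
      contourIntegral φ (1 / t) (fun z => Complex.exp (z * t) * (β z * (z * β z + l i)⁻¹))) := by
    intro i
    have h1 := scalar_solution_eq hβ hφ hκ (hl i) (hu.continuousOn (b.coord i)) (fun t ht => by
      have h2 := hu.hasDerivAt hκ (b.coord i) ht
      simpa only [hcoord] using h2) ht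
    rwa [hu.init] at h1
  rw [(contourIntegral_resolvent hβ hφ ht hl hb ℓ v).2, ← b.sum_repr (u t), map_sum, Finset.mul_sum]
  refine Finset.sum_congr rfl fun i _ => ?_
  rw [map_smul, map_smul, smul_eq_mul, smul_eq_mul, ← b.coord_apply, ← b.coord_apply, hy]
  ring

end Solution

end Triangulation

/-! ### The error of the finite volume element method -/

namespace Triangulation

variable {Ω : Set Plane} (T : Triangulation Ω)

/-- Evaluation of finite element functions at a point. -/
def evalAt (x : Plane) : T.femSpace →ₗ[ℂ] ℂ := LinearMap.proj x ∘ₗ T.femSpace.subtype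

/-- `xi` is defined pointwise in space; evaluation functionals identify it with a member of the
finite element space, so its `L²` and gradient norms become form norms. -/
theorem xi_eq_of_vector {β : ℂ → ℂ} {φ t : ℝ} {v X : T.femSpace}
    (hX : ∀ ℓ : T.femSpace →ₗ[ℂ] ℂ, ℓ X = -(2 * Real.pi * Complex.I)⁻¹ *
      contourIntegral φ (1 / t) (fun z => Complex.exp (z * t) *
        ℓ (errorTransform T.feLaplacian T.fveLaplacian T.quadError β v z))) :
    T.xi β φ v t = X :=
  funext fun x => (hX (T.evalAt x)).symm

section Error

variable {K : ℝ} (S : QuadratureSetting T.massForm T.dualMassForm T.stiffForm T.feLaplacian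
    T.fveLaplacian T.quadError T.meshSize K) {θ θ' φ : ℝ} {β : ℂ → ℂ}
  (hβ : IsSectorialKernel θ θ' β) (hφ : φ ∈ Set.Ioo (Real.pi / 2) θ)
include S hβ hφ

theorem solution_sub_eq_xi {κ : ℝ → ℝ} (hκ : HasSymbol κ β) {v : T.femSpace}
    {ubar u : ℝ → T.femSpace} (hubar : T.IsSolution κ T.fveLaplacian v ubar)
    (hu : T.IsSolution κ T.feLaplacian v u) {t : ℝ} (ht : 0 < t) :
    ((ubar t - u t : T.femSpace) : Plane → ℂ) = T.xi β φ v t := by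
  funext x
  have h1 := hubar.apply_eq hβ hφ hκ S.innerh S.energy S.Ab_spec (T.evalAt x) ht
  have h2 := hu.apply_eq hβ hφ hκ S.inner S.energy S.A_spec (T.evalAt x) ht
  have h3 := S.contourIntegral_errorTransform hβ hφ ht (T.evalAt x) v
  have h4 : T.xi β φ v t x = -(2 * Real.pi * Complex.I)⁻¹ * contourIntegral φ (1 / t) (fun z =>
      Complex.exp (z * t) * T.evalAt x
        (errorTransform T.feLaplacian T.fveLaplacian T.quadError β v z)) := rfl
  have h5 : ((ubar t - u t : T.femSpace) : Plane → ℂ) x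
      = T.evalAt x (ubar t) - T.evalAt x (u t) := rfl
  rw [h4, h5, h1, h2, h3]
  ring

/-- A bound for the transform of the error yields a bound for the error. -/
theorem errorNorm_le {v : T.femSpace} {M s t : ℝ} (ht : 0 < t)
    (hM : ∀ z ∈ sector θ,
      formNorm T.massForm (errorTransform T.feLaplacian T.fveLaplacian T.quadError β v z)
        + T.meshSize * formNorm T.stiffForm
          (errorTransform T.feLaplacian T.fveLaplacian T.quadError β v z) ≤ M * ‖z‖ ^ s) :
    T.errorNorm β φ v t ≤ 2 * (M * t ^ (-s - 1) * contourConst φ s) := by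
  have hφ' := hβ.contourAngles hφ
  have hh := S.h_nonneg
  have hn : ∀ W, 0 ≤ formNorm T.massForm W := fun W => Real.sqrt_nonneg _
  have hg : ∀ W, 0 ≤ formNorm T.stiffForm W := fun W => Real.sqrt_nonneg _
  obtain ⟨X, hX⟩ := S.exists_error_vector hβ hφ ht v
  rw [errorNorm, T.xi_eq_of_vector hX, l2Norm_eq_formNorm, gradNorm_eq_formNorm, two_mul]
  refine add_le_add (formNorm_contourIntegral_le S.inner hφ' ht hX fun z hz => ?_) ?_
  · exact (le_add_of_nonneg_right (mul_nonneg hh (hg _))).trans (hM z hz)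
  -- The weight `h` is moved into the vector, so that the bound for the weighted sum can be used for
  -- the gradient term, including when `h = 0`.
  · have h1 : T.meshSize * formNorm T.stiffForm X
        = formNorm T.stiffForm ((T.meshSize : ℂ) • X) := by
      rw [S.energy.formNorm_smul, Complex.norm_real, Real.norm_of_nonneg hh]
    rw [h1]
    refine formNorm_contourIntegral_le S.energy hφ' ht (W := fun z => (T.meshSize : ℂ) •
      errorTransform T.feLaplacian T.fveLaplacian T.quadError β v z) (fun ℓ => ?_) fun z hz => ?_
    · have h2 := hX ((T.meshSize : ℂ) • ℓ)
      simpa only [LinearMap.smul_apply, map_smul] using h2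
    · rw [S.energy.formNorm_smul, Complex.norm_real, Real.norm_of_nonneg hh]
      exact (le_add_of_nonneg_left (hn _)).trans (hM z hz)

end Error

end Triangulation

/-- Power bounds have positive constants. -/
theorem HasPowerBound.pos {θ θ' c μ : ℝ} {β : ℂ → ℂ} (hβ : IsSectorialKernel θ θ' β)
    (hp : HasPowerBound θ β c μ) : 0 < c := by
  have h1 : (1 : ℂ) ∈ sector θ :=
    ⟨one_ne_zero, by
      rw [Complex.arg_one, abs_zero]
      linarith [hβ.angle.1, Real.pi_pos]⟩
  have h2 := hp 1 h1
  have h3 : 0 < ‖β 1‖ := norm_pos_iff.2 fun h => (hβ.mapsTo 1 h1).1 (by rw [h, mul_zero])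
  rw [norm_one, Real.one_rpow, mul_one] at h2
  exact h3.trans_le h2

end FVE

/-! ### The main theorem -/

theorem mainTheorem8 :
    -- the discrete operators are well defined
    (∀ Ω : Set FVE.Plane, FVE.IsConvexPolygonalDomain Ω → ∀ T : FVE.Triangulation Ω,
      ∀ ψ χ : T.femSpace,
        T.massForm (T.feLaplacian ψ) χ = T.stiffForm ψ χ ∧
        T.dualMassForm (T.fveLaplacian ψ) χ = T.stiffForm ψ χ ∧
        T.stiffForm (T.quadError ψ) χ = T.quadForm ψ χ) ∧
    -- the general problem
    (∀ (Ω : Set FVE.Plane) (_ : FVE.IsConvexPolygonalDomain Ω) (σ : ℝ) (_ : 0 < σ)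
      (θ θ' φ : ℝ) (β : ℂ → ℂ) (_ : FVE.IsSectorialKernel θ θ' β)
      (_ : φ ∈ Set.Ioo (Real.pi / 2) θ),
      -- the error is the difference of the two semidiscrete solutions
      (∀ κ : ℝ → ℝ, FVE.HasSymbol κ β → ∀ T : FVE.Triangulation Ω, ∀ v : T.femSpace,
        ∀ ubar u : ℝ → T.femSpace,
          T.IsSolution κ T.fveLaplacian v ubar → T.IsSolution κ T.feLaplacian v u →
          ∀ t : ℝ, 0 < t → ((ubar t - u t : T.femSpace) : FVE.Plane → ℂ) = T.xi β φ v t) ∧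
      -- smooth data
      (∃ C : ℝ, 0 < C ∧ ∀ T : FVE.Triangulation Ω, T.IsShapeRegular σ →
        ∀ v : T.femSpace, ∀ t : ℝ, 0 < t →
          T.errorNorm β φ v t ≤ C * T.meshSize ^ 2 * FVE.l2Norm Ω (T.fveLaplacian v)) ∧
      -- data in the energy space
      (∀ μ c : ℝ, μ < 1 → FVE.HasPowerBound θ β c μ →
        ∃ C : ℝ, 0 < C ∧ ∀ T : FVE.Triangulation Ω, T.IsShapeRegular σ →
          ∀ v : T.femSpace, ∀ t : ℝ, 0 < t →
            T.errorNorm β φ v t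
              ≤ C * t ^ (-(μ + 1) / 2) * T.meshSize ^ 2 * FVE.gradNorm Ω v) ∧
      -- nonsmooth data, on meshes with a second order quadrature error
      (∀ μ c q : ℝ, FVE.HasPowerBound θ β c μ →
        ∃ C : ℝ, 0 < C ∧ ∀ T : FVE.Triangulation Ω, T.IsShapeRegular σ →
          (∀ χ : T.femSpace,
            FVE.l2Norm Ω (T.quadError χ) ≤ q * T.meshSize ^ 2 * FVE.l2Norm Ω χ) →
          ∀ v : T.femSpace, ∀ t : ℝ, 0 < t →
            T.errorNorm β φ v t
              ≤ C * t ^ (-(μ + 1)) * T.meshSize ^ 2 * FVE.l2Norm Ω v)) ∧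
    -- the examples: diffusion-wave, singular-kernel and Rayleigh-Stokes problems
    (∀ α γ : ℝ, 0 < α → α < 1 → 0 < γ →
      (FVE.HasSymbol (fun t => FVE.omega (1 + α) t) (fun z => z ^ (α : ℂ)) ∧
        ∃ θ θ' c : ℝ, FVE.IsSectorialKernel θ θ' (fun z => z ^ (α : ℂ)) ∧
          FVE.HasPowerBound θ (fun z => z ^ (α : ℂ)) c α) ∧
      (FVE.HasSymbol (fun t => 1 + FVE.omega (1 + α) t)
          (fun z => z ^ (α : ℂ) / (1 + z ^ (α : ℂ))) ∧
        ∃ θ θ' c : ℝ, FVE.IsSectorialKernel θ θ' (fun z => z ^ (α : ℂ) / (1 + z ^ (α : ℂ))) ∧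
          FVE.HasPowerBound θ (fun z => z ^ (α : ℂ) / (1 + z ^ (α : ℂ))) c α) ∧
      (FVE.HasSymbol (fun t => 1 + γ * FVE.omega (1 - α) t)
          (fun z => 1 / (1 + (γ : ℂ) * z ^ (α : ℂ))) ∧
        ∃ θ θ' c : ℝ, FVE.IsSectorialKernel θ θ' (fun z => 1 / (1 + (γ : ℂ) * z ^ (α : ℂ))) ∧
          FVE.HasPowerBound θ (fun z => 1 / (1 + (γ : ℂ) * z ^ (α : ℂ))) c (-α))) := by
  obtain ⟨K, hK⟩ := FVE.exists_quadratureSetting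
  refine ⟨fun Ω hΩ T ψ χ => ⟨(hK Ω hΩ T).A_spec ψ χ, (hK Ω hΩ T).Ab_spec ψ χ,
    (hK Ω hΩ T).Q_spec ψ χ⟩, fun Ω hΩ σ _ θ θ' φ β hβ hφ => ⟨?_, ?_, ?_, ?_⟩,
    fun α γ hα hα1 hγ => ?_⟩
  · intro κ hκ T v ubar u hubar hu t ht
    exact T.solution_sub_eq_xi (hK Ω hΩ T) hβ hφ hκ hubar hu ht
  · have hC := FVE.contourConst_pos (hβ.contourAngles hφ).pos (-1)
    have hs := FVE.sectorConst_pos hβ.angle'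
    -- The constant must be chosen before the triangulation; adding `1` makes it positive without
    -- knowing that `K` is nonzero.
    refine ⟨2 * (2 * FVE.sectorConst θ' ^ 2 * K ^ 4 * FVE.contourConst φ (-1)) + 1, by positivity,
      fun T _ v t ht => ?_⟩
    refine (T.errorNorm_le (hK Ω hΩ T) hβ hφ ht fun z hz =>
      (hK Ω hΩ T).errorTransform_le_smooth hβ hz v).trans ?_
    rw [T.l2Norm_eq_formNorm, neg_neg, sub_self, Real.rpow_zero]
    have h1 : 0 ≤ T.meshSize ^ 2 * FVE.formNorm T.massForm (T.fveLaplacian v) :=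
      mul_nonneg (sq_nonneg _) (Real.sqrt_nonneg _)
    linear_combination h1
  · intro μ c _ hp
    have hc := hp.pos hβ
    have hC := FVE.contourConst_pos (hβ.contourAngles hφ).pos ((μ - 1) / 2)
    have hs := FVE.sectorConst_pos hβ.angle'
    refine ⟨2 * (2 * FVE.sectorConst θ' ^ 2 * K ^ 2 * Real.sqrt c *
      FVE.contourConst φ ((μ - 1) / 2)) + 1, by positivity, fun T _ v t ht => ?_⟩
    refine (T.errorNorm_le (hK Ω hΩ T) hβ hφ ht fun z hz =>
      (hK Ω hΩ T).errorTransform_le_energy hβ hz v hc.le hp).trans ?_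
    rw [T.gradNorm_eq_formNorm, show -((μ - 1) / 2) - 1 = -(μ + 1) / 2 by ring]
    have h1 : 0 ≤ t ^ (-(μ + 1) / 2) * T.meshSize ^ 2 * FVE.formNorm T.stiffForm v :=
      mul_nonneg (mul_nonneg (Real.rpow_nonneg ht.le _) (sq_nonneg _)) (Real.sqrt_nonneg _)
    linear_combination h1
  · intro μ c q hp
    have hc := hp.pos hβ
    have hC := FVE.contourConst_pos (hβ.contourAngles hφ).pos μ
    have hs := FVE.sectorConst_pos hβ.angle'
    -- Neither `q` nor, before a triangulation is given, `K` is known to be nonnegative; hence `|q|`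
    -- here and `|k|` in the final constant.
    obtain ⟨k, hk⟩ : ∃ k, k = (K ^ 2 * (1 + FVE.sectorConst θ') * |q| + FVE.sectorConst θ' * K) *
      (1 + FVE.sectorConst θ') * c := ⟨_, rfl⟩
    refine ⟨2 * (|k| * FVE.contourConst φ μ) + 1, by positivity, fun T _ hq v t ht => ?_⟩
    refine (T.errorNorm_le (hK Ω hΩ T) hβ hφ ht fun z hz =>
      (hK Ω hΩ T).errorTransform_le_nonsmooth hβ hz v (abs_nonneg q) hp fun χ => ?_).trans ?_
    · have h1 := hq χ
      rw [T.l2Norm_eq_formNorm, T.l2Norm_eq_formNorm] at h1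
      refine h1.trans ?_
      have h2 : 0 ≤ FVE.formNorm T.massForm χ := Real.sqrt_nonneg _
      gcongr
      exact le_abs_self q
    · rw [T.l2Norm_eq_formNorm, show -(μ + 1) = -μ - 1 by ring, ← hk]
      have h1 : 0 ≤ t ^ (-μ - 1) * T.meshSize ^ 2 * FVE.formNorm T.massForm v :=
        mul_nonneg (mul_nonneg (Real.rpow_nonneg ht.le _) (sq_nonneg _)) (Real.sqrt_nonneg _)
      have h2 := mul_le_mul_of_nonneg_right (le_abs_self k) (mul_nonneg hC.le h1)
      linear_combination h1 + 2 * h2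
  · obtain ⟨θ, hθ, hθ', hαθ⟩ := FVE.exists_example_angle hα hα1
    exact ⟨⟨FVE.hasSymbol_diffusionWave hα, θ, _, 1,
        FVE.isSectorialKernel_diffusionWave hα hθ hθ' hαθ, FVE.hasPowerBound_diffusionWave α θ⟩,
      ⟨FVE.hasSymbol_singularKernel hα, θ, _, 1,
        FVE.isSectorialKernel_singularKernel hα hθ hθ' hαθ,
        FVE.hasPowerBound_singularKernel hα hαθ⟩,
      ⟨FVE.hasSymbol_rayleighStokes hα1 γ, θ, _, γ⁻¹,
        FVE.isSectorialKernel_rayleighStokes hα hα1 hγ hθ hαθ,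
        FVE.hasPowerBound_rayleighStokes hα hγ hαθ⟩⟩
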